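/- **Setting.** Let $\Omega=(\mathbb R/2\pi\mathbb Z)^2$. Let $H$ be the space of real $L^2$ vector fields on $\Omega$ that are mean-free and divergence-free in the sense of distributions, with $(u,v)=\int_\Omega u\cdot v\,dx$ and $|u|^2=(u,u)$; let $V$ be the subspace of $u\in H$ with $\partial_1u,\partial_2u\in L^2$, with norm $\|u\|^2=\sum_{j=1,2}\int_\Omega|\partial_ju|^2dx$. Let $\mathbb P$ be the Leray projection (the orthogonal projection of $L^2$ onto $H$), $A=-\mathbb P\Delta$ the Stokes operator with domain $D(A)$, $B(u,v)=\mathbb P((u\cdot\nabla)v)$, and, for real $N>0$, let $P_N$ be the projection onto the Fourier wavenumbers $|k|\le N$. Let $C_L,C_A>0$ be constants for which $$|u|_{L^4}^2\le C_L\|u\|\,|u|\quad(u\in V),\qquad |u|_{L^\infty}^2\le C_A|Au|\,|u|\quad(u\in D(A)).$$ Let $\nu>0$, $g_1,g_2\in L^\infty(0,\infty;H)$, and $\theta_1,\theta_2\ge0$ with $\theta_1+\theta_2=1$. The mutual synchronization intertwinement is the system $$\partial_tv_1+\nu Av_1+B(v_1,v_1)=g_1+\theta_1\bigl(P_NB(v_1,v_1)-P_NB(v_2,v_2)\bigr),\quad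 v_1(0)=v_0^1,$$ $$\partial_tv_2+\nu Av_2+B(v_2,v_2)=g_2+\theta_2\bigl(P_NB(v_2,v_2)-P_NB(v_1,v_1)\bigr),\quad v_2(0)=v_0^2.$$ A global strong solution is a pair of functions $v_1,v_2\in C([0,T];V)\cap L^2(0,T;D(A))$ with $\frac{dv_j}{dt}\in L^2(0,T;H)$ for all $T>0$ that satisfies the system. The system is called self-synchronous if $|g_1(t)-g_2(t)|\to0$ as $t\to\infty$ implies $|v_1(t)-v_2(t)|\to0$ as $t\to\infty$ for all $v_0^1,v_0^2\in V$ and every global strong solution $(v_1,v_2)$ with these initial data. Put $\lambda=\theta_1$, $\lambda_1=1-\lambda=\theta_2$, $\lambda_2=\lambda=\theta_1$, and $$\mathfrak g_\lambda=\frac{\operatorname{ess\,sup}_{t\ge0}|\lambda_1g_1(t)+\lambda_2g_2(t)|}{\nu^2}.$$ **Theorem.** The mutual synchronization intertwinement is self-synchronous for all sufficiently large $N$: there is $N_0=N_0(\nu,\theta_1,\theta_2,g_1,g_2)$ such that it is self-synchronous for every $N>0$ with $N\ge N_0$. In particular, it is self-synchronous for every $N>0$ such that $$N\ge\begin{cases}\max\left\{48\sqrt3\,C_L^2\,\mathfrak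 g_\lambda^2,\;C_AC_L^{-2}\right\},&\lambda\in\{0,1\},\\[2pt] 15\sqrt{27}\,C_L^2\,\mathfrak g_\lambda^2,&\lambda\in(0,1).\end{cases}$$ -/

import Mathlib

open MeasureTheory Filter Topology
open scoped ENNReal

noncomputable section

namespace NSE

/-- The period is positive; this equips the circle of length `2π` with its Lebesgue measure. -/
instance instFactTwoPiPos : Fact ((0 : ℝ) < 2 * Real.pi) := ⟨Real.two_pi_pos⟩

/-- The two-dimensional torus `Ω = (ℝ / 2πℤ)²`; its `volume` is Lebesgue measure, of mass `4π²`. -/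
abbrev Torus : Type := Fin 2 → AddCircle (2 * Real.pi)

/-- The plane with its Euclidean norm. -/
abbrev Plane : Type := EuclideanSpace ℝ (Fin 2)

/-- Square integrable real vector fields on the torus, a real Hilbert space with inner product
`(u, v) = ∫ u(x) · v(x) dx` and norm `|u|`. -/
abbrev L2 : Type := Lp Plane 2 (volume : Measure Torus)

/-- Wavenumbers. -/
abbrev Wave : Type := Fin 2 → ℤ

/-- The squared Euclidean length `|k|²`. -/
def waveSq (k : Wave) : ℝ := ∑ j, (k j : ℝ) ^ 2

/-- The wavenumber `k` as a vector of the plane. -/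
def waveVec (k : Wave) : Plane := WithLp.toLp 2 fun j => (k j : ℝ)

/-- The character `x ↦ exp (i k · x)`. -/
def character (k : Wave) : C(Torus, ℂ) :=
  ⟨fun x => ∏ j, fourier (k j) (x j), by fun_prop⟩

/-- The vector field `x ↦ cos (k · x) a`. -/
def cosMode (k : Wave) (a : Plane) : L2 :=
  ContinuousMap.toLp 2 volume ℝ
    (⟨fun x => (character k x).re • a, by fun_prop⟩ : C(Torus, Plane))

/-- The vector field `x ↦ sin (k · x) a`. -/
def sinMode (k : Wave) (a : Plane) : L2 :=
  ContinuousMap.toLp 2 volume ℝ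
    (⟨fun x => (character k x).im • a, by fun_prop⟩ : C(Torus, Plane))

/-- The space `H` of square integrable vector fields that are mean-free (orthogonal to the
constants) and divergence-free in the sense of distributions (orthogonal to the gradients
of `sin (k · x)` and of `- cos (k · x)`, for all `k`). -/
def H : Submodule ℝ L2 :=
  (Submodule.span ℝ
    ({f | ∃ a : Plane, f = cosMode 0 a} ∪ {f | ∃ k : Wave, f = cosMode k (waveVec k)} ∪
      {f | ∃ k : Wave, f = sinMode k (waveVec k)}))ᗮ

instance instHProj : H.HasOrthogonalProjection := by
  haveI : CompleteSpace H := by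
    unfold H
    exact Submodule.instOrthogonalCompleteSpace _
  exact Submodule.HasOrthogonalProjection.ofCompleteSpace _

/-- The Leray projection: the orthogonal projection of `L²` onto `H`. -/
def leray : L2 →L[ℝ] L2 := H.starProjection

/-- The fields with Fourier modes `|k| ≤ N` only. -/
def lowModes (N : ℝ) : Submodule ℝ L2 :=
  (Submodule.span ℝ
    {f | ∃ (k : Wave) (a : Plane), √(waveSq k) ≤ N ∧
      (f = cosMode k a ∨ f = sinMode k a)}).topologicalClosure

instance instLowModesProj (N : ℝ) : (lowModes N).HasOrthogonalProjection := by
  unfold lowModes; infer_instance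

/-- The projection `P_N` onto the Fourier wavenumbers `|k| ≤ N`. -/
def projLow (N : ℝ) : L2 →L[ℝ] L2 := (lowModes N).starProjection

/-- `g ∈ L²` is the distributional derivative `∂_j u`, tested against the trigonometric fields:
`∫ g · φ = - ∫ u · ∂_j φ` for `φ = cos (k · x) a` and `φ = sin (k · x) a`. -/
def IsWeakDeriv (j : Fin 2) (u g : L2) : Prop :=
  ∀ (k : Wave) (a : Plane),
    inner ℝ g (cosMode k a) = (k j : ℝ) * inner ℝ u (sinMode k a) ∧
    inner ℝ g (sinMode k a) = -((k j : ℝ) * inner ℝ u (cosMode k a))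

open Classical in
/-- The derivative `∂_j u` (zero if there is none in `L²`). -/
def wderiv (j : Fin 2) (u : L2) : L2 :=
  if h : ∃ g, IsWeakDeriv j u g then h.choose else 0

/-- The space `V`: the fields in `H` whose first derivatives are square integrable. -/
def V : Set L2 := {u | u ∈ H ∧ ∀ j, ∃ g, IsWeakDeriv j u g}

/-- The norm `‖u‖` of `V`, `‖u‖² = ∑_j ∫ |∂_j u|²`. -/
def normV (u : L2) : ℝ := √(∑ j, ‖wderiv j u‖ ^ 2)

/-- `f ∈ L²` is `-Δ u` in the sense of distributions, that is, `f` has the Fourier coefficients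
`|k|² û_k`. -/
def IsNegLaplacian (u f : L2) : Prop :=
  ∀ (k : Wave) (a : Plane),
    inner ℝ f (cosMode k a) = waveSq k * inner ℝ u (cosMode k a) ∧
    inner ℝ f (sinMode k a) = waveSq k * inner ℝ u (sinMode k a)

/-- The domain `D(A)` of the Stokes operator. -/
def domA : Set L2 := {u | u ∈ H ∧ ∃ f, IsNegLaplacian u f}

open Classical in
/-- The Stokes operator `A = -ℙ Δ` (zero off its domain). -/
def stokes (u : L2) : L2 :=
  if h : ∃ f, IsNegLaplacian u f then leray h.choose else 0

open Classical in
/-- The convective term `(u · ∇) v` (zero if it is not square integrable, which does not happen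
for `u ∈ D(A)` and `v ∈ V`). -/
def convect (u v : L2) : L2 :=
  if h : MemLp (fun x => ∑ j, (u x) j • (wderiv j v) x) 2 (volume : Measure Torus)
  then h.toLp _ else 0

/-- `B(u, v) = ℙ ((u · ∇) v)`. -/
def B (u v : L2) : L2 := leray (convect u v)

/-- `C` is an admissible constant in Ladyzhenskaya's inequality `|u|_{L⁴}² ≤ C ‖u‖ |u|`. -/
def IsLadyzhenskayaConst (C : ℝ) : Prop :=
  0 < C ∧ ∀ u ∈ V, eLpNorm u 4 (volume : Measure Torus) ^ 2 ≤ ENNReal.ofReal (C * normV u * ‖u‖)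

/-- `C` is an admissible constant in Agmon's inequality `|u|_{L^∞}² ≤ C |A u| |u|`. -/
def IsAgmonConst (C : ℝ) : Prop :=
  0 < C ∧ ∀ u ∈ domA,
    eLpNorm u ∞ (volume : Measure Torus) ^ 2 ≤ ENNReal.ofReal (C * ‖stokes u‖ * ‖u‖)

/-- `g ∈ L^∞(0, ∞; H)`. -/
def IsForce (g : ℝ → L2) : Prop :=
  MemLp g ∞ (volume.restrict (Set.Ioi (0 : ℝ))) ∧
    ∀ᵐ t ∂(volume.restrict (Set.Ioi (0 : ℝ))), g t ∈ H

/-- `v ∈ C([0, T]; V) ∩ L²(0, T; D(A))` for all `T > 0`. -/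
structure IsStrongPath (v : ℝ → L2) : Prop where
  mem_V : ∀ t, 0 ≤ t → v t ∈ V
  continuous_V : ∀ s, 0 ≤ s →
    Tendsto (fun t => normV (v t - v s)) (𝓝[Set.Ici 0] s) (𝓝 0)
  mem_domA : ∀ᵐ t ∂(volume.restrict (Set.Ioi (0 : ℝ))), v t ∈ domA
  memLp_domA : ∀ T, 0 < T → MemLp (fun t => stokes (v t)) 2 (volume.restrict (Set.Ioc 0 T))

/-- `v` is a global strong solution of `dv/dt + ν A v + B(v, v) = f`, `v(0) = v₀`. The equation
holds in `H` in the form integrated in time, with `dv/dt ∈ L²(0, T; H)` for all `T > 0`. -/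
structure IsStrongSolution (ν : ℝ) (f : ℝ → L2) (v₀ : L2) (v : ℝ → L2) : Prop where
  path : IsStrongPath v
  memLp_rhs : ∀ T, 0 < T →
    MemLp (fun s => f s - ν • stokes (v s) - B (v s) (v s)) 2 (volume.restrict (Set.Ioc 0 T))
  eqn : ∀ t, 0 ≤ t →
    v t = v₀ + ∫ s in (0 : ℝ)..t, (f s - ν • stokes (v s) - B (v s) (v s))

/-- `(v₁, v₂)` is a global strong solution, with initial data `(a₁, a₂)`, of
`∂ₜ v₁ + ν A v₁ + B(v₁, v₁) = g₁ + θ₁ (P_N B(v₁, v₁) - P_N B(v₂, v₂))`,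
`∂ₜ v₂ + ν A v₂ + B(v₂, v₂) = g₂ + θ₂ (P_N B(v₂, v₂) - P_N B(v₁, v₁))`. -/
def IsMutualSyncSolution (ν N θ₁ θ₂ : ℝ) (g₁ g₂ : ℝ → L2) (a₁ a₂ : L2) (v₁ v₂ : ℝ → L2) : Prop :=
  IsStrongSolution ν
    (fun t => g₁ t + θ₁ • (projLow N (B (v₁ t) (v₁ t)) - projLow N (B (v₂ t) (v₂ t)))) a₁ v₁ ∧
  IsStrongSolution ν
    (fun t => g₂ t + θ₂ • (projLow N (B (v₂ t) (v₂ t)) - projLow N (B (v₁ t) (v₁ t)))) a₂ v₂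

/-- The mutual synchronization intertwinement with forces `g₁, g₂` is self-synchronous. -/
def IsSelfSynchronous (ν N θ₁ θ₂ : ℝ) (g₁ g₂ : ℝ → L2) : Prop :=
  Tendsto (fun t => ‖g₁ t - g₂ t‖) atTop (𝓝 0) →
    ∀ a₁ ∈ V, ∀ a₂ ∈ V, ∀ v₁ v₂ : ℝ → L2, IsMutualSyncSolution ν N θ₁ θ₂ g₁ g₂ a₁ a₂ v₁ v₂ →
      Tendsto (fun t => ‖v₁ t - v₂ t‖) atTop (𝓝 0)

/-- `𝔤_λ = sup_t |λ₁ g₁(t) + λ₂ g₂(t)| / ν²` with `λ₁ = θ₂` and `λ₂ = θ₁`; the supremum is that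
of `L^∞(0, ∞; H)`. -/
def grashof (ν θ₁ θ₂ : ℝ) (g₁ g₂ : ℝ → L2) : ℝ :=
  (eLpNorm (fun t => θ₂ • g₁ t + θ₁ • g₂ t) ∞ (volume.restrict (Set.Ioi (0 : ℝ)))).toReal / ν ^ 2

open Classical in
/-- The lower bound required of `N`, for `lam = λ = θ₁` and `gr = 𝔤_λ`. -/
def threshold (CL CA lam gr : ℝ) : ℝ :=
  if lam = 0 ∨ lam = 1 then max (48 * √3 * CL ^ 2 * gr ^ 2) (CA / CL ^ 2)
  else 15 * √27 * CL ^ 2 * gr ^ 2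

end NSE

end

noncomputable section

namespace NSE

/-! ### Characters of the torus -/

/-! Write `w = v₁ - v₂`, `m = θ₂ v₁ + θ₁ v₂` and `b(u, v, p) = ((u · ∇) v, p)`. Because `θ₁ + θ₂ =
1`, subtracting the two equations leaves the coupling `P_N (B(v₁, v₁) - B(v₂, v₂))`, which cancels
the nonlinearity on the wavenumbers `|k| ≤ N`. So `P_N w` solves a forced linear heat equation whose
force tends to zero, and `P_N w → 0`. Only finitely many modes are involved, so the convergence also
holds in `V` (`tendsto_low`, `normV_projLow_le`).

In the balance of the weighted energy `θ₂ |v₁|² + θ₁ |v₂|²` the coupling terms combine to `θ₁ θ₂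
(B(v₁, v₁) - B(v₂, v₂), P_N w)` (`inner_velocity_pair`). Antisymmetry of `b` puts the derivative on
`P_N w`, and Ladyzhenskaya's inequality bounds the term by `‖P_N w‖ (‖v₁‖² + ‖v₂‖²)` up to a
constant, which viscosity eventually absorbs. Hence, with `G` the supremum of `|θ₂ g₁ + θ₁ g₂|`, the
long-time average of `‖m‖²` exceeds `G² / ν²` by as little as desired (`energy_window`).

In the balance of `|w|²` the nonlinearity is `b(w, m, w)`, since `b(w, w, w) = 0`, and it is at most
`2 C ‖m‖ ‖w‖ |w|` (`inner_B_sub_diff`, `abs_tri_self_le`). Half of the viscous term absorbs it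
through Young's inequality. The other half controls `max(1, N)² |w|²` up to the vanishing `|P_N w|²`
(`norm_sub_projLow_sq_le`). Up to small errors, `d/dt |w|² ≤ -(ν max(1, N)² - (4 C² / ν) ‖m‖²)
|w|²`. The bracket may change sign, but its average is positive when `2 C 𝔤_λ < max(1, N)`, and a
Gronwall argument that uses only averages (`tendsto_zero_of_differential_inequality`) gives `w → 0`.

This condition is linear in `𝔤_λ`; the stated quadratic thresholds imply it
(`lt_max_of_threshold_le`). For the bare existence of `N₀`, Ladyzhenskaya's inequality is proved
with the constant 3. -/

theorem character_apply (k : Wave) (x : Torus) :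
    character k x = ∏ j, fourier (k j) (x j) := rfl

theorem character_neg (k : Wave) (x : Torus) :
    character (-k) x = (starRingEnd ℂ) (character k x) := by
  simp only [character_apply, Pi.neg_apply, fourier_neg, map_prod]

theorem character_add (k l : Wave) (x : Torus) :
    character (k + l) x = character k x * character l x := by
  simp only [character_apply, Pi.add_apply, fourier_add, ← Finset.prod_mul_distrib]

theorem character_zero (x : Torus) : character 0 x = 1 := by
  simp [character_apply]

theorem character_single (i : Fin 2) (x : Torus) :
    character (Pi.single i 1) x = fourier 1 (x i) := by
  rw [character_apply, Finset.prod_eq_single i]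
  · simp
  · intro j _ hj
    simp [Pi.single_eq_of_ne hj]
  · simp

/-- The star subalgebra of continuous functions generated by the characters. -/
def characterSubalgebra : StarSubalgebra ℂ C(Torus, ℂ) where
  toSubalgebra := Algebra.adjoin ℂ (Set.range character)
  star_mem' := by
    change Algebra.adjoin ℂ (Set.range character) ≤ star (Algebra.adjoin ℂ (Set.range character))
    refine Algebra.adjoin_le ?_
    rintro _ ⟨n, rfl⟩
    refine Algebra.subset_adjoin ⟨-n, ?_⟩
    ext1 x
    simp only [character_neg, starRingEnd_apply, ContinuousMap.star_apply]

theorem characterSubalgebra_coe :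
    Subalgebra.toSubmodule characterSubalgebra.toSubalgebra
      = Submodule.span ℂ (Set.range character) := by
  apply Algebra.adjoin_eq_span_of_subset
  refine .trans (fun x ↦ Submonoid.closure_induction (fun _ ↦ id) ⟨0, ?_⟩ ?_) Submodule.subset_span
  · ext z
    simp [character_zero]
  · rintro _ _ _ _ ⟨m, rfl⟩ ⟨n, rfl⟩
    refine ⟨m + n, ?_⟩
    ext z
    simp [character_add]

theorem characterSubalgebra_separatesPoints : characterSubalgebra.SeparatesPoints := by
  intro x y hxy
  rw [Ne, funext_iff, not_forall] at hxy
  obtain ⟨i, hi⟩ := hxy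
  refine ⟨_, ⟨character (Pi.single i 1), Algebra.subset_adjoin ⟨Pi.single i 1, rfl⟩, rfl⟩, ?_⟩
  dsimp only
  rw [character_single, character_single, fourier_one, fourier_one]
  intro h
  exact hi (AddCircle.injective_toCircle Real.two_pi_pos.ne' (Circle.ext h))

/-- Stone–Weierstrass: characters are closed under products and conjugation, and those of the unit
wavenumbers already separate points. -/
theorem span_character_closure_eq_top :
    (Submodule.span ℂ (Set.range character)).topologicalClosure = ⊤ := by
  rw [← characterSubalgebra_coe]
  exact congr_arg (Subalgebra.toSubmodule <| StarSubalgebra.toSubalgebra ·)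
    (ContinuousMap.starSubalgebra_topologicalClosure_eq_top_of_separatesPoints _
      characterSubalgebra_separatesPoints)

/-- The complex valued square integrable functions on the torus. -/
abbrev CL2 : Type := Lp ℂ 2 (volume : Measure Torus)

theorem integral_fourier_volume (n : ℤ) :
    ∫ x : AddCircle (2 * Real.pi), fourier n x = if n = 0 then ((2 * Real.pi : ℝ) : ℂ) else 0 := by
  split_ifs with h
  · subst h
    simp [measureReal_def, AddCircle.measure_univ, Real.pi_pos.le]
  · rw [AddCircle.volume_eq_smul_haarAddCircle, integral_smul_measure]
    have := (orthonormal_iff_ite.mp <| orthonormal_fourier (T := 2 * Real.pi)) 0 n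
    simp only [ContinuousMap.inner_toLp] at this
    rw [if_neg (fun h' => h h'.symm)] at this
    simp only [fourier_zero, map_one, mul_one] at this
    rw [this, smul_zero]

theorem integral_character (k : Wave) :
    ∫ x, character k x = if k = 0 then (((2 * Real.pi) ^ 2 : ℝ) : ℂ) else 0 := by
  simp only [character_apply]
  rw [MeasureTheory.integral_fintype_prod_volume_eq_prod
    (f := fun (i : Fin 2) (x : AddCircle (2 * Real.pi)) => fourier (k i) x)]
  simp only [integral_fourier_volume]
  split_ifs with h
  · subst h; simp [sq]
  · obtain ⟨i, hi⟩ := Function.ne_iff.mp h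
    exact Finset.prod_eq_zero (Finset.mem_univ i) (if_neg hi)

/-- The normalized characters, as square integrable functions. -/
def characterLp (k : Wave) : CL2 :=
  ((2 * Real.pi)⁻¹ : ℂ) • ContinuousMap.toLp (E := ℂ) 2 volume ℂ (character k)

theorem orthonormal_characterLp : Orthonormal ℂ characterLp := by
  rw [orthonormal_iff_ite]
  intro m n
  simp only [characterLp, inner_smul_left, inner_smul_right, ContinuousMap.inner_toLp,
    ← character_neg, ← character_add]
  rw [integral_character]
  have hpi : (Real.pi : ℂ) ≠ 0 := by exact_mod_cast Real.pi_ne_zero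
  by_cases h : m = n
  · subst h
    simp [Complex.conj_ofNat]
    field_simp
  · rw [if_neg h, if_neg]
    · simp
    · intro h'; exact h (by rw [add_neg_eq_zero] at h'; exact h'.symm)

theorem span_characterLp_closure_eq_top :
    (Submodule.span ℂ (Set.range characterLp)).topologicalClosure = ⊤ := by
  have h1 : (Submodule.span ℂ (Set.range fun k : Wave =>
      ContinuousMap.toLp (E := ℂ) 2 (volume : Measure Torus) ℂ (character k))).topologicalClosure
      = ⊤ := by
    simpa only [Submodule.map_span, ContinuousLinearMap.coe_coe, ← Set.range_comp,
      Function.comp_def] using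
      (ContinuousMap.toLp_denseRange ℂ (volume : Measure Torus) ℂ
        (p := 2) (by simp)).topologicalClosure_map_submodule span_character_closure_eq_top
  rw [eq_top_iff, ← h1]
  apply Submodule.topologicalClosure_mono
  rw [Submodule.span_le]
  rintro _ ⟨k, rfl⟩
  have hpi : (2 * Real.pi : ℂ) ≠ 0 := by exact_mod_cast Real.two_pi_pos.ne'
  have : ContinuousMap.toLp (E := ℂ) 2 (volume : Measure Torus) ℂ (character k)
      = (2 * Real.pi : ℂ) • characterLp k := by
    rw [characterLp, smul_smul, mul_inv_cancel₀ hpi, one_smul]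
  simp only [this]
  exact Submodule.smul_mem _ _ (Submodule.subset_span ⟨k, rfl⟩)

/-- The Hilbert basis of normalized characters. -/
def characterBasis : HilbertBasis Wave ℂ CL2 :=
  HilbertBasis.mk orthonormal_characterLp span_characterLp_closure_eq_top.ge

theorem coe_characterBasis : ⇑characterBasis = characterLp := HilbertBasis.coe_mk _ _


/-! ### Real Fourier coefficients and Parseval's identity -/

/-- The standard basis vectors of the plane. -/
def unitVec (i : Fin 2) : Plane := EuclideanSpace.single i 1

theorem cosMode_coeFn (k : Wave) (a : Plane) :
    cosMode k a =ᵐ[volume] fun x => (character k x).re • a :=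
  ContinuousMap.coeFn_toLp (𝕜 := ℝ) volume _

theorem sinMode_coeFn (k : Wave) (a : Plane) :
    sinMode k a =ᵐ[volume] fun x => (character k x).im • a :=
  ContinuousMap.coeFn_toLp (𝕜 := ℝ) volume _

theorem inner_cosMode (u : L2) (k : Wave) (a : Plane) :
    inner ℝ u (cosMode k a) = ∫ x, (character k x).re * inner ℝ (u x) a := by
  rw [L2.inner_def]
  apply integral_congr_ae
  filter_upwards [cosMode_coeFn k a] with x hx
  rw [hx, inner_smul_right]

theorem inner_sinMode (u : L2) (k : Wave) (a : Plane) :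
    inner ℝ u (sinMode k a) = ∫ x, (character k x).im * inner ℝ (u x) a := by
  rw [L2.inner_def]
  apply integral_congr_ae
  filter_upwards [sinMode_coeFn k a] with x hx
  rw [hx, inner_smul_right]

theorem cosMode_eq_sum (k : Wave) (a : Plane) :
    cosMode k a = ∑ i, a i • cosMode k (unitVec i) := by
  have ha : a = ∑ i, a i • unitVec i := by
    ext i; simp [unitVec, Fin.sum_univ_two]; fin_cases i <;> simp
  simp only [cosMode, ← map_smul, ← map_sum]
  congr 1
  ext1 x
  simp only [ContinuousMap.coe_mk, ContinuousMap.coe_sum, ContinuousMap.coe_smul, Finset.sum_apply,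
    Pi.smul_apply]
  conv_lhs => rw [ha]
  rw [Finset.smul_sum]
  exact Finset.sum_congr rfl fun i _ => smul_comm _ _ _

theorem sinMode_eq_sum (k : Wave) (a : Plane) :
    sinMode k a = ∑ i, a i • sinMode k (unitVec i) := by
  have ha : a = ∑ i, a i • unitVec i := by
    ext i; simp [unitVec, Fin.sum_univ_two]; fin_cases i <;> simp
  simp only [sinMode, ← map_smul, ← map_sum]
  congr 1
  ext1 x
  simp only [ContinuousMap.coe_mk, ContinuousMap.coe_sum, ContinuousMap.coe_smul, Finset.sum_apply,
    Pi.smul_apply]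
  conv_lhs => rw [ha]
  rw [Finset.smul_sum]
  exact Finset.sum_congr rfl fun i _ => smul_comm _ _ _

/-- The `i`-th coordinate of a plane vector, as a complex number. -/
def coordC (i : Fin 2) : Plane →L[ℝ] ℂ := Complex.ofRealCLM.comp (EuclideanSpace.proj i)

/-- The `i`-th component of a field, as a complex valued function. -/
def component (i : Fin 2) (u : L2) : CL2 := (coordC i).compLp u

theorem component_coeFn (i : Fin 2) (u : L2) :
    component i u =ᵐ[volume] fun x => ((u x i : ℝ) : ℂ) :=
  (coordC i).coeFn_compLp u

theorem integrable_coord_mul (u v : L2) (i : Fin 2) :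
    Integrable (fun x => u x i * v x i) volume := by
  have h (w : L2) : MemLp (fun x => w x i) 2 volume :=
    (EuclideanSpace.proj (𝕜 := ℝ) i).comp_memLp' (Lp.memLp w)
  exact (h u).integrable_mul (h v)

theorem inner_component (u v : L2) (i : Fin 2) :
    inner ℂ (component i u) (component i v) = ((∫ x, u x i * v x i : ℝ) : ℂ) := by
  rw [L2.inner_def, ← integral_complex_ofReal]
  apply integral_congr_ae
  filter_upwards [component_coeFn i u, component_coeFn i v] with x hu hv
  rw [hu, hv]
  simp [mul_comm]

theorem inner_eq_sum_coord (u v : L2) : inner ℝ u v = ∑ i, ∫ x, u x i * v x i := by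
  rw [L2.inner_def, ← integral_finsetSum _ fun i _ => integrable_coord_mul u v i]
  simp only [PiLp.inner_apply]
  simp [mul_comm]

theorem inner_unitVec (a : Plane) (i : Fin 2) : inner ℝ a (unitVec i) = a i := by
  simp [unitVec, EuclideanSpace.inner_single_right]

theorem inner_characterLp_component (u : L2) (k : Wave) (i : Fin 2) :
    inner ℂ (characterLp k) (component i u) = ((2 * Real.pi)⁻¹ : ℂ) *
      (((inner ℝ u (cosMode k (unitVec i)) : ℝ) : ℂ) -
        Complex.I * ((inner ℝ u (sinMode k (unitVec i)) : ℝ) : ℂ)) := by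
  have hu : Integrable (fun x => u x i) volume :=
    ((EuclideanSpace.proj (𝕜 := ℝ) i).comp_memLp' (Lp.memLp u)).integrable (by norm_num)
  have hc (c : C(Torus, ℝ)) : Integrable (fun x => c x * u x i) volume :=
    hu.bdd_mul c.continuous.aestronglyMeasurable (c := ‖c‖)
      (Eventually.of_forall fun x => c.norm_coe_le_norm x)
  have h1 : Integrable (fun x => (((character k x).re * u x i : ℝ) : ℂ)) volume :=
    (hc ⟨fun x => (character k x).re, by fun_prop⟩).ofReal
  have h2 : Integrable (fun x => (((character k x).im * u x i : ℝ) : ℂ)) volume :=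
    (hc ⟨fun x => (character k x).im, by fun_prop⟩).ofReal
  rw [characterLp, inner_smul_left, inner_cosMode, inner_sinMode, L2.inner_def]
  simp only [inner_unitVec]
  rw [← integral_complex_ofReal, ← integral_complex_ofReal, ← integral_const_mul Complex.I,
    ← integral_sub h1 (h2.const_mul _)]
  congr 1
  · simp [Complex.conj_ofNat]
  apply integral_congr_ae
  filter_upwards [component_coeFn i u,
    ContinuousMap.coeFn_toLp (p := 2) (𝕜 := ℂ) volume (character k)] with x hu hk
  rw [hu, hk]
  apply Complex.ext <;> simp [mul_comm]

/-- The contribution of the wavenumber `k` to the inner product of two fields. -/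
def modePair (u v : L2) (k : Wave) : ℝ :=
  ∑ i, (inner ℝ u (cosMode k (unitVec i)) * inner ℝ v (cosMode k (unitVec i)) +
    inner ℝ u (sinMode k (unitVec i)) * inner ℝ v (sinMode k (unitVec i)))

/-- Parseval for the complex basis, applied to each component. A complex coefficient is `(c - i s) /
2π` with `c`, `s` the real cosine and sine coefficients, so the real part of the product keeps `c c'
+ s s'` and drops the cross terms; the normalization is the source of `(2π)²`. -/
theorem hasSum_modePair (u v : L2) :
    HasSum (modePair u v) ((2 * Real.pi) ^ 2 * inner ℝ u v) := by
  rw [inner_eq_sum_coord, Finset.mul_sum]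
  unfold modePair
  apply hasSum_sum
  intro i _
  have h := characterBasis.hasSum_inner_mul_inner (component i u) (component i v)
  rw [inner_component] at h
  have h2 := (Complex.hasSum_re h).mul_left ((2 * Real.pi) ^ 2)
  rw [Complex.ofReal_re] at h2
  refine h2.congr_fun fun k => ?_
  rw [coe_characterBasis, ← inner_conj_symm (component i u), inner_characterLp_component,
    inner_characterLp_component]
  have hpi : ((2 * Real.pi)⁻¹ : ℂ) = (((2 * Real.pi)⁻¹ : ℝ) : ℂ) := by push_cast; rfl
  rw [hpi]
  have hpi' : (2 * Real.pi) ≠ 0 := Real.two_pi_pos.ne'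
  simp
  field_simp

theorem modePair_self_nonneg (u : L2) (k : Wave) : 0 ≤ modePair u u k :=
  Finset.sum_nonneg fun _ _ => add_nonneg (mul_self_nonneg _) (mul_self_nonneg _)

theorem hasSum_modePair_self (u : L2) :
    HasSum (modePair u u) ((2 * Real.pi) ^ 2 * ‖u‖ ^ 2) := by
  simpa only [real_inner_self_eq_norm_sq] using hasSum_modePair u u

theorem two_pi_sq_pos : 0 < (2 * Real.pi) ^ 2 := pow_pos Real.two_pi_pos 2

/-- Parseval for `u - v`. This makes weak derivatives and Laplacians unique, so the choices inside
`wderiv` and `stokes` can be computed. -/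
theorem eq_of_coeff {u v : L2}
    (hc : ∀ k a, inner ℝ u (cosMode k a) = inner ℝ v (cosMode k a))
    (hs : ∀ k a, inner ℝ u (sinMode k a) = inner ℝ v (sinMode k a)) : u = v := by
  have h := hasSum_modePair (u - v) (u - v)
  have h0 : modePair (u - v) (u - v) = fun _ => 0 := by
    ext k
    simp [modePair, inner_sub_left, hc, hs]
  rw [h0] at h
  have := h.unique hasSum_zero
  rw [mul_eq_zero, or_iff_right two_pi_sq_pos.ne', inner_self_eq_zero] at this
  exact sub_eq_zero.mp this

/-! ### Weak derivatives and Laplacians: algebra -/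

namespace IsWeakDeriv

variable {j : Fin 2} {u v f g : L2}

theorem unique (hf : IsWeakDeriv j u f) (hg : IsWeakDeriv j u g) : f = g :=
  eq_of_coeff (fun k a => by rw [(hf k a).1, (hg k a).1]) fun k a => by rw [(hf k a).2, (hg k a).2]

theorem wderiv_eq (hf : IsWeakDeriv j u f) : wderiv j u = f := by
  have h : ∃ g, IsWeakDeriv j u g := ⟨f, hf⟩
  rw [wderiv, dif_pos h]
  exact h.choose_spec.unique hf

theorem add (hf : IsWeakDeriv j u f) (hg : IsWeakDeriv j v g) : IsWeakDeriv j (u + v) (f + g) :=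
  fun k a => by
    simp only [inner_add_left, (hf k a).1, (hf k a).2, (hg k a).1, (hg k a).2]
    constructor <;> ring

theorem sub (hf : IsWeakDeriv j u f) (hg : IsWeakDeriv j v g) : IsWeakDeriv j (u - v) (f - g) :=
  fun k a => by
    simp only [inner_sub_left, (hf k a).1, (hf k a).2, (hg k a).1, (hg k a).2]
    constructor <;> ring

theorem smul (c : ℝ) (hf : IsWeakDeriv j u f) : IsWeakDeriv j (c • u) (c • f) :=
  fun k a => by
    simp only [real_inner_smul_left, (hf k a).1, (hf k a).2]
    constructor <;> ring

end IsWeakDeriv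

theorem isWeakDeriv_wderiv {j : Fin 2} {u : L2} (h : ∃ g, IsWeakDeriv j u g) :
    IsWeakDeriv j u (wderiv j u) := by
  rw [wderiv, dif_pos h]
  exact h.choose_spec

namespace IsNegLaplacian

variable {u v f g : L2}

theorem unique (hf : IsNegLaplacian u f) (hg : IsNegLaplacian u g) : f = g :=
  eq_of_coeff (fun k a => by rw [(hf k a).1, (hg k a).1]) fun k a => by rw [(hf k a).2, (hg k a).2]

theorem sub (hf : IsNegLaplacian u f) (hg : IsNegLaplacian v g) :
    IsNegLaplacian (u - v) (f - g) :=
  fun k a => by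
    simp only [inner_sub_left, (hf k a).1, (hf k a).2, (hg k a).1, (hg k a).2]
    constructor <;> ring

end IsNegLaplacian

/-! ### Classical derivatives on the torus -/

variable {E : Type*} [NormedAddCommGroup E]

/-- `D j` is the classical partial derivative of `φ` in the direction `j`. -/
def IsC1 [NormedSpace ℝ E] (φ : C(Torus, E)) (D : Fin 2 → C(Torus, E)) : Prop :=
  ∀ (j : Fin 2) (x : Torus),
    HasDerivAt (fun t : ℝ => φ (x + Pi.single j (t : AddCircle (2 * Real.pi)))) (D j x) 0

theorem single_coe_add (j : Fin 2) (s t : ℝ) :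
    (Pi.single j ((s + t : ℝ) : AddCircle (2 * Real.pi)) : Torus) =
      Pi.single j (s : AddCircle (2 * Real.pi)) + Pi.single j (t : AddCircle (2 * Real.pi)) := by
  rw [← Pi.single_add]; rfl

theorem IsC1.hasDerivAt_line [NormedSpace ℝ E] {φ : C(Torus, E)} {D : Fin 2 → C(Torus, E)}
    (h : IsC1 φ D) (j : Fin 2) (x : Torus) (t : ℝ) :
    HasDerivAt (fun t : ℝ => φ (x + Pi.single j (t : AddCircle (2 * Real.pi))))
      (D j (x + Pi.single j (t : AddCircle (2 * Real.pi)))) t := by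
  have h1 := h j (x + Pi.single j (t : AddCircle (2 * Real.pi)))
  have h2 := HasDerivAt.comp_sub_const (x := t) (a := t)
    (f := fun s : ℝ => φ (x + Pi.single j (t : AddCircle (2 * Real.pi)) +
      Pi.single j (s : AddCircle (2 * Real.pi)))) (by rw [sub_self]; exact h1)
  convert h2 using 2 with s
  rw [add_assoc, ← single_coe_add, add_sub_cancel]

theorem continuous_single_coe (j : Fin 2) :
    Continuous fun t : ℝ => (Pi.single j (t : AddCircle (2 * Real.pi)) : Torus) :=
  (continuous_single j).comp (AddCircle.continuous_mk' (2 * Real.pi))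

theorem IsC1.add [NormedSpace ℝ E] {φ ψ : C(Torus, E)} {D D' : Fin 2 → C(Torus, E)}
    (h : IsC1 φ D) (h' : IsC1 ψ D') : IsC1 (φ + ψ) fun j => D j + D' j :=
  fun j x => (h j x).add (h' j x)

theorem IsC1.smul [NormedSpace ℝ E] {φ : C(Torus, E)} {D : Fin 2 → C(Torus, E)}
    (c : ℝ) (h : IsC1 φ D) : IsC1 (c • φ) fun j => c • D j :=
  fun j x => (h j x).const_smul c

/-- The pointwise inner product of two continuous fields. -/
def innerC [InnerProductSpace ℝ E] (φ ψ : C(Torus, E)) : C(Torus, ℝ) :=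
  ⟨fun x => inner ℝ (φ x) (ψ x), φ.continuous.inner ψ.continuous⟩

theorem IsC1.innerC [InnerProductSpace ℝ E] {φ ψ : C(Torus, E)} {D D' : Fin 2 → C(Torus, E)}
    (h : IsC1 φ D) (h' : IsC1 ψ D') :
    IsC1 (innerC φ ψ) fun j => NSE.innerC φ (D' j) + NSE.innerC (D j) ψ := by
  intro j x
  have := (h j x).inner ℝ (h' j x)
  simpa [NSE.innerC] using this

instance instTorusAddInv : (volume : Measure Torus).IsAddRightInvariant :=
  inferInstanceAs (Measure.pi fun _ => volume).IsAddRightInvariant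

/-- By translation invariance `t ↦ ∫ φ(x + t e_j) dx` is constant; differentiate it under the
integral at `t = 0`. -/
theorem IsC1.integral_eq_zero {φ : C(Torus, ℝ)} {D : Fin 2 → C(Torus, ℝ)}
    (h : IsC1 φ D) (j : Fin 2) : ∫ x, D j x = 0 := by
  have hder := hasDerivAt_integral_of_dominated_loc_of_deriv_le (μ := (volume : Measure Torus))
    (F := fun (t : ℝ) (x : Torus) => φ (x + Pi.single j (t : AddCircle (2 * Real.pi))))
    (F' := fun (t : ℝ) (x : Torus) => D j (x + Pi.single j (t : AddCircle (2 * Real.pi))))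
    (x₀ := (0 : ℝ)) (s := Set.univ) (bound := fun _ => ‖D j‖) Filter.univ_mem
    (Eventually.of_forall fun t => (by fun_prop : Continuous _).aestronglyMeasurable)
    ((by fun_prop : Continuous _).integrable_of_hasCompactSupport
      (HasCompactSupport.of_compactSpace _))
    ((by fun_prop : Continuous _).aestronglyMeasurable)
    (Eventually.of_forall fun x t _ => (D j).norm_coe_le_norm _)
    (integrable_const _)
    (Eventually.of_forall fun x t _ => h.hasDerivAt_line j x t)
  have h0 : (fun t : ℝ => ∫ x : Torus, φ (x + Pi.single j (t : AddCircle (2 * Real.pi)))) =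
      fun _ => ∫ x, φ x := by
    ext t
    exact integral_add_right_eq_self (fun x => φ x) _
  have h1 := hder.2
  rw [h0] at h1
  have h2 := h1.unique (hasDerivAt_const _ _)
  simpa using h2

theorem character_add_arg (k : Wave) (x y : Torus) :
    character k (x + y) = character k x * character k y := by
  simp only [character_apply, ← Finset.prod_mul_distrib, Pi.add_apply, fourier_apply, smul_add,
    AddCircle.toCircle_add, Circle.coe_mul]

theorem character_single_arg (k : Wave) (j : Fin 2) (t : AddCircle (2 * Real.pi)) :
    character k (Pi.single j t) = fourier (k j) t := by
  rw [character_apply, Finset.prod_eq_single j]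
  · simp
  · intro i _ hi
    rw [Pi.single_eq_of_ne hi, fourier_eval_zero]
  · simp

theorem hasDerivAt_character_line (k : Wave) (j : Fin 2) (x : Torus) :
    HasDerivAt (fun t : ℝ => character k (x + Pi.single j (t : AddCircle (2 * Real.pi))))
      (character k x * (Complex.I * (k j : ℝ))) 0 := by
  simp only [character_add_arg, character_single_arg]
  have h := (hasDerivAt_fourier (2 * Real.pi) (k j) 0).const_mul (character k x)
  refine h.congr_deriv ?_
  have hpi : (Real.pi : ℂ) ≠ 0 := by exact_mod_cast Real.pi_ne_zero
  rw [QuotientAddGroup.mk_zero, fourier_eval_zero]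
  push_cast
  field_simp

/-- `cosMode` as a continuous field. -/
def cosField (k : Wave) (a : Plane) : C(Torus, Plane) :=
  ⟨fun x => (character k x).re • a, by fun_prop⟩

/-- `sinMode` as a continuous field. -/
def sinField (k : Wave) (a : Plane) : C(Torus, Plane) :=
  ⟨fun x => (character k x).im • a, by fun_prop⟩

/-- A continuous field as an element of `L²`. -/
def ofField (φ : C(Torus, Plane)) : L2 := ContinuousMap.toLp 2 volume ℝ φ

theorem cosMode_eq (k : Wave) (a : Plane) : cosMode k a = ofField (cosField k a) := rfl

theorem sinMode_eq (k : Wave) (a : Plane) : sinMode k a = ofField (sinField k a) := rfl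

theorem ofField_coeFn (φ : C(Torus, Plane)) : ofField φ =ᵐ[volume] φ :=
  ContinuousMap.coeFn_toLp (𝕜 := ℝ) volume φ

theorem inner_ofField (φ ψ : C(Torus, Plane)) :
    inner ℝ (ofField φ) (ofField ψ) = ∫ x, innerC φ ψ x := by
  rw [L2.inner_def]
  apply integral_congr_ae
  filter_upwards [ofField_coeFn φ, ofField_coeFn ψ] with x h1 h2
  rw [h1, h2]; rfl

theorem isC1_cosField (k : Wave) (a : Plane) :
    IsC1 (cosField k a) fun j => (-(k j : ℝ)) • sinField k a := by
  intro j x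
  have h1 := (hasDerivAt_character_line k j x)
  have h2 := (Complex.reCLM.hasFDerivAt.comp_hasDerivAt (0 : ℝ) h1).smul_const a
  refine h2.congr_deriv ?_
  change _ = (-(k j : ℝ)) • ((character k x).im • a)
  rw [smul_smul]
  congr 1
  simp [mul_comm]

theorem isC1_sinField (k : Wave) (a : Plane) :
    IsC1 (sinField k a) fun j => (k j : ℝ) • cosField k a := by
  intro j x
  have h1 := (hasDerivAt_character_line k j x)
  have h2 := (Complex.imCLM.hasFDerivAt.comp_hasDerivAt (0 : ℝ) h1).smul_const a
  refine h2.congr_deriv ?_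
  change _ = (k j : ℝ) • ((character k x).re • a)
  rw [smul_smul]
  congr 1
  simp [mul_comm]

theorem IsC1.integral_inner {φ ψ : C(Torus, Plane)} {D D' : Fin 2 → C(Torus, Plane)}
    (h : IsC1 φ D) (h' : IsC1 ψ D') (j : Fin 2) :
    inner ℝ (ofField (D j)) (ofField ψ) = -inner ℝ (ofField φ) (ofField (D' j)) := by
  have h0 := (h.innerC h').integral_eq_zero j
  have hi (f : C(Torus, ℝ)) : Integrable (fun x => f x) volume :=
    f.continuous.integrable_of_hasCompactSupport (HasCompactSupport.of_compactSpace _)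
  simp only [ContinuousMap.add_apply] at h0
  rw [integral_add (hi _) (hi _)] at h0
  rw [inner_ofField, inner_ofField]
  linarith

theorem IsC1.isWeakDeriv {φ : C(Torus, Plane)} {D : Fin 2 → C(Torus, Plane)}
    (h : IsC1 φ D) (j : Fin 2) : IsWeakDeriv j (ofField φ) (ofField (D j)) := by
  intro k a
  have hs (c : ℝ) (f : C(Torus, Plane)) : ofField (c • f) = c • ofField f := map_smul _ _ _
  constructor
  · rw [cosMode_eq, h.integral_inner (isC1_cosField k a), hs, inner_smul_right, sinMode_eq]
    ring
  · rw [sinMode_eq, h.integral_inner (isC1_sinField k a), hs, inner_smul_right, cosMode_eq]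

/-! ### Orthogonality of modes and the low mode projection -/

theorem ofField_smul (c : ℝ) (f : C(Torus, Plane)) : ofField (c • f) = c • ofField f :=
  map_smul _ _ _

theorem ofField_add (f g : C(Torus, Plane)) : ofField (f + g) = ofField f + ofField g :=
  map_add _ _ _

theorem isWeakDeriv_cosMode (j : Fin 2) (k : Wave) (a : Plane) :
    IsWeakDeriv j (cosMode k a) (-(k j : ℝ) • sinMode k a) := by
  have := (isC1_cosField k a).isWeakDeriv j
  rwa [ofField_smul, ← cosMode_eq, ← sinMode_eq] at this

theorem isWeakDeriv_sinMode (j : Fin 2) (k : Wave) (a : Plane) :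
    IsWeakDeriv j (sinMode k a) ((k j : ℝ) • cosMode k a) := by
  have := (isC1_sinField k a).isWeakDeriv j
  rwa [ofField_smul, ← cosMode_eq, ← sinMode_eq] at this

/-- Integrating by parts twice in direction `j` gives `k_j² x = l_j² x` for the inner product `x`;
summing over `j` gives `(|k|² - |l|²) x = 0`. Modes of equal length need no separate treatment,
because `P_N` depends on `|k|` only. -/
theorem modes_orthogonal {k l : Wave} (h : waveSq k ≠ waveSq l) (a b : Plane) :
    inner ℝ (cosMode k a) (cosMode l b) = 0 ∧ inner ℝ (sinMode k a) (sinMode l b) = 0 ∧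
      inner ℝ (cosMode k a) (sinMode l b) = 0 := by
  have h1 (j : Fin 2) := isWeakDeriv_cosMode j k a l b
  have h2 (j : Fin 2) := isWeakDeriv_sinMode j k a l b
  simp only [real_inner_smul_left] at h1 h2
  have hsub : waveSq k - waveSq l ≠ 0 := sub_ne_zero.mpr h
  have key (x : ℝ) (hx : ∀ j, (k j : ℝ) ^ 2 * x = (l j : ℝ) ^ 2 * x) : x = 0 := by
    have : (waveSq k - waveSq l) * x = 0 := by
      rw [waveSq, waveSq, sub_mul, Finset.sum_mul, Finset.sum_mul, sub_eq_zero]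
      exact Finset.sum_congr rfl fun j _ => hx j
    exact (mul_eq_zero.mp this).resolve_left hsub
  refine ⟨key _ fun j => ?_, key _ fun j => ?_, key _ fun j => ?_⟩
  · linear_combination (k j : ℝ) * (h2 j).1 - (l j : ℝ) * (h1 j).2
  · linear_combination (l j : ℝ) * (h2 j).1 - (k j : ℝ) * (h1 j).2
  · linear_combination (k j : ℝ) * (h2 j).2 + (l j : ℝ) * (h1 j).1

theorem cosMode_mem_lowModes {N : ℝ} {k : Wave} (h : √(waveSq k) ≤ N) (a : Plane) :
    cosMode k a ∈ lowModes N :=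
  Submodule.le_topologicalClosure _ (Submodule.subset_span ⟨k, a, h, Or.inl rfl⟩)

theorem sinMode_mem_lowModes {N : ℝ} {k : Wave} (h : √(waveSq k) ≤ N) (a : Plane) :
    sinMode k a ∈ lowModes N :=
  Submodule.le_topologicalClosure _ (Submodule.subset_span ⟨k, a, h, Or.inr rfl⟩)

theorem mem_lowModes_orthogonal {N : ℝ} {v : L2}
    (h : ∀ k, √(waveSq k) ≤ N → ∀ a, inner ℝ (cosMode k a) v = 0 ∧ inner ℝ (sinMode k a) v = 0) :
    v ∈ (lowModes N)ᗮ := by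
  rw [lowModes, Submodule.orthogonal_closure]
  rw [Submodule.mem_orthogonal]
  intro u hu
  induction hu using Submodule.span_induction with
  | mem x hx =>
    obtain ⟨k, a, hk, rfl | rfl⟩ := hx
    · exact (h k hk a).1
    · exact (h k hk a).2
  | zero => simp
  | add x y _ _ hx hy => rw [inner_add_left, hx, hy, add_zero]
  | smul c x _ hx => rw [real_inner_smul_left, hx, mul_zero]

theorem projLow_eq_self {N : ℝ} {u : L2} (h : u ∈ lowModes N) : projLow N u = u :=
  Submodule.starProjection_eq_self_iff.mpr h

theorem projLow_eq_zero {N : ℝ} {u : L2} (h : u ∈ (lowModes N)ᗮ) : projLow N u = 0 :=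
  (Submodule.starProjection_apply_eq_zero_iff _).mpr h

theorem inner_projLow_left (N : ℝ) (u v : L2) :
    inner ℝ (projLow N u) v = inner ℝ u (projLow N v) :=
  Submodule.inner_starProjection_left_eq_right _ u v

-- With its sine counterpart, this exhibits `P_N` as the Fourier multiplier by the indicator of `|k|
-- ≤ N`. That it commutes with derivatives and the Laplacian and preserves `H` is then read off
-- coefficients.
open Classical in
theorem inner_projLow_cosMode (N : ℝ) (u : L2) (k : Wave) (a : Plane) :
    inner ℝ (projLow N u) (cosMode k a) =
      if √(waveSq k) ≤ N then inner ℝ u (cosMode k a) else 0 := by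
  rw [inner_projLow_left]
  split_ifs with h
  · rw [projLow_eq_self (cosMode_mem_lowModes h a)]
  · rw [projLow_eq_zero, inner_zero_right]
    refine mem_lowModes_orthogonal fun l hl b => ?_
    have hne : waveSq k ≠ waveSq l := fun h' => h (h' ▸ hl)
    rw [real_inner_comm, real_inner_comm (cosMode k a)]
    exact ⟨(modes_orthogonal hne a b).1, (modes_orthogonal hne a b).2.2⟩

open Classical in
theorem inner_projLow_sinMode (N : ℝ) (u : L2) (k : Wave) (a : Plane) :
    inner ℝ (projLow N u) (sinMode k a) =
      if √(waveSq k) ≤ N then inner ℝ u (sinMode k a) else 0 := by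
  rw [inner_projLow_left]
  split_ifs with h
  · rw [projLow_eq_self (sinMode_mem_lowModes h a)]
  · rw [projLow_eq_zero, inner_zero_right]
    refine mem_lowModes_orthogonal fun l hl b => ?_
    have hne : waveSq k ≠ waveSq l := fun h' => h (h' ▸ hl)
    exact ⟨(modes_orthogonal hne.symm b a).2.2, (modes_orthogonal hne.symm b a).2.1⟩

open Classical in
theorem modePair_projLow_left (N : ℝ) (u v : L2) (k : Wave) :
    modePair (projLow N u) v k = if √(waveSq k) ≤ N then modePair u v k else 0 := by
  simp only [modePair, inner_projLow_cosMode, inner_projLow_sinMode]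
  split_ifs <;> simp

theorem modePair_comm (u v : L2) (k : Wave) : modePair u v k = modePair v u k := by
  simp only [modePair, mul_comm]

theorem IsWeakDeriv.projLow {j : Fin 2} {u g : L2} (h : IsWeakDeriv j u g) (N : ℝ) :
    IsWeakDeriv j (projLow N u) (projLow N g) := by
  intro k a
  simp only [inner_projLow_cosMode, inner_projLow_sinMode, (h k a).1, (h k a).2]
  split_ifs <;> simp

theorem IsNegLaplacian.projLow {u f : L2} (h : IsNegLaplacian u f) (N : ℝ) :
    IsNegLaplacian (projLow N u) (projLow N f) := by
  intro k a
  simp only [inner_projLow_cosMode, inner_projLow_sinMode, (h k a).1, (h k a).2]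
  split_ifs <;> simp

theorem norm_projLow_le (N : ℝ) (u : L2) : ‖projLow N u‖ ≤ ‖u‖ :=
  Submodule.norm_starProjection_apply_le _ u

theorem lowModes_mono {M N : ℝ} (h : M ≤ N) : lowModes M ≤ lowModes N :=
  Submodule.topologicalClosure_mono (Submodule.span_mono
    fun _ ⟨k, a, hk, hf⟩ => ⟨k, a, hk.trans h, hf⟩)

theorem tendsto_projLow (u : L2) :
    Tendsto (fun n : ℕ => projLow n u) atTop (𝓝 u) := by
  apply Submodule.starProjection_tendsto_self (fun n : ℕ => lowModes n)
    (fun m n h => lowModes_mono (by exact_mod_cast h))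
  rw [top_le_iff, Submodule.topologicalClosure_eq_top_iff, eq_bot_iff]
  intro v hv
  rw [Submodule.mem_orthogonal'] at hv
  rw [Submodule.mem_bot]
  have hmem (k : Wave) : lowModes (⌈√(waveSq k)⌉₊ : ℕ) ≤ ⨆ n : ℕ, lowModes n :=
    le_iSup (fun n : ℕ => lowModes n) _
  refine eq_of_coeff (fun k a => ?_) fun k a => ?_
  · rw [inner_zero_left]
    exact hv _ (hmem k (cosMode_mem_lowModes (Nat.le_ceil _) a))
  · rw [inner_zero_left]
    exact hv _ (hmem k (sinMode_mem_lowModes (Nat.le_ceil _) a))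

/-! ### The spaces `H` and `V` -/

theorem mem_H_iff {u : L2} : u ∈ H ↔ (∀ a, inner ℝ u (cosMode 0 a) = 0) ∧
    ∀ k, inner ℝ u (cosMode k (waveVec k)) = 0 ∧ inner ℝ u (sinMode k (waveVec k)) = 0 := by
  rw [H, Submodule.mem_orthogonal']
  constructor
  · intro h
    exact ⟨fun a => h _ (Submodule.subset_span (Or.inl (Or.inl ⟨a, rfl⟩))), fun k =>
      ⟨h _ (Submodule.subset_span (Or.inl (Or.inr ⟨k, rfl⟩))),
        h _ (Submodule.subset_span (Or.inr ⟨k, rfl⟩))⟩⟩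
  · rintro ⟨h0, h⟩ v hv
    induction hv using Submodule.span_induction with
    | mem x hx =>
      rcases hx with (⟨a, rfl⟩ | ⟨k, rfl⟩) | ⟨k, rfl⟩
      · exact h0 a
      · exact (h k).1
      · exact (h k).2
    | zero => simp
    | add x y _ _ hx hy => rw [inner_add_right, hx, hy, add_zero]
    | smul c x _ hx => rw [real_inner_smul_right, hx, mul_zero]

theorem IsWeakDeriv.mem_H {j : Fin 2} {u g : L2} (h : IsWeakDeriv j u g) (hu : u ∈ H) : g ∈ H := by
  rw [mem_H_iff] at hu ⊢
  refine ⟨fun a => ?_, fun k => ⟨?_, ?_⟩⟩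
  · rw [(h 0 a).1]; simp
  · rw [(h _ _).1, (hu.2 k).2, mul_zero]
  · rw [(h _ _).2, (hu.2 k).1, mul_zero, neg_zero]

theorem IsNegLaplacian.mem_H {u f : L2} (h : IsNegLaplacian u f) (hu : u ∈ H) : f ∈ H := by
  rw [mem_H_iff] at hu ⊢
  refine ⟨fun a => ?_, fun k => ⟨?_, ?_⟩⟩
  · rw [(h 0 a).1, hu.1, mul_zero]
  · rw [(h _ _).1, (hu.2 k).1, mul_zero]
  · rw [(h _ _).2, (hu.2 k).2, mul_zero]

theorem projLow_mem_H {u : L2} (hu : u ∈ H) (N : ℝ) : projLow N u ∈ H := by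
  rw [mem_H_iff] at hu ⊢
  simp only [inner_projLow_cosMode, inner_projLow_sinMode, hu.1, (hu.2 _).1, (hu.2 _).2]
  simp

theorem leray_eq_self {u : L2} (hu : u ∈ H) : leray u = u :=
  Submodule.starProjection_eq_self_iff.mpr hu

theorem inner_leray_left {v : L2} (hv : v ∈ H) (u : L2) : inner ℝ (leray u) v = inner ℝ u v := by
  rw [leray, Submodule.inner_starProjection_left_eq_right]
  exact congrArg _ (leray_eq_self hv)

theorem IsNegLaplacian.stokes_eq {u f : L2} (h : IsNegLaplacian u f) (hu : u ∈ H) :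
    stokes u = f := by
  have h' : ∃ f, IsNegLaplacian u f := ⟨f, h⟩
  rw [stokes, dif_pos h', h'.choose_spec.unique h, leray_eq_self (h.mem_H hu)]

theorem isNegLaplacian_stokes {u : L2} (h : u ∈ domA) : IsNegLaplacian u (stokes u) := by
  obtain ⟨f, hf⟩ := h.2
  rwa [hf.stokes_eq h.1]

theorem V_weakDeriv {u : L2} (hu : u ∈ V) (j : Fin 2) : IsWeakDeriv j u (wderiv j u) :=
  isWeakDeriv_wderiv (hu.2 j)

theorem V_add {u v : L2} (hu : u ∈ V) (hv : v ∈ V) : u + v ∈ V :=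
  ⟨H.add_mem hu.1 hv.1, fun j => ⟨_, (V_weakDeriv hu j).add (V_weakDeriv hv j)⟩⟩

theorem V_sub {u v : L2} (hu : u ∈ V) (hv : v ∈ V) : u - v ∈ V :=
  ⟨H.sub_mem hu.1 hv.1, fun j => ⟨_, (V_weakDeriv hu j).sub (V_weakDeriv hv j)⟩⟩

theorem V_smul {u : L2} (c : ℝ) (hu : u ∈ V) : c • u ∈ V :=
  ⟨H.smul_mem c hu.1, fun j => ⟨_, (V_weakDeriv hu j).smul c⟩⟩

theorem V_projLow {u : L2} (hu : u ∈ V) (N : ℝ) : projLow N u ∈ V :=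
  ⟨projLow_mem_H hu.1 N, fun j => ⟨_, (V_weakDeriv hu j).projLow N⟩⟩

theorem wderiv_add {u v : L2} (hu : u ∈ V) (hv : v ∈ V) (j : Fin 2) :
    wderiv j (u + v) = wderiv j u + wderiv j v :=
  ((V_weakDeriv hu j).add (V_weakDeriv hv j)).wderiv_eq

theorem wderiv_sub {u v : L2} (hu : u ∈ V) (hv : v ∈ V) (j : Fin 2) :
    wderiv j (u - v) = wderiv j u - wderiv j v :=
  ((V_weakDeriv hu j).sub (V_weakDeriv hv j)).wderiv_eq

theorem wderiv_smul {u : L2} (c : ℝ) (hu : u ∈ V) (j : Fin 2) :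
    wderiv j (c • u) = c • wderiv j u :=
  ((V_weakDeriv hu j).smul c).wderiv_eq

theorem wderiv_projLow {u : L2} (hu : u ∈ V) (N : ℝ) (j : Fin 2) :
    wderiv j (projLow N u) = projLow N (wderiv j u) :=
  ((V_weakDeriv hu j).projLow N).wderiv_eq

theorem normV_nonneg (u : L2) : 0 ≤ normV u := Real.sqrt_nonneg _

theorem normV_sq (u : L2) : normV u ^ 2 = ∑ j, ‖wderiv j u‖ ^ 2 :=
  Real.sq_sqrt (Finset.sum_nonneg fun _ _ => sq_nonneg _)

theorem norm_wderiv_le (u : L2) (j : Fin 2) : ‖wderiv j u‖ ≤ normV u :=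
  Real.le_sqrt_of_sq_le (Finset.single_le_sum (f := fun j => ‖wderiv j u‖ ^ 2)
    (fun _ _ => sq_nonneg _) (Finset.mem_univ j))

theorem normV_eq_norm (u : L2) :
    normV u = ‖(WithLp.toLp 2 fun j => wderiv j u : PiLp 2 fun _ : Fin 2 => L2)‖ := by
  rw [PiLp.norm_eq_of_L2]; rfl

theorem normV_add_le {u v : L2} (hu : u ∈ V) (hv : v ∈ V) : normV (u + v) ≤ normV u + normV v := by
  simp only [normV_eq_norm, wderiv_add hu hv]
  exact norm_add_le (WithLp.toLp 2 fun j => wderiv j u : PiLp 2 fun _ : Fin 2 => L2)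
    (WithLp.toLp 2 fun j => wderiv j v)

theorem abs_normV_sub_le {u v : L2} (hu : u ∈ V) (hv : v ∈ V) :
    |normV u - normV v| ≤ normV (u - v) := by
  simp only [normV_eq_norm, wderiv_sub hu hv]
  exact abs_norm_sub_norm_le (WithLp.toLp 2 fun j => wderiv j u : PiLp 2 fun _ : Fin 2 => L2)
    (WithLp.toLp 2 fun j => wderiv j v)

theorem normV_smul {u : L2} (c : ℝ) (hu : u ∈ V) : normV (c • u) = |c| * normV u := by
  simp only [normV_eq_norm, wderiv_smul c hu]
  exact norm_smul c (WithLp.toLp 2 fun j => wderiv j u : PiLp 2 fun _ : Fin 2 => L2)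

/-! ### Spectral estimates -/

/-- Each `∂_j` exchanges sine and cosine coefficients with factors `± k_j`; in the products the
signs cancel and `k_j²` remains. -/
theorem hasSum_waveSq_mul_of_weakDeriv {u v : L2} {f g : Fin 2 → L2}
    (hf : ∀ j, IsWeakDeriv j u (f j)) (hg : ∀ j, IsWeakDeriv j v (g j)) :
    HasSum (fun k => waveSq k * modePair u v k)
      ((2 * Real.pi) ^ 2 * ∑ j, inner ℝ (f j) (g j)) := by
  rw [Finset.mul_sum]
  refine (hasSum_sum fun j _ => hasSum_modePair (f j) (g j)).congr_fun fun k => ?_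
  rw [waveSq, Finset.sum_mul]
  refine Finset.sum_congr rfl fun j _ => ?_
  simp only [modePair, Finset.mul_sum, (hf j _ _).1, (hf j _ _).2, (hg j _ _).1, (hg j _ _).2]
  exact Finset.sum_congr rfl fun i _ => by ring

theorem IsNegLaplacian.hasSum {u f : L2} (h : IsNegLaplacian u f) (v : L2) :
    HasSum (fun k => waveSq k * modePair u v k) ((2 * Real.pi) ^ 2 * inner ℝ f v) := by
  refine (hasSum_modePair f v).congr_fun fun k => ?_
  simp only [modePair, Finset.mul_sum, (h _ _).1, (h _ _).2]
  exact Finset.sum_congr rfl fun i _ => by ring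

theorem IsNegLaplacian.inner_eq {u v φ : L2} {f g : Fin 2 → L2} (h : IsNegLaplacian u φ)
    (hf : ∀ j, IsWeakDeriv j u (f j)) (hg : ∀ j, IsWeakDeriv j v (g j)) :
    inner ℝ φ v = ∑ j, inner ℝ (f j) (g j) :=
  mul_left_cancel₀ two_pi_sq_pos.ne'
    ((h.hasSum v).unique (hasSum_waveSq_mul_of_weakDeriv hf hg))

theorem IsWeakDeriv.inner_eq_neg {j : Fin 2} {u v f g : L2} (hf : IsWeakDeriv j u f)
    (hg : IsWeakDeriv j v g) : inner ℝ f v = -inner ℝ u g := by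
  refine mul_left_cancel₀ two_pi_sq_pos.ne' ((hasSum_modePair f v).unique ?_)
  rw [mul_neg]
  refine (hasSum_modePair u g).neg.congr_fun fun k => ?_
  simp only [modePair, ← Finset.sum_neg_distrib, (hf _ _).1, (hf _ _).2, (hg _ _).1, (hg _ _).2]
  exact Finset.sum_congr rfl fun i _ => by ring

theorem hasSum_normV_sq {u : L2} (hu : u ∈ V) :
    HasSum (fun k => waveSq k * modePair u u k) ((2 * Real.pi) ^ 2 * normV u ^ 2) := by
  have h := hasSum_waveSq_mul_of_weakDeriv (V_weakDeriv hu) (V_weakDeriv hu)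
  simpa only [real_inner_self_eq_norm_sq, ← normV_sq] using h

theorem waveSq_nonneg (k : Wave) : 0 ≤ waveSq k := Finset.sum_nonneg fun _ _ => sq_nonneg _

theorem one_le_waveSq {k : Wave} (hk : k ≠ 0) : 1 ≤ waveSq k := by
  obtain ⟨i, hi⟩ := Function.ne_iff.mp hk
  have h1 : (1 : ℝ) ≤ (k i : ℝ) ^ 2 := by
    have : (1 : ℤ) ≤ k i ^ 2 := Order.one_le_iff_pos.mpr (sq_pos_of_ne_zero hi)
    exact_mod_cast this
  exact h1.trans (Finset.single_le_sum (f := fun j => (k j : ℝ) ^ 2)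
    (fun _ _ => sq_nonneg _) (Finset.mem_univ i))

theorem sinMode_zero (a : Plane) : sinMode 0 a = 0 := by
  have : (⟨fun x => (character 0 x).im • a, by fun_prop⟩ : C(Torus, Plane)) = 0 := by
    ext1 x; simp [character_zero]
  rw [sinMode, this, map_zero]

theorem modePair_zero {u : L2} (hu : u ∈ H) (v : L2) : modePair u v 0 = 0 := by
  simp [modePair, (mem_H_iff.mp hu).1, sinMode_zero]

theorem norm_le_normV {u : L2} (hu : u ∈ V) : ‖u‖ ≤ normV u := by
  have h := hasSum_le (fun k => ?_) (hasSum_modePair_self u) (hasSum_normV_sq hu)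
  · exact (sq_le_sq₀ (norm_nonneg _) (normV_nonneg _)).mp (le_of_mul_le_mul_left h two_pi_sq_pos)
  · by_cases hk : k = 0
    · subst hk; rw [modePair_zero hu.1, mul_zero]
    · exact le_mul_of_one_le_left (modePair_self_nonneg _ _) (one_le_waveSq hk)

/-- The difference of squares is the energy carried by `|k| > N`. There `|k|² ≥ N²`, and also `|k|²
≥ 1` because fields in `H` have no zero mode; hence the maximum, which matters when `N < 1`. -/
theorem norm_sub_projLow_sq_le {u : L2} (hu : u ∈ V) {N : ℝ} (hN : 0 ≤ N) :
    max 1 N ^ 2 * (‖u‖ ^ 2 - ‖projLow N u‖ ^ 2) ≤ normV u ^ 2 := by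
  refine le_of_mul_le_mul_left ?_ two_pi_sq_pos
  have h1 := ((hasSum_modePair_self u).sub (hasSum_modePair_self (projLow N u))).mul_left
    (max 1 N ^ 2)
  have h := hasSum_le (fun k => ?_) h1 (hasSum_normV_sq hu)
  · linarith
  · rw [modePair_projLow_left, modePair_comm u (projLow N u), modePair_projLow_left]
    split_ifs with hk
    · rw [sub_self, mul_zero]
      exact mul_nonneg (waveSq_nonneg _) (modePair_self_nonneg _ _)
    · rw [sub_zero]
      by_cases hk0 : k = 0
      · subst hk0; rw [modePair_zero hu.1, mul_zero, mul_zero]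
      · refine mul_le_mul_of_nonneg_right ?_ (modePair_self_nonneg _ _)
        rcases max_cases 1 N with ⟨h, _⟩ | ⟨h, _⟩ <;> rw [h]
        · simpa using one_le_waveSq hk0
        · exact (Real.le_sqrt hN (waveSq_nonneg k)).mp (not_le.mp hk).le

/-- Bernstein's inequality. It upgrades the decay of the low modes from `L²` to `V`. -/
theorem normV_projLow_le {u : L2} (hu : u ∈ V) {N : ℝ} (hN : 0 ≤ N) :
    normV (projLow N u) ≤ N * ‖projLow N u‖ := by
  have h := hasSum_le (fun k => ?_) (hasSum_normV_sq (V_projLow hu N))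
    ((hasSum_modePair_self (projLow N u)).mul_left (N ^ 2))
  · rw [← mul_assoc, mul_comm (N ^ 2), mul_assoc] at h
    rw [← sq_le_sq₀ (normV_nonneg _) (by positivity), mul_pow]
    exact le_of_mul_le_mul_left h two_pi_sq_pos
  · rw [modePair_projLow_left]
    split_ifs with hk
    · refine mul_le_mul_of_nonneg_right ?_ ?_
      · exact (Real.sqrt_le_left hN).mp hk
      · rw [modePair_comm, modePair_projLow_left, if_pos hk]
        exact modePair_self_nonneg _ _
    · simp

theorem inner_stokes_projLow {u : L2} (hu : u ∈ V) (hA : u ∈ domA) (N : ℝ) :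
    inner ℝ (stokes u) (projLow N u) = normV (projLow N u) ^ 2 := by
  have h1 := (isNegLaplacian_stokes hA).hasSum (projLow N u)
  refine mul_left_cancel₀ two_pi_sq_pos.ne' (h1.unique ?_)
  refine (hasSum_normV_sq (V_projLow hu N)).congr_fun fun k => ?_
  congr 1
  rw [modePair_projLow_left, modePair_comm, modePair_projLow_left]
  split_ifs
  · rw [modePair_comm]
  · rfl

theorem inner_stokes {u v : L2} (hu : u ∈ V) (hA : u ∈ domA) (hv : v ∈ V) :
    inner ℝ (stokes u) v = ∑ j, inner ℝ (wderiv j u) (wderiv j v) :=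
  (isNegLaplacian_stokes hA).inner_eq (V_weakDeriv hu) (V_weakDeriv hv)

theorem inner_stokes_self {u : L2} (hu : u ∈ V) (hA : u ∈ domA) :
    inner ℝ (stokes u) u = normV u ^ 2 := by
  simp only [inner_stokes hu hA hu, real_inner_self_eq_norm_sq, normV_sq]

theorem normV_projLow_le_normV {u : L2} (hu : u ∈ V) (N : ℝ) : normV (projLow N u) ≤ normV u := by
  refine Real.sqrt_le_sqrt (Finset.sum_le_sum fun j _ => ?_)
  rw [wderiv_projLow hu]
  gcongr
  exact norm_projLow_le _ _

theorem tendsto_normV_sub_projLow {u : L2} (hu : u ∈ V) :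
    Tendsto (fun n : ℕ => normV (u - projLow n u)) atTop (𝓝 0) := by
  have h (j : Fin 2) : Tendsto (fun n : ℕ => ‖wderiv j (u - projLow n u)‖ ^ 2) atTop (𝓝 0) := by
    simp only [wderiv_sub hu (V_projLow hu _), wderiv_projLow hu]
    have := ((tendsto_const_nhds (x := wderiv j u)).sub (tendsto_projLow (wderiv j u))).norm.pow 2
    simpa using this
  have h2 := (tendsto_finsetSum Finset.univ fun j _ => h j).sqrt
  simpa [normV] using h2

/-! ### Truncations are smooth; regularity on the domain of the Stokes operator -/

/-- The continuously differentiable fields, as elements of `L²`. -/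
def smoothFields : Submodule ℝ L2 where
  carrier := {u | ∃ φ D, IsC1 φ D ∧ u = ofField φ}
  add_mem' := by
    rintro _ _ ⟨φ, D, h, rfl⟩ ⟨ψ, D', h', rfl⟩
    exact ⟨_, _, h.add h', (ofField_add φ ψ).symm⟩
  zero_mem' := ⟨0, fun _ => 0, fun _ _ => hasDerivAt_const _ _, (map_zero _).symm⟩
  smul_mem' := by
    rintro c _ ⟨φ, D, h, rfl⟩
    exact ⟨_, _, h.smul c, (ofField_smul c φ).symm⟩

theorem cosMode_mem_smoothFields (k : Wave) (a : Plane) : cosMode k a ∈ smoothFields :=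
  ⟨_, _, isC1_cosField k a, rfl⟩

theorem sinMode_mem_smoothFields (k : Wave) (a : Plane) : sinMode k a ∈ smoothFields :=
  ⟨_, _, isC1_sinField k a, rfl⟩

theorem finite_low_waves (N : ℝ) : {k : Wave | √(waveSq k) ≤ N}.Finite := by
  refine (Set.finite_Icc (fun _ : Fin 2 => -⌈N⌉) (fun _ => ⌈N⌉)).subset fun k hk => ?_
  have hj (j : Fin 2) : |(k j : ℝ)| ≤ ⌈N⌉ := by
    refine le_trans ?_ (le_trans (b := N) hk (Int.le_ceil N))
    rw [← Real.sqrt_sq_eq_abs]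
    exact Real.sqrt_le_sqrt (Finset.single_le_sum (f := fun j => (k j : ℝ) ^ 2)
      (fun _ _ => sq_nonneg _) (Finset.mem_univ j))
  have hj' (j : Fin 2) := abs_le.mp (hj j)
  exact ⟨fun j => by exact_mod_cast (hj' j).1, fun j => by exact_mod_cast (hj' j).2⟩

/-- Parseval against an arbitrary field, where only finitely many wavenumbers survive. Truncations
are thus trigonometric polynomials, so classical calculus applies to them. -/
theorem projLow_eq_sum (N : ℝ) (u : L2) :
    projLow N u = ((2 * Real.pi) ^ 2)⁻¹ • ∑ k ∈ (finite_low_waves N).toFinset, ∑ i,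
      (inner ℝ u (cosMode k (unitVec i)) • cosMode k (unitVec i) +
        inner ℝ u (sinMode k (unitVec i)) • sinMode k (unitVec i)) := by
  refine ext_inner_right ℝ fun v => ?_
  refine mul_left_cancel₀ two_pi_sq_pos.ne' ((hasSum_modePair (projLow N u) v).unique ?_)
  rw [real_inner_smul_left, mul_inv_cancel_left₀ two_pi_sq_pos.ne', sum_inner]
  have h := hasSum_sum_of_ne_finset_zero (L := .unconditional _) (f := modePair (projLow N u) v)
    (s := (finite_low_waves N).toFinset) fun k hk => by
      rw [modePair_projLow_left, if_neg]
      simpa using hk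
  convert h using 1
  refine Finset.sum_congr rfl fun k hk => ?_
  rw [modePair_projLow_left, if_pos (by simpa using hk), modePair, sum_inner]
  refine Finset.sum_congr rfl fun i _ => ?_
  rw [inner_add_left, real_inner_smul_left, real_inner_smul_left, real_inner_comm v,
    real_inner_comm v]

theorem projLow_mem_smoothFields (N : ℝ) (u : L2) : projLow N u ∈ smoothFields := by
  rw [projLow_eq_sum]
  exact smoothFields.smul_mem _ (smoothFields.sum_mem fun k _ => smoothFields.sum_mem fun i _ =>
    smoothFields.add_mem (smoothFields.smul_mem _ (cosMode_mem_smoothFields _ _))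
      (smoothFields.smul_mem _ (sinMode_mem_smoothFields _ _)))

theorem exists_weakDeriv_projLow (N : ℝ) (u : L2) (j : Fin 2) :
    ∃ g, IsWeakDeriv j (projLow N u) g := by
  obtain ⟨φ, D, h, hu⟩ := projLow_mem_smoothFields N u
  exact ⟨_, hu ▸ h.isWeakDeriv j⟩

theorem projLow_mem_V {u : L2} (hu : u ∈ H) (N : ℝ) : projLow N u ∈ V :=
  ⟨projLow_mem_H hu N, exists_weakDeriv_projLow N u⟩

/-- The weak derivative is closed: the derivatives are Cauchy by comparison with `fn`, and the
defining identities pass to the limit coefficient by coefficient. -/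
theorem exists_weakDeriv_of_tendsto {j : Fin 2} {z : L2} {zn gn fn : ℕ → L2}
    (hz : Tendsto zn atTop (𝓝 z)) (hg : ∀ n, IsWeakDeriv j (zn n) (gn n)) (hf : CauchySeq fn)
    (h : ∀ m n, ‖gn m - gn n‖ ≤ ‖fn m - fn n‖) : ∃ g, IsWeakDeriv j z g := by
  have hc : CauchySeq gn := by
    rw [Metric.cauchySeq_iff] at hf ⊢
    intro ε hε
    obtain ⟨M, hM⟩ := hf ε hε
    refine ⟨M, fun m hm n hn => ?_⟩
    have := hM m hm n hn
    rw [dist_eq_norm] at this ⊢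
    exact (h m n).trans_lt this
  obtain ⟨g, hgl⟩ := cauchySeq_tendsto_of_complete hc
  refine ⟨g, fun k a => ⟨?_, ?_⟩⟩
  · refine tendsto_nhds_unique (hgl.inner tendsto_const_nhds) ?_
    simp only [(hg _ k a).1]
    exact (hz.inner tendsto_const_nhds).const_mul _
  · refine tendsto_nhds_unique (hgl.inner tendsto_const_nhds) ?_
    simp only [(hg _ k a).2]
    exact ((hz.inner tendsto_const_nhds).const_mul _).neg

/-- `‖u‖² = (-Δu, u) ≤ |f| |u| ≤ |f| ‖u‖` by Poincaré's inequality. -/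
theorem IsNegLaplacian.normV_le {u f : L2} (h : IsNegLaplacian u f) (hu : u ∈ V) :
    normV u ≤ ‖f‖ := by
  have h1 := h.inner_eq (V_weakDeriv hu) (V_weakDeriv hu)
  simp only [real_inner_self_eq_norm_sq, ← normV_sq] at h1
  by_contra! hlt
  have h2 := real_inner_le_norm f u
  have h3 := norm_le_normV hu
  have h4 := norm_nonneg f
  nlinarith [norm_nonneg u]

theorem IsNegLaplacian.wderiv {u f d e : L2} {j : Fin 2} (h : IsNegLaplacian u f)
    (hd : IsWeakDeriv j u d) (he : IsWeakDeriv j f e) : IsNegLaplacian d e := by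
  intro k a
  rw [(he k a).1, (he k a).2, (hd k a).1, (hd k a).2, (h k a).1, (h k a).2]
  constructor <;> ring

theorem domA_subset_V {u : L2} (hu : u ∈ domA) : u ∈ V := by
  refine ⟨hu.1, fun j => ?_⟩
  have hA := isNegLaplacian_stokes hu
  have hv (n : ℕ) := projLow_mem_V hu.1 n
  refine exists_weakDeriv_of_tendsto (tendsto_projLow u) (fun n => V_weakDeriv (hv n) j)
    (tendsto_projLow (stokes u)).cauchySeq fun m n => ?_
  rw [← wderiv_sub (hv m) (hv n)]
  exact (norm_wderiv_le _ j).trans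
    (((hA.projLow m).sub (hA.projLow n)).normV_le (V_sub (hv m) (hv n)))

/-- `‖∂_j u‖² = (∂_j f, ∂_j u) = -(f, ∂_j ∂_j u) ≤ |f| ‖∂_j u‖`. -/
theorem IsNegLaplacian.normV_wderiv_le {u f e : L2} {j : Fin 2} (h : IsNegLaplacian u f)
    (hu : u ∈ V) (hd : NSE.wderiv j u ∈ V) (he : IsWeakDeriv j f e) :
    normV (NSE.wderiv j u) ≤ ‖f‖ := by
  have hA := h.wderiv (V_weakDeriv hu j) he
  have h1 := hA.inner_eq (V_weakDeriv hd) (V_weakDeriv hd)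
  simp only [real_inner_self_eq_norm_sq, ← normV_sq] at h1
  rw [he.inner_eq_neg (V_weakDeriv hd j)] at h1
  by_contra! hlt
  have h2 := neg_le_of_abs_le (abs_real_inner_le_norm f (NSE.wderiv j (NSE.wderiv j u)))
  have h3 := norm_wderiv_le (NSE.wderiv j u) j
  nlinarith [norm_nonneg f]

/-- `H²` regularity, by the preceding estimate on differences of truncations. It puts `∇v` in `L⁴`,
so that `(u · ∇) v` is square integrable for `u, v ∈ D(A)`. -/
theorem wderiv_mem_V_of_domA {u : L2} (hu : u ∈ domA) (j : Fin 2) : wderiv j u ∈ V := by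
  have hV := domA_subset_V hu
  have hH : wderiv j u ∈ H := (V_weakDeriv hV j).mem_H hu.1
  refine ⟨hH, fun i => ?_⟩
  have hA := isNegLaplacian_stokes hu
  have hv (n : ℕ) := projLow_mem_V hu.1 n
  have hd (n : ℕ) := projLow_mem_V hH n
  refine exists_weakDeriv_of_tendsto (tendsto_projLow _) (fun n => V_weakDeriv (hd n) i)
    (tendsto_projLow (stokes u)).cauchySeq fun m n => ?_
  rw [← wderiv_sub (hd m) (hd n)]
  refine (norm_wderiv_le _ i).trans ?_
  have he (n : ℕ) := isWeakDeriv_wderiv (exists_weakDeriv_projLow n (stokes u) j)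
  have hsub : wderiv j (projLow m u - projLow n u) =
      projLow m (wderiv j u) - projLow n (wderiv j u) := by
    rw [wderiv_sub (hv m) (hv n), wderiv_projLow hV, wderiv_projLow hV]
  rw [← hsub]
  exact ((hA.projLow m).sub (hA.projLow n)).normV_wderiv_le (V_sub (hv m) (hv n))
    (hsub ▸ V_sub (hd m) (hd n)) ((he m).sub (he n))

theorem domA_sub {u v : L2} (hu : u ∈ domA) (hv : v ∈ domA) : u - v ∈ domA :=
  ⟨H.sub_mem hu.1 hv.1, _, (isNegLaplacian_stokes hu).sub (isNegLaplacian_stokes hv)⟩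

theorem stokes_sub {u v : L2} (hu : u ∈ domA) (hv : v ∈ domA) :
    stokes (u - v) = stokes u - stokes v :=
  ((isNegLaplacian_stokes hu).sub (isNegLaplacian_stokes hv)).stokes_eq (H.sub_mem hu.1 hv.1)

/-! ### Ladyzhenskaya's inequality -/

/-- The circle of length `2π`. -/
abbrev Circ : Type := AddCircle (2 * Real.pi)

theorem integrable_of_continuous {X : Type*} [TopologicalSpace X] [CompactSpace X]
    [MeasurableSpace X] [OpensMeasurableSpace X] {μ : Measure X} [IsFiniteMeasure μ]
    {f : X → ℝ} (hf : Continuous f) : Integrable f μ :=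
  hf.integrable_of_hasCompactSupport (HasCompactSupport.of_compactSpace _)

theorem continuous_pair : Continuous fun p : Circ × Circ => (![p.1, p.2] : Torus) := by
  refine continuous_pi fun i => ?_
  fin_cases i
  · exact continuous_fst
  · exact continuous_snd

theorem integral_torus_eq (f : C(Torus, ℝ)) :
    ∫ x, f x = ∫ a : Circ, ∫ b : Circ, f ![a, b] := by
  have h := (volume_preserving_finTwoArrow Circ).symm.integral_comp'
    (g := fun x => f x)
  rw [← h, Measure.volume_eq_prod, integral_prod]
  · rfl
  · exact integrable_of_continuous (f.continuous.comp continuous_pair)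

theorem integral_torus_eq_swap (f : C(Torus, ℝ)) :
    ∫ x, f x = ∫ b : Circ, ∫ a : Circ, f ![a, b] := by
  rw [integral_torus_eq]
  exact integral_integral_swap (f := fun a b => f ![a, b])
    (integrable_of_continuous (f.continuous.comp continuous_pair))

/-- Along a circle the value at `x` is at most the value at any other point plus the total
variation; average over that other point. -/
theorem IsC1.le_integral_line {f : C(Torus, ℝ)} {D : Fin 2 → C(Torus, ℝ)} (h : IsC1 f D)
    (j : Fin 2) (x : Torus) :
    f x ≤ ∫ y : Circ, ((2 * Real.pi)⁻¹ * f (x + Pi.single j y) + |D j (x + Pi.single j y)|) := by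
  have hpi := Real.two_pi_pos
  rw [← AddCircle.intervalIntegral_preimage (2 * Real.pi) 0, zero_add]
  set q : ℝ → ℝ := fun s => f (x + Pi.single j (s : Circ)) with hq
  set q' : ℝ → ℝ := fun s => D j (x + Pi.single j (s : Circ)) with hq'
  have hline := continuous_single_coe j
  have hqc : Continuous q := by
    exact f.continuous.comp (continuous_const.add hline)
  have hqc' : Continuous q' := by
    exact (D j).continuous.comp (continuous_const.add hline)
  have hfx : f x = q 0 := by simp [hq]
  have hpt (s : ℝ) (hs : s ∈ Set.Icc 0 (2 * Real.pi)) :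
      f x ≤ q s + ∫ t in (0 : ℝ)..(2 * Real.pi), |q' t| := by
    have h1 : ∫ t in (0 : ℝ)..s, q' t = q s - q 0 :=
      intervalIntegral.integral_eq_sub_of_hasDerivAt (fun t _ => h.hasDerivAt_line j x t)
        (hqc'.intervalIntegrable _ _)
    have h2 : |∫ t in (0 : ℝ)..s, q' t| ≤ ∫ t in (0 : ℝ)..s, |q' t| :=
      intervalIntegral.abs_integral_le_integral_abs hs.1
    have h3 : ∫ t in (0 : ℝ)..s, |q' t| ≤ ∫ t in (0 : ℝ)..(2 * Real.pi), |q' t| :=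
      intervalIntegral.integral_mono_interval le_rfl hs.1 hs.2
        (Eventually.of_forall fun _ => abs_nonneg _) (hqc'.abs.intervalIntegrable _ _)
    have h4 := neg_le_of_abs_le h2
    linarith
  have hint := intervalIntegral.integral_mono_on hpi.le (intervalIntegrable_const (μ := volume))
    ((hqc.add continuous_const).intervalIntegrable 0 (2 * Real.pi)) hpt
  simp only [Pi.add_apply] at hint
  rw [intervalIntegral.integral_const, intervalIntegral.integral_add
    (hqc.intervalIntegrable _ _) intervalIntegrable_const, intervalIntegral.integral_const,
    smul_eq_mul, smul_eq_mul, sub_zero] at hint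
  change _ ≤ ∫ s in (0 : ℝ)..(2 * Real.pi), ((2 * Real.pi)⁻¹ * q s + |q' s|)
  rw [intervalIntegral.integral_add ((hqc.const_mul _).intervalIntegrable _ _)
    (hqc'.abs.intervalIntegrable _ _), intervalIntegral.integral_const_mul]
  calc f x = (2 * Real.pi)⁻¹ * (2 * Real.pi * f x) := by field_simp
    _ ≤ (2 * Real.pi)⁻¹ * ((∫ s in (0 : ℝ)..(2 * Real.pi), q s) +
        2 * Real.pi * ∫ t in (0 : ℝ)..(2 * Real.pi), |q' t|) := by gcongr
    _ = _ := by field_simp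

/-- Gagliardo's argument: by the line estimate `f(a, b)` is bounded by a function of `a` alone and
by a function of `b` alone. Their product dominates `f²` and integrates to a product by Fubini. -/
theorem IsC1.integral_sq_le {f : C(Torus, ℝ)} {D : Fin 2 → C(Torus, ℝ)} (h : IsC1 f D)
    (hf : ∀ x, 0 ≤ f x) {K : ℝ} (hK : ∀ j, ∫ x, ((2 * Real.pi)⁻¹ * f x + |D j x|) ≤ K) :
    ∫ x, f x ^ 2 ≤ K ^ 2 := by
  set g : Fin 2 → C(Torus, ℝ) := fun j =>
    ⟨fun x => (2 * Real.pi)⁻¹ * f x + |D j x|, by fun_prop⟩ with hg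
  have hg0 (j : Fin 2) (x : Torus) : 0 ≤ g j x :=
    add_nonneg (mul_nonneg (by positivity) (hf x)) (abs_nonneg _)
  have h0 (a b : Circ) : f ![a, b] ≤ ∫ y : Circ, g 0 ![y, b] := by
    refine (h.le_integral_line 0 ![a, b]).trans_eq ?_
    rw [← integral_add_left_eq_self (fun y => g 0 ![y, b]) a]
    have (y : Circ) : (![a, b] : Torus) + Pi.single 0 y = ![a + y, b] := by
      ext i; fin_cases i <;> simp
    simp only [this]
    rfl
  have h1 (a b : Circ) : f ![a, b] ≤ ∫ y : Circ, g 1 ![a, y] := by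
    refine (h.le_integral_line 1 ![a, b]).trans_eq ?_
    rw [← integral_add_left_eq_self (fun y => g 1 ![a, y]) b]
    have (y : Circ) : (![a, b] : Torus) + Pi.single 1 y = ![a, b + y] := by
      ext i; fin_cases i <;> simp
    simp only [this]
    rfl
  have hc0 : Continuous fun b : Circ => ∫ y : Circ, g 0 ![y, b] := by
    have := continuous_parametric_integral_of_continuous (μ := (volume : Measure Circ))
      (f := fun (b y : Circ) => g 0 ![y, b]) (s := Set.univ)
      ((g 0).continuous.comp (continuous_pair.comp continuous_swap)) isCompact_univ
    simpa using this
  have hc1 : Continuous fun a : Circ => ∫ y : Circ, g 1 ![a, y] := by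
    have := continuous_parametric_integral_of_continuous (μ := (volume : Measure Circ))
      (f := fun (a y : Circ) => g 1 ![a, y]) (s := Set.univ)
      ((g 1).continuous.comp continuous_pair) isCompact_univ
    simpa using this
  have hle : ∫ x, f x ^ 2 ≤ (∫ x, g 1 x) * ∫ x, g 0 x := by
    have hsq := integral_torus_eq ⟨fun x => f x ^ 2, by fun_prop⟩
    simp only [ContinuousMap.coe_mk] at hsq
    rw [hsq, integral_torus_eq (g 1), integral_torus_eq_swap (g 0),
      ← integral_prod_mul (f := fun a : Circ => ∫ y : Circ, g 1 ![a, y])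
        (g := fun b : Circ => ∫ y : Circ, g 0 ![y, b]), ← integral_prod (f := fun p : Circ × Circ =>
          f ![p.1, p.2] ^ 2)
        (integrable_of_continuous ((f.continuous.comp continuous_pair).pow 2))]
    refine integral_mono (integrable_of_continuous ((f.continuous.comp continuous_pair).pow 2))
      (integrable_of_continuous ((hc1.comp continuous_fst).mul (hc0.comp continuous_snd)))
      fun p => ?_
    simp only [sq]
    exact mul_le_mul (h1 _ _) (h0 _ _) (hf _) (integral_nonneg fun y => hg0 1 _)
  refine hle.trans ?_
  rw [sq]
  exact mul_le_mul (hK 1) (hK 0) (integral_nonneg (hg0 0))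
    ((integral_nonneg (hg0 1)).trans (hK 1))

theorem norm_ofField_sq (φ : C(Torus, Plane)) : ‖ofField φ‖ ^ 2 = ∫ x, ‖φ x‖ ^ 2 := by
  rw [← real_inner_self_eq_norm_sq, inner_ofField]
  simp [innerC]

/-- The previous bound for `f = |φ|²`, with `|∂_j f| ≤ 2 |φ| |∂_j φ|`. Young's inequality with
weights `W / A` and `A / W` bounds the derivative part by `2 W A`; the zeroth-order part is at most
`A² ≤ W A`. -/
theorem IsC1.integral_norm_pow_four_le {φ : C(Torus, Plane)} {D : Fin 2 → C(Torus, Plane)}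
    (h : IsC1 φ D) {A W : ℝ} (hA : 0 < A) (hAW : A ≤ W) (hφ : ‖ofField φ‖ ≤ A)
    (hD : ∀ j, ‖ofField (D j)‖ ≤ W) : ∫ x, ‖φ x‖ ^ 4 ≤ (3 * W * A) ^ 2 := by
  have hW : 0 < W := hA.trans_le hAW
  have h2 := (h.innerC h).integral_sq_le (fun x => real_inner_self_nonneg (x := φ x)) (K := 3 * W * A) ?_
  · convert h2 using 2
    ext x
    change _ = inner ℝ (φ x) (φ x) ^ 2
    rw [real_inner_self_eq_norm_sq]
    ring
  · intro j
    have hφ2 : ∫ x, ‖φ x‖ ^ 2 ≤ A ^ 2 := by rw [← norm_ofField_sq]; gcongr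
    have hD2 : ∫ x, ‖D j x‖ ^ 2 ≤ W ^ 2 := by rw [← norm_ofField_sq]; gcongr; exact hD j
    have hi1 : Integrable (fun x => ‖φ x‖ ^ 2) (volume : Measure Torus) :=
      integrable_of_continuous (by fun_prop)
    have hi2 : Integrable (fun x => ‖D j x‖ ^ 2) (volume : Measure Torus) :=
      integrable_of_continuous (by fun_prop)
    have hpi : (2 * Real.pi)⁻¹ ≤ 1 := by
      apply inv_le_one_of_one_le₀; linarith [Real.pi_gt_three]
    calc _ ≤ ∫ x, ((1 + W / A) * ‖φ x‖ ^ 2 + A / W * ‖D j x‖ ^ 2) := by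
          refine integral_mono (integrable_of_continuous (by fun_prop)) ((hi1.const_mul _).add
            (hi2.const_mul _)) fun x => ?_
          simp only [NSE.innerC, ContinuousMap.coe_mk, ContinuousMap.add_apply,
            real_inner_self_eq_norm_sq, real_inner_comm (φ x) (D j x)]
          have hab : |inner ℝ (φ x) (D j x) + inner ℝ (φ x) (D j x)| ≤
              W / A * ‖φ x‖ ^ 2 + A / W * ‖D j x‖ ^ 2 := by
            rw [← two_mul, abs_mul, abs_two]
            have h3 := abs_real_inner_le_norm (φ x) (D j x)
            have h4 : 2 * (‖φ x‖ * ‖D j x‖) ≤ W / A * ‖φ x‖ ^ 2 + A / W * ‖D j x‖ ^ 2 := by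
              rw [← sub_nonneg]
              have : W / A * ‖φ x‖ ^ 2 + A / W * ‖D j x‖ ^ 2 - 2 * (‖φ x‖ * ‖D j x‖) =
                  (W * ‖φ x‖ - A * ‖D j x‖) ^ 2 / (W * A) := by field_simp; ring
              rw [this]; positivity
            linarith
          have h5 : (2 * Real.pi)⁻¹ * ‖φ x‖ ^ 2 ≤ 1 * ‖φ x‖ ^ 2 := by gcongr
          linarith
      _ = (1 + W / A) * (∫ x, ‖φ x‖ ^ 2) + A / W * ∫ x, ‖D j x‖ ^ 2 := by
          rw [integral_add (hi1.const_mul _) (hi2.const_mul _), integral_const_mul,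
            integral_const_mul]
      _ ≤ (1 + W / A) * A ^ 2 + A / W * W ^ 2 := by gcongr
      _ = A * A + 2 * W * A := by field_simp; ring
      _ ≤ 3 * W * A := by nlinarith

theorem eLpNorm_four_le_of_smooth {u : L2} (hu : u ∈ V) (hs : u ∈ smoothFields) :
    eLpNorm u 4 (volume : Measure Torus) ^ 2 ≤ ENNReal.ofReal (3 * normV u * ‖u‖) := by
  obtain ⟨φ, D, h, rfl⟩ := hs
  by_cases h0 : ofField φ = 0
  · rw [h0, eLpNorm_congr_ae (Lp.coeFn_zero _ _ _)]
    simp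
  have hD (j : Fin 2) : wderiv j (ofField φ) = ofField (D j) := (h.isWeakDeriv j).wderiv_eq
  have h4 := h.integral_norm_pow_four_le (norm_pos_iff.mpr h0) (norm_le_normV hu) le_rfl
    fun j => by rw [← hD]; exact norm_wderiv_le _ j
  rw [eLpNorm_congr_ae (ofField_coeFn φ)]
  rw [← ENNReal.pow_le_pow_left_iff (two_ne_zero), ← pow_mul]
  have h5 := eLpNorm_nnreal_pow_eq_lintegral (f := φ) (μ := (volume : Measure Torus))
    (p := 4) (by norm_num)
  have h6 : eLpNorm φ 4 (volume : Measure Torus) ^ (2 * 2) = ∫⁻ x, ‖φ x‖ₑ ^ 4 := by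
    have : ((4 : NNReal) : ℝ) = ((4 : ℕ) : ℝ) := by norm_num
    rw [this] at h5
    simpa only [ENNReal.rpow_natCast, ENNReal.coe_ofNat] using h5
  rw [h6, ← ENNReal.ofReal_pow (by have := normV_nonneg (ofField φ); positivity)]
  refine le_trans (le_of_eq ?_) (ENNReal.ofReal_le_ofReal h4)
  rw [ofReal_integral_eq_lintegral_ofReal (integrable_of_continuous (by fun_prop))
    (Eventually.of_forall fun x => by positivity)]
  refine lintegral_congr fun x => ?_
  rw [ENNReal.ofReal_pow (norm_nonneg _), ofReal_norm]

/-- The smooth bound holds for the truncations `P_n u`, and Fatou's lemma along an almost everywhere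
convergent subsequence carries it to `u`. Having some explicit constant makes `N₀` depend on the
data only. -/
theorem isLadyzhenskayaConst_three : IsLadyzhenskayaConst 3 := by
  refine ⟨by norm_num, fun u hu => ?_⟩
  set K : ℝ≥0∞ := ENNReal.ofReal (3 * normV u * ‖u‖) with hK
  have hn (n : ℕ) : eLpNorm (projLow n u) 4 (volume : Measure Torus) ≤ K ^ (2⁻¹ : ℝ) := by
    have h1 := eLpNorm_four_le_of_smooth (V_projLow hu n) (projLow_mem_smoothFields n u)
    have h2 : ENNReal.ofReal (3 * normV (projLow n u) * ‖projLow n u‖) ≤ K := by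
      apply ENNReal.ofReal_le_ofReal
      have := normV_projLow_le_normV hu n
      have := norm_projLow_le n u
      have := normV_nonneg u
      gcongr
    rw [ENNReal.le_rpow_inv_iff (by norm_num), ENNReal.rpow_ofNat]
    exact h1.trans h2
  obtain ⟨ns, -, hae⟩ := (tendstoInMeasure_of_tendsto_Lp (tendsto_projLow u)).exists_seq_tendsto_ae
  have h := Lp.eLpNorm_lim_le_liminf_eLpNorm (p := 4) (f := fun i => projLow (ns i : ℕ) u)
    (fun i => Lp.aestronglyMeasurable _) u hae
  have h2 : eLpNorm u 4 (volume : Measure Torus) ≤ K ^ (2⁻¹ : ℝ) := by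
    refine h.trans (liminf_le_of_le (by isBoundedDefault) fun b hb => ?_)
    obtain ⟨n, hn'⟩ := hb.exists
    exact hn'.trans (hn _)
  rwa [ENNReal.le_rpow_inv_iff (by norm_num), ENNReal.rpow_ofNat] at h2

/-! ### Products of fields and the trilinear form -/

instance instHolderFourFourTwo : ENNReal.HolderTriple 4 4 2 := ⟨by
  rw [← two_mul, ← ENNReal.toReal_eq_toReal_iff' (by finiteness) (by finiteness)]
  norm_num⟩

/-- The `L⁴` norm. -/
def norm4 (u : L2) : ℝ := (eLpNorm u 4 (volume : Measure Torus)).toReal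

/-- The fields in `L⁴`. -/
def L4 : Submodule ℝ L2 where
  carrier := {u | MemLp u 4 (volume : Measure Torus)}
  add_mem' := fun ha hb => (MemLp.add ha hb).ae_eq (Lp.coeFn_add _ _).symm
  zero_mem' := (MemLp.zero (ε := Plane)).ae_eq (Lp.coeFn_zero _ _ _).symm
  smul_mem' := fun c _ hu => (MemLp.const_smul hu c).ae_eq (Lp.coeFn_smul _ _).symm

theorem norm4_nonneg (u : L2) : 0 ≤ norm4 u := ENNReal.toReal_nonneg

theorem memLp_mulField {u w : L2} (hu : u ∈ L4) (hw : w ∈ L4) (j : Fin 2) :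
    MemLp (fun x => u x j • w x) 2 (volume : Measure Torus) :=
  MemLp.smul (p := 4) (q := 4) hw ((EuclideanSpace.proj (𝕜 := ℝ) j).comp_memLp' hu)

open Classical in
/-- The product of the `j`-th component of `u` with `w` (zero if it is not square integrable). -/
def mulField (j : Fin 2) (u w : L2) : L2 :=
  if h : MemLp (fun x => u x j • w x) 2 (volume : Measure Torus) then h.toLp _ else 0

theorem mulField_coeFn {u w : L2} (hu : u ∈ L4) (hw : w ∈ L4) (j : Fin 2) :
    mulField j u w =ᵐ[volume] fun x => u x j • w x := by
  rw [mulField, dif_pos (memLp_mulField hu hw j)]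
  exact MemLp.coeFn_toLp _

theorem norm_mulField_le {u w : L2} (hu : u ∈ L4) (hw : w ∈ L4) (j : Fin 2) :
    ‖mulField j u w‖ ≤ norm4 u * norm4 w := by
  rw [mulField, dif_pos (memLp_mulField hu hw j), Lp.norm_toLp, norm4, norm4, ← ENNReal.toReal_mul]
  refine ENNReal.toReal_mono (ENNReal.mul_ne_top hu.2.ne hw.2.ne) ?_
  refine (eLpNorm_smul_le_mul_eLpNorm (p := 4) (q := 4) (r := 2) hw.1
    ((EuclideanSpace.proj (𝕜 := ℝ) j).comp_memLp' hu).1).trans ?_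
  gcongr
  exact eLpNorm_mono fun x => PiLp.norm_apply_le (u x) j

theorem mulField_add_left {u u' w : L2} (hu : u ∈ L4) (hu' : u' ∈ L4) (hw : w ∈ L4) (j : Fin 2) :
    mulField j (u + u') w = mulField j u w + mulField j u' w := by
  ext1
  filter_upwards [mulField_coeFn (L4.add_mem hu hu') hw j, mulField_coeFn hu hw j,
    mulField_coeFn hu' hw j, Lp.coeFn_add u u', Lp.coeFn_add (mulField j u w) (mulField j u' w)]
    with x h1 h2 h3 h4 h5
  rw [h1, h5, h4, Pi.add_apply, Pi.add_apply, h2, h3, PiLp.add_apply, add_smul]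

theorem mulField_add_right {u w w' : L2} (hu : u ∈ L4) (hw : w ∈ L4) (hw' : w' ∈ L4) (j : Fin 2) :
    mulField j u (w + w') = mulField j u w + mulField j u w' := by
  ext1
  filter_upwards [mulField_coeFn hu (L4.add_mem hw hw') j, mulField_coeFn hu hw j,
    mulField_coeFn hu hw' j, Lp.coeFn_add w w', Lp.coeFn_add (mulField j u w) (mulField j u w')]
    with x h1 h2 h3 h4 h5
  rw [h1, h5, h4, Pi.add_apply, Pi.add_apply, h2, h3, smul_add]

theorem inner_mulField {u g w : L2} (hu : u ∈ L4) (hg : g ∈ L4) (hw : w ∈ L4) (j : Fin 2) :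
    inner ℝ (mulField j u g) w = inner ℝ g (mulField j u w) := by
  rw [L2.inner_def, L2.inner_def]
  refine integral_congr_ae ?_
  filter_upwards [mulField_coeFn hu hg j, mulField_coeFn hu hw j] with x h1 h2
  rw [h1, h2, real_inner_smul_left, real_inner_smul_right]

/-- The trilinear form `b(u, v, w) = ∑_j ∫ u_j ∂_j v · w`. -/
def tri (u v w : L2) : ℝ := ∑ j, inner ℝ (wderiv j v) (mulField j u w)

theorem V_mem_L4 {C : ℝ} (hC : IsLadyzhenskayaConst C) {u : L2} (hu : u ∈ V) : u ∈ L4 := by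
  refine ⟨Lp.aestronglyMeasurable _, ?_⟩
  have h := (hC.2 u hu).trans_lt ENNReal.ofReal_lt_top
  by_contra h'
  rw [not_lt, top_le_iff] at h'
  rw [h'] at h
  simp at h

theorem norm4_sq_le {C : ℝ} (hC : IsLadyzhenskayaConst C)
    {u : L2} (hu : u ∈ V) : norm4 u ^ 2 ≤ C * normV u * ‖u‖ := by
  have h := ENNReal.toReal_mono ENNReal.ofReal_ne_top (hC.2 u hu)
  rwa [ENNReal.toReal_pow, ENNReal.toReal_ofReal] at h
  exact mul_nonneg (mul_nonneg hC.1.le (normV_nonneg u)) (norm_nonneg u)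

theorem norm4_mul_le {C : ℝ} (hC : IsLadyzhenskayaConst C) {u w : L2} (hu : u ∈ V) (hw : w ∈ V) :
    norm4 u * norm4 w ≤ C * normV u * normV w := by
  have h1 : norm4 u ^ 2 ≤ C * normV u ^ 2 := (norm4_sq_le hC hu).trans (by
    rw [sq, ← mul_assoc]
    exact mul_le_mul_of_nonneg_left (norm_le_normV hu) (mul_nonneg hC.1.le (normV_nonneg u)))
  have h2 : norm4 w ^ 2 ≤ C * normV w ^ 2 := (norm4_sq_le hC hw).trans (by
    rw [sq, ← mul_assoc]
    exact mul_le_mul_of_nonneg_left (norm_le_normV hw) (mul_nonneg hC.1.le (normV_nonneg w)))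
  have hr : 0 ≤ C * normV u * normV w :=
    mul_nonneg (mul_nonneg hC.1.le (normV_nonneg u)) (normV_nonneg w)
  refine abs_le_of_sq_le_sq' ?_ hr |>.2
  calc (norm4 u * norm4 w) ^ 2 = norm4 u ^ 2 * norm4 w ^ 2 := by ring
    _ ≤ (C * normV u ^ 2) * (C * normV w ^ 2) :=
      mul_le_mul h1 h2 (sq_nonneg _) ((sq_nonneg _).trans h1)
    _ = _ := by ring

/-- Hölder with exponents 2, 4, 4 in each of the two directions, which is where the factor 2 comes
from. -/
theorem abs_tri_le {C : ℝ} (hC : IsLadyzhenskayaConst C) {u v w : L2} (hu : u ∈ V) (hw : w ∈ V) :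
    |tri u v w| ≤ 2 * normV v * (norm4 u * norm4 w) := by
  have h (j : Fin 2) : |inner ℝ (wderiv j v) (mulField j u w)| ≤ normV v * (norm4 u * norm4 w) :=
    (abs_real_inner_le_norm _ _).trans (mul_le_mul (norm_wderiv_le v j)
      (norm_mulField_le (V_mem_L4 hC hu) (V_mem_L4 hC hw) j) (norm_nonneg _) (normV_nonneg _))
  rw [tri, Fin.sum_univ_two]
  refine (abs_add_le _ _).trans ?_
  linarith [h 0, h 1]

theorem abs_tri_le_normV {C : ℝ} (hC : IsLadyzhenskayaConst C)
    {u v w : L2} (hu : u ∈ V) (hw : w ∈ V) :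
    |tri u v w| ≤ 2 * C * normV v * (normV u * normV w) := by
  refine (abs_tri_le hC hu hw).trans ?_
  have := mul_le_mul_of_nonneg_left (norm4_mul_le hC hu hw) (normV_nonneg v)
  linarith

/-- Equal outer arguments give `‖u‖ |u|` in place of `‖u‖²`, so that Young's inequality can leave a
multiple of `|u|²`. -/
theorem abs_tri_self_le {C : ℝ} (hC : IsLadyzhenskayaConst C) {u v : L2} (hu : u ∈ V) :
    |tri u v u| ≤ 2 * C * normV v * (normV u * ‖u‖) := by
  refine (abs_tri_le hC hu hu).trans ?_
  have := mul_le_mul_of_nonneg_left (norm4_sq_le hC hu) (normV_nonneg v)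
  linarith

theorem tri_add_left {C : ℝ} (hC : IsLadyzhenskayaConst C)
    {u u' w : L2} (hu : u ∈ V) (hu' : u' ∈ V) (v : L2) (hw : w ∈ V) :
    tri (u + u') v w = tri u v w + tri u' v w := by
  simp only [tri, mulField_add_left (V_mem_L4 hC hu) (V_mem_L4 hC hu') (V_mem_L4 hC hw),
    inner_add_right, Finset.sum_add_distrib]

theorem tri_add_right {C : ℝ} (hC : IsLadyzhenskayaConst C)
    {u w w' : L2} (hu : u ∈ V) (v : L2) (hw : w ∈ V) (hw' : w' ∈ V) :
    tri u v (w + w') = tri u v w + tri u v w' := by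
  simp only [tri, mulField_add_right (V_mem_L4 hC hu) (V_mem_L4 hC hw) (V_mem_L4 hC hw'),
    inner_add_right, Finset.sum_add_distrib]

theorem tri_add_mid (u : L2) {v v' : L2} (hv : v ∈ V) (hv' : v' ∈ V) (w : L2) :
    tri u (v + v') w = tri u v w + tri u v' w := by
  simp only [tri, wderiv_add hv hv', inner_add_left, Finset.sum_add_distrib]

theorem tri_smul_mid (u : L2) {v : L2} (c : ℝ) (hv : v ∈ V) (w : L2) :
    tri u (c • v) w = c * tri u v w := by
  simp only [tri, wderiv_smul c hv, real_inner_smul_left, Finset.mul_sum]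

theorem convect_eq {C : ℝ} (hC : IsLadyzhenskayaConst C)
    {u v : L2} (hu : u ∈ domA) (hv : v ∈ domA) :
    convect u v = ∑ j, mulField j u (wderiv j v) := by
  have hu4 := V_mem_L4 hC (domA_subset_V hu)
  have hv4 (j : Fin 2) := V_mem_L4 hC (wderiv_mem_V_of_domA hv j)
  have h : MemLp (fun x => ∑ j, (u x) j • (wderiv j v) x) 2 (volume : Measure Torus) :=
    memLp_finsetSum _ fun j _ => memLp_mulField hu4 (hv4 j) j
  rw [convect, dif_pos h, Fin.sum_univ_two]
  ext1
  filter_upwards [h.coeFn_toLp, mulField_coeFn hu4 (hv4 0) 0, mulField_coeFn hu4 (hv4 1) 1,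
    Lp.coeFn_add (mulField 0 u (wderiv 0 v)) (mulField 1 u (wderiv 1 v))] with x h1 h2 h3 h4
  rw [h1, h4, Pi.add_apply, h2, h3, Fin.sum_univ_two]

theorem inner_B {C : ℝ} (hC : IsLadyzhenskayaConst C)
    {u v w : L2} (hu : u ∈ domA) (hv : v ∈ domA) (hw : w ∈ V) :
    inner ℝ (B u v) w = tri u v w := by
  rw [B, inner_leray_left hw.1, convect_eq hC hu hv, sum_inner, tri]
  exact Finset.sum_congr rfl fun j _ => inner_mulField (V_mem_L4 hC (domA_subset_V hu))
    (V_mem_L4 hC (wderiv_mem_V_of_domA hv j)) (V_mem_L4 hC hw) j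

/-! ### Antisymmetry of the trilinear form -/

/-- The gradient field with the given partial derivatives. -/
def gradField (D : Fin 2 → C(Torus, ℝ)) : C(Torus, Plane) :=
  ⟨fun x => WithLp.toLp 2 fun j => D j x, by fun_prop⟩

/-- The field `s a` for a scalar function `s`. -/
def scalarField (s : C(Torus, ℝ)) (a : Plane) : C(Torus, Plane) :=
  ⟨fun x => s x • a, by fun_prop⟩

theorem IsC1.scalarField {s : C(Torus, ℝ)} {D : Fin 2 → C(Torus, ℝ)} (h : IsC1 s D) (a : Plane) :
    IsC1 (scalarField s a) fun j => NSE.scalarField (D j) a :=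
  fun j x => (h j x).smul_const a

theorem inner_scalarField_cosMode (s : C(Torus, ℝ)) (k : Wave) (i : Fin 2) :
    inner ℝ (ofField (scalarField s (unitVec i))) (cosMode k (unitVec i)) =
      ∫ x, (character k x).re * s x := by
  rw [cosMode_eq, inner_ofField]
  refine integral_congr_ae (Eventually.of_forall fun x => ?_)
  simp only [innerC, scalarField, cosField, ContinuousMap.coe_mk, real_inner_smul_left,
    real_inner_smul_right, inner_unitVec]
  simp [unitVec, mul_comm]

theorem inner_scalarField_sinMode (s : C(Torus, ℝ)) (k : Wave) (i : Fin 2) :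
    inner ℝ (ofField (scalarField s (unitVec i))) (sinMode k (unitVec i)) =
      ∫ x, (character k x).im * s x := by
  rw [sinMode_eq, inner_ofField]
  refine integral_congr_ae (Eventually.of_forall fun x => ?_)
  simp only [innerC, scalarField, sinField, ContinuousMap.coe_mk, real_inner_smul_left,
    real_inner_smul_right, inner_unitVec]
  simp [unitVec, mul_comm]

theorem inner_gradField_cosMode (D : Fin 2 → C(Torus, ℝ)) (k : Wave) (i : Fin 2) :
    inner ℝ (ofField (gradField D)) (cosMode k (unitVec i)) =
      ∫ x, (character k x).re * D i x := by
  rw [cosMode_eq, inner_ofField]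
  refine integral_congr_ae (Eventually.of_forall fun x => ?_)
  simp only [innerC, gradField, cosField, ContinuousMap.coe_mk, real_inner_smul_right,
    inner_unitVec]

theorem inner_gradField_sinMode (D : Fin 2 → C(Torus, ℝ)) (k : Wave) (i : Fin 2) :
    inner ℝ (ofField (gradField D)) (sinMode k (unitVec i)) =
      ∫ x, (character k x).im * D i x := by
  rw [sinMode_eq, inner_ofField]
  refine integral_congr_ae (Eventually.of_forall fun x => ?_)
  simp only [innerC, gradField, sinField, ContinuousMap.coe_mk, real_inner_smul_right,
    inner_unitVec]

/-- Membership in `H` tests only against trigonometric gradients. The coefficients of `∇s` at `k`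
are, up to sign, those of `s` times the vector `k`, so each term of the Parseval sum contains `k ·
û_k = 0`. -/
theorem inner_gradField_eq_zero {u : L2} (hu : u ∈ H) {s : C(Torus, ℝ)} {D : Fin 2 → C(Torus, ℝ)}
    (h : IsC1 s D) : inner ℝ u (ofField (gradField D)) = 0 := by
  have hp : modePair u (ofField (gradField D)) = fun _ => 0 := by
    ext k
    have hw (i : Fin 2) := (h.scalarField (unitVec i)).isWeakDeriv i k (unitVec i)
    simp only [inner_scalarField_cosMode, inner_scalarField_sinMode] at hw
    have hc := ((mem_H_iff.mp hu).2 k).1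
    have hs := ((mem_H_iff.mp hu).2 k).2
    rw [cosMode_eq_sum, inner_sum] at hc
    rw [sinMode_eq_sum, inner_sum] at hs
    simp only [real_inner_smul_right, waveVec, Fin.sum_univ_two] at hc hs
    simp only [modePair, inner_gradField_cosMode, inner_gradField_sinMode, (hw _).1, (hw _).2,
      Fin.sum_univ_two]
    linear_combination (∫ x, (character k x).im * s x) * hc - (∫ x, (character k x).re * s x) * hs
  have h2 := hasSum_modePair u (ofField (gradField D))
  rw [hp] at h2
  exact (mul_eq_zero.mp (h2.unique hasSum_zero)).resolve_left two_pi_sq_pos.ne'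

theorem ofField_mem_L4 (φ : C(Torus, Plane)) : ofField φ ∈ L4 :=
  (MemLp.of_bound (p := 4) φ.continuous.aestronglyMeasurable ‖φ‖
    (Eventually.of_forall φ.norm_coe_le_norm)).ae_eq (ofField_coeFn φ).symm

/-- The two integrands add up to `u · ∇(v · w)`, and `u` is orthogonal to gradients. -/
theorem tri_antisymm_of_smooth {u v w : L2} (hu : u ∈ H) (hu4 : u ∈ L4) (hv : v ∈ smoothFields)
    (hw : w ∈ smoothFields) : tri u v w + tri u w v = 0 := by
  obtain ⟨φ, D, h, rfl⟩ := hv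
  obtain ⟨ψ, D', h', rfl⟩ := hw
  rw [← inner_gradField_eq_zero hu (h.innerC h'), tri, tri, ← Finset.sum_add_distrib]
  simp only [(h.isWeakDeriv _).wderiv_eq, (h'.isWeakDeriv _).wderiv_eq]
  simp only [← inner_mulField hu4 (ofField_mem_L4 _) (ofField_mem_L4 _), L2.inner_def]
  rw [← Finset.sum_congr rfl fun j _ => integral_add (L2.integrable_inner _ _)
    (L2.integrable_inner _ _), ← integral_finsetSum _ fun j _ => (L2.integrable_inner _ _).add
    (L2.integrable_inner _ _)]
  refine integral_congr_ae ?_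
  filter_upwards [mulField_coeFn hu4 (ofField_mem_L4 (D 0)) 0,
    mulField_coeFn hu4 (ofField_mem_L4 (D 1)) 1, mulField_coeFn hu4 (ofField_mem_L4 (D' 0)) 0,
    mulField_coeFn hu4 (ofField_mem_L4 (D' 1)) 1, ofField_coeFn φ, ofField_coeFn ψ,
    ofField_coeFn (D 0), ofField_coeFn (D 1), ofField_coeFn (D' 0), ofField_coeFn (D' 1),
    ofField_coeFn (gradField fun j => innerC φ (D' j) + innerC (D j) ψ)]
    with x h1 h2 h3 h4 h5 h6 h7 h8 h9 h10 h11
  simp only [Fin.sum_univ_two, h1, h2, h3, h4, h5, h6, h7, h8, h9, h10, h11, real_inner_smul_left]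
  rw [PiLp.inner_apply (u x)]
  simp only [gradField, innerC, Fin.sum_univ_two, ContinuousMap.coe_mk, ContinuousMap.add_apply,
    RCLike.inner_apply, conj_trivial, real_inner_comm (D' _ x)]
  ring

/-- Density of truncations: `∂_j P_n v → ∂_j v` in `L²`, and `u_j P_n w → u_j w` in `L²` because
Ladyzhenskaya's inequality gives `P_n w → w` in `L⁴`. -/
theorem tri_antisymm {C : ℝ} (hC : IsLadyzhenskayaConst C) {u v w : L2} (hu : u ∈ V) (hv : v ∈ V)
    (hw : w ∈ V) : tri u v w = -tri u w v := by
  have hu4 := V_mem_L4 hC hu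
  have hmul {z : L2} (hz : z ∈ V) (j : Fin 2) :
      Tendsto (fun n : ℕ => mulField j u (projLow n z)) atTop (𝓝 (mulField j u z)) := by
    rw [tendsto_iff_norm_sub_tendsto_zero]
    have h4 : Tendsto (fun n : ℕ => norm4 (z - projLow n z) ^ 2) atTop (𝓝 0) := by
      refine squeeze_zero (fun _ => sq_nonneg _)
        (fun n => norm4_sq_le hC (V_sub hz (V_projLow hz n))) ?_
      have h1 := (tendsto_normV_sub_projLow hz).const_mul C
      have h2 := ((tendsto_const_nhds (x := z)).sub (tendsto_projLow z)).norm
      simpa using h1.mul h2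
    have h4' : Tendsto (fun n : ℕ => norm4 u * norm4 (z - projLow n z)) atTop (𝓝 0) := by
      have := h4.sqrt.const_mul (norm4 u)
      simpa [Real.sqrt_sq (norm4_nonneg _)] using this
    refine squeeze_zero (fun _ => norm_nonneg _) (fun n => ?_) h4'
    have hn4 := V_mem_L4 hC (V_projLow hz n)
    have hd := V_mem_L4 hC (V_sub hz (V_projLow hz n))
    have : mulField j u z = mulField j u (projLow n z) + mulField j u (z - projLow n z) := by
      rw [← mulField_add_right hu4 hn4 hd, add_sub_cancel]
    rw [this, norm_sub_rev, add_sub_cancel_left]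
    exact norm_mulField_le hu4 hd j
  have htri {y z : L2} (hy : y ∈ V) (hz : z ∈ V) :
      Tendsto (fun n : ℕ => tri u (projLow n y) (projLow n z)) atTop (𝓝 (tri u y z)) := by
    refine tendsto_finsetSum _ fun j _ => ?_
    simp only [wderiv_projLow hy]
    exact (tendsto_projLow _).inner (hmul hz j)
  have h0 (n : ℕ) : tri u (projLow n v) (projLow n w) + tri u (projLow n w) (projLow n v) = 0 :=
    tri_antisymm_of_smooth hu.1 hu4 (projLow_mem_smoothFields _ _) (projLow_mem_smoothFields _ _)
  have h1 := (htri hv hw).add (htri hw hv)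
  simp only [h0] at h1
  exact eq_neg_of_add_eq_zero_left (tendsto_nhds_unique h1 tendsto_const_nhds)

theorem tri_self {C : ℝ} (hC : IsLadyzhenskayaConst C) {u v : L2} (hu : u ∈ V) (hv : v ∈ V) :
    tri u v v = 0 := by
  have := tri_antisymm hC hu hv hv
  linarith

/-! ### The energy identity and Gronwall's inequality -/

section Energy

variable {E : Type*} [NormedAddCommGroup E] [InnerProductSpace ℝ E] [CompleteSpace E]

/-- Fubini on the triangle `x < r` of the square over `(s, t]`, together with the symmetry of the
inner product. -/
theorem integral_inner_primitive_swap {f : ℝ → E} {s t : ℝ}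
    (hf : IntegrableOn f (Set.Ioc s t)) :
    ∫ r in Set.Ioc s t, inner ℝ (f r) (∫ x in Set.Ioc s r, f x) =
      ∫ r in Set.Ioc s t, inner ℝ (f r) (∫ x in Set.Ioc r t, f x) := by
  set μ := (volume : Measure ℝ).restrict (Set.Ioc s t) with hμ
  set S : Set (ℝ × ℝ) := {p | p.2 < p.1} with hS
  have hSm : MeasurableSet S := measurableSet_lt measurable_snd measurable_fst
  have hF : Integrable (fun p : ℝ × ℝ => inner ℝ (f p.1) (f p.2)) (μ.prod μ) := by
    refine (hf.norm.mul_prod hf.norm).mono' (hf.1.comp_fst.inner hf.1.comp_snd) ?_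
    exact Eventually.of_forall fun p => norm_inner_le_norm _ _
  have hswap := integral_integral_swap (μ := μ) (ν := μ)
    (f := fun r r' => S.indicator (fun p : ℝ × ℝ => inner ℝ (f p.1) (f p.2)) (r, r'))
    (hF.indicator hSm)
  have hl (r : ℝ) (hr : r ∈ Set.Ioc s t) :
      ∫ r', S.indicator (fun p : ℝ × ℝ => inner ℝ (f p.1) (f p.2)) (r, r') ∂μ =
        inner ℝ (f r) (∫ x in Set.Ioc s r, f x) := by
    have h1 : (fun r' => S.indicator (fun p : ℝ × ℝ => inner ℝ (f p.1) (f p.2)) (r, r')) =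
        (Set.Iio r).indicator fun r' => inner ℝ (f r) (f r') := rfl
    rw [h1, integral_indicator measurableSet_Iio, hμ, Measure.restrict_restrict measurableSet_Iio]
    have h2 : Set.Iio r ∩ Set.Ioc s t = Set.Ioo s r := by
      ext x; simp only [Set.mem_inter_iff, Set.mem_Iio, Set.mem_Ioc, Set.mem_Ioo]
      exact ⟨fun h => ⟨h.2.1, h.1⟩, fun h => ⟨h.2, h.1, (h.2.trans_le hr.2).le⟩⟩
    rw [h2, ← integral_Ioc_eq_integral_Ioo, integral_inner]
    exact hf.mono_set (Set.Ioc_subset_Ioc_right hr.2)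
  have hr (r' : ℝ) (hr' : r' ∈ Set.Ioc s t) :
      ∫ r, S.indicator (fun p : ℝ × ℝ => inner ℝ (f p.1) (f p.2)) (r, r') ∂μ =
        inner ℝ (f r') (∫ x in Set.Ioc r' t, f x) := by
    have h1 : (fun r => S.indicator (fun p : ℝ × ℝ => inner ℝ (f p.1) (f p.2)) (r, r')) =
        (Set.Ioi r').indicator fun r => inner ℝ (f r') (f r) := by
      ext r
      simp only [Set.indicator, hS, Set.mem_ofPred_eq, Set.mem_Ioi, real_inner_comm (f r)]
    rw [h1, integral_indicator measurableSet_Ioi, hμ, Measure.restrict_restrict measurableSet_Ioi]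
    have h2 : Set.Ioi r' ∩ Set.Ioc s t = Set.Ioc r' t := by
      ext x; simp only [Set.mem_inter_iff, Set.mem_Ioi, Set.mem_Ioc]
      exact ⟨fun h => ⟨h.1, h.2.2⟩, fun h => ⟨h.1, hr'.1.trans h.1, h.2⟩⟩
    rw [h2, integral_inner]
    exact hf.mono_set (Set.Ioc_subset_Ioc_left hr'.1.le)
  rw [setIntegral_congr_fun measurableSet_Ioc hl, setIntegral_congr_fun measurableSet_Ioc hr]
    at hswap
  exact hswap

/-- By the swap, `∫ (f, z(r) - z(s)) = ∫ (f, z(t) - z(r))`. Hence `2 ∫ (f, z) = (z(t) + z(s), z(t) -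
z(s))`, without differentiating `z` at any time. -/
theorem energy_identity {z f : ℝ → E} {z₀ : E}
    (hf : ∀ T, 0 < T → IntegrableOn f (Set.Ioc 0 T))
    (hz : ∀ t, 0 ≤ t → z t = z₀ + ∫ r in (0 : ℝ)..t, f r) {s t : ℝ} (hs : 0 ≤ s) (hst : s ≤ t) :
    IntervalIntegrable (fun r => 2 * inner ℝ (z r) (f r)) volume s t ∧
      ‖z t‖ ^ 2 - ‖z s‖ ^ 2 = ∫ r in s..t, 2 * inner ℝ (z r) (f r) := by
  have hI (a b : ℝ) (ha : 0 ≤ a) (hab : a ≤ b) : IntegrableOn f (Set.Ioc a b) :=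
    (hf (b + 1) (by linarith)).mono_set (Set.Ioc_subset_Ioc ha (by linarith))
  have hII (a b : ℝ) (ha : 0 ≤ a) (hab : a ≤ b) : IntervalIntegrable f volume a b :=
    (intervalIntegrable_iff_integrableOn_Ioc_of_le hab).mpr (hI a b ha hab)
  have hdiff (a b : ℝ) (ha : 0 ≤ a) (hab : a ≤ b) : z b - z a = ∫ r in Set.Ioc a b, f r := by
    rw [hz a ha, hz b (ha.trans hab), add_sub_add_left_eq_sub,
      intervalIntegral.integral_interval_sub_left (hII 0 b le_rfl (ha.trans hab))
        (hII 0 a le_rfl ha), intervalIntegral.integral_of_le hab]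
  have hcont : ContinuousOn z (Set.Icc s t) := by
    have h1 : ContinuousOn (fun x => z s + ∫ r in s..x, f r) (Set.uIcc s t) :=
      continuousOn_const.add (intervalIntegral.continuousOn_primitive_interval
        (by rw [Set.uIcc_of_le hst]
            exact (integrableOn_Icc_iff_integrableOn_Ioc).mpr (hI s t hs hst)))
    rw [Set.uIcc_of_le hst] at h1
    refine h1.congr fun x hx => ?_
    simp only
    rw [intervalIntegral.integral_of_le hx.1, ← hdiff s x hs hx.1, add_sub_cancel]
  have hmul {y : ℝ → E} (hy : ContinuousOn y (Set.Icc s t)) :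
      IntegrableOn (fun r => inner ℝ (f r) (y r)) (Set.Ioc s t) := by
    obtain ⟨M, hM⟩ := isCompact_Icc.exists_bound_of_continuousOn hy
    refine ((hI s t hs hst).norm.mul_const M).mono'
      ((hI s t hs hst).1.inner ((hy.mono Set.Ioc_subset_Icc_self).aestronglyMeasurable
        measurableSet_Ioc)) ?_
    filter_upwards [ae_restrict_mem measurableSet_Ioc] with r hr
    exact (norm_inner_le_norm _ _).trans
      (mul_le_mul_of_nonneg_left (hM r (Set.Ioc_subset_Icc_self hr)) (norm_nonneg _))
  have hzf := hmul hcont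
  refine ⟨?_, ?_⟩
  · rw [intervalIntegrable_iff_integrableOn_Ioc_of_le hst]
    simp only [real_inner_comm (f _)]
    exact hzf.const_mul 2
  · have h1 := integral_inner_primitive_swap (hI s t hs hst)
    have h2 : ∫ r in Set.Ioc s t, inner ℝ (f r) (z r - z s) =
        ∫ r in Set.Ioc s t, inner ℝ (f r) (z t - z r) := by
      rw [setIntegral_congr_fun measurableSet_Ioc fun r hr => by
          rw [hdiff s r hs hr.1.le], h1]
      exact setIntegral_congr_fun measurableSet_Ioc fun r hr => by
          rw [hdiff r t (hs.trans hr.1.le) hr.2]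
    simp only [inner_sub_right] at h2
    rw [integral_sub hzf (hmul continuousOn_const), integral_sub (hmul continuousOn_const) hzf] at h2
    have hconst (c : E) : ∫ r in Set.Ioc s t, inner ℝ (f r) c = inner ℝ c (z t - z s) := by
      rw [hdiff s t hs hst, ← integral_inner (hI s t hs hst)]
      simp only [real_inner_comm]
    rw [hconst, hconst] at h2
    rw [intervalIntegral.integral_const_mul, intervalIntegral.integral_of_le hst]
    simp only [real_inner_comm (f _)]
    simp only [inner_sub_right, real_inner_self_eq_norm_sq, real_inner_comm (z t) (z s)] at h2
    linarith

end Energy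

/-! ### Gronwall arguments for inequalities in integrated form -/

/-- `Y` need not be differentiable. With `I` the primitive of `a` and `G` that of `exp I`, the
function `exp(I) Y - K G` has nonpositive upper right slopes, hence does not exceed its initial
value. -/
theorem gronwall_monotone {Y a : ℝ → ℝ} {K T : ℝ} (hY : Continuous Y) (ha : Continuous a)
    (H : ∀ s t, T ≤ s → s ≤ t → Y t - Y s ≤ ∫ r in s..t, (K - a r * Y r)) {t : ℝ} (ht : T ≤ t) :
    Real.exp (∫ r in T..t, a r) * Y t ≤ Y T + K * ∫ x in T..t, Real.exp (∫ r in T..x, a r) := by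
  set I : ℝ → ℝ := fun x => ∫ r in T..x, a r with hI
  have hId (x : ℝ) : HasDerivAt I (a x) x := (ha.integral_hasStrictDerivAt T x).hasDerivAt
  have hIc : Continuous I := continuous_iff_continuousAt.mpr fun x => (hId x).continuousAt
  have hee : Continuous fun x => Real.exp (I x) := Real.continuous_exp.comp hIc
  set G : ℝ → ℝ := fun x => ∫ r in T..x, Real.exp (I r) with hG
  have hGd (x : ℝ) : HasDerivAt G (Real.exp (I x)) x :=
    (hee.integral_hasStrictDerivAt T x).hasDerivAt
  have hGc : Continuous G := continuous_iff_continuousAt.mpr fun x => (hGd x).continuousAt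
  have hk : Continuous fun r => K - a r * Y r := by fun_prop
  set J : ℝ → ℝ := fun x => ∫ r in T..x, (K - a r * Y r) with hJ
  have hJd (x : ℝ) : HasDerivAt J (K - a x * Y x) x := (hk.integral_hasStrictDerivAt T x).hasDerivAt
  set F : ℝ → ℝ := fun x => Real.exp (I x) * Y x - K * G x with hF
  have hFc : Continuous F := (hee.mul hY).sub (hGc.const_mul K)
  have key := image_le_of_liminf_slope_right_le_deriv_boundary (f := F) (a := T) (b := t)
    (B := fun _ => F T) (B' := fun _ => 0) hFc.continuousOn le_rfl continuousOn_const
    (fun x _ => hasDerivWithinAt_const _ _ _) ?_ (Set.right_mem_Icc.mpr ht)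
  · have hT : F T = Y T := by simp [hF, hI, hG]
    simp only [hT] at key
    simp only [hF] at key
    linarith
  · intro x hx r hr
    refine Eventually.frequently ?_
    have hsl {φ : ℝ → ℝ} {φ' : ℝ} (h : HasDerivAt φ φ' x) :
        Tendsto (slope φ x) (𝓝[>] x) (𝓝 φ') :=
      (hasDerivAt_iff_tendsto_slope.mp h).mono_left (nhdsWithin_mono _ fun y hy => ne_of_gt hy)
    -- Replacing the increment of `Y` by that of `J` majorizes the slope of `F`; the majorant tends
    -- to `e^I (K - a Y) + Y a e^I - K e^I = 0`.
    have hlim : Tendsto (fun z => Real.exp (I z) * slope J x z +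
        Y x * slope (fun x => Real.exp (I x)) x z - K * slope G x z) (𝓝[>] x) (𝓝 0) := by
      have h1 := (((hee.tendsto x).mono_left nhdsWithin_le_nhds).mul (hsl (hJd x))).add
        ((hsl (hId x).exp).const_mul (Y x))
      have h2 := h1.sub ((hsl (hGd x)).const_mul K)
      convert h2 using 2
      ring
    filter_upwards [hlim.eventually (gt_mem_nhds hr), self_mem_nhdsWithin] with z hz hxz
    refine lt_of_le_of_lt ?_ hz
    have hxz' : 0 < z - x := sub_pos.mpr hxz
    have hJ' : Y z - Y x ≤ J z - J x := by
      refine (H x z hx.1 (le_of_lt hxz)).trans_eq ?_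
      rw [hJ]
      exact (intervalIntegral.integral_interval_sub_left (hk.intervalIntegrable _ _)
        (hk.intervalIntegrable _ _)).symm
    simp only [slope_def_field]
    have hsum : Real.exp (I z) * ((J z - J x) / (z - x)) +
        Y x * ((Real.exp (I z) - Real.exp (I x)) / (z - x)) - K * ((G z - G x) / (z - x)) =
        (Real.exp (I z) * (J z - J x) + Y x * (Real.exp (I z) - Real.exp (I x))
          - K * (G z - G x)) / (z - x) := by ring
    rw [hsum]
    refine div_le_div_of_nonneg_right ?_ hxz'.le
    have := mul_le_mul_of_nonneg_left hJ' (Real.exp_pos (I z)).le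
    simp only [hF]
    linarith

/-- Only integrals of `a` are bounded below, so `a` may be negative at times; the deficit `m` costs
a factor `exp m`, independent of the length of the time interval. -/
theorem gronwall_bound {Y a : ℝ → ℝ} {K T γ m : ℝ} (hY : ContinuousOn Y (Set.Ici T))
    (ha : ContinuousOn a (Set.Ici T)) (hY0 : ∀ t, T ≤ t → 0 ≤ Y t) (hK : 0 ≤ K) (hγ : 0 < γ)
    (H : ∀ s t, T ≤ s → s ≤ t → Y t - Y s ≤ ∫ r in s..t, (K - a r * Y r))
    (hA : ∀ s t, T ≤ s → s ≤ t → γ * (t - s) - m ≤ ∫ r in s..t, a r) {t : ℝ} (ht : T ≤ t) :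
    Y t ≤ Real.exp m * (Real.exp (-(γ * (t - T))) * Y T + K / γ) := by
  -- Freezing `Y` and `a` at their values at `T` for earlier times makes them continuous on the
  -- whole line.
  have hmax : Continuous fun x : ℝ => max T x := by fun_prop
  have hext {φ : ℝ → ℝ} (h : ContinuousOn φ (Set.Ici T)) : Continuous fun x => φ (max T x) :=
    h.comp_continuous hmax fun x => le_max_left T x
  have hcongr {φ : ℝ → ℝ} {s t : ℝ} (hs : T ≤ s) (hst : s ≤ t) :
      ∫ r in s..t, φ (max T r) = ∫ r in s..t, φ r := by
    refine intervalIntegral.integral_congr fun r hr => ?_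
    rw [Set.uIcc_of_le hst] at hr
    rw [max_eq_right (hs.trans hr.1)]
  have ha' := hext ha
  have h := gronwall_monotone (Y := fun x => Y (max T x)) (a := fun x => a (max T x)) (K := K)
    (T := T) (hext hY) ha' (fun s t hs hst => by
      have := H s t hs hst
      rw [← hcongr (φ := fun r => K - a r * Y r) hs hst] at this
      simpa only [max_eq_right hs, max_eq_right (hs.trans hst)] using this) ht
  simp only [max_eq_right ht, max_self] at h
  set I : ℝ → ℝ := fun x => ∫ r in T..x, a (max T r) with hI
  have hIc : Continuous I := continuous_iff_continuousAt.mpr fun x =>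
    (ha'.integral_hasStrictDerivAt T x).hasDerivAt.continuousAt
  have hIt (x : ℝ) (hTx : T ≤ x) (hxt : x ≤ t) : I x + (γ * (t - x) - m) ≤ I t := by
    have h1 := hA x t hTx hxt
    rw [← hcongr hTx hxt] at h1
    have h2 : I t - I x = ∫ r in x..t, a (max T r) :=
      intervalIntegral.integral_interval_sub_left (ha'.intervalIntegrable _ _)
        (ha'.intervalIntegrable _ _)
    linarith
  have hint : ∫ x in T..t, Real.exp (I x) ≤ Real.exp (I t) * (Real.exp m / γ) := by
    have hd (x : ℝ) : HasDerivAt (fun x => Real.exp (I t + m - γ * (t - x)) / γ)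
        (Real.exp (I t + m - γ * (t - x))) x := by
      have h1 : HasDerivAt (fun x : ℝ => I t + m - γ * (t - x)) γ x := by
        have := (((hasDerivAt_id x).const_sub t).const_mul γ).const_sub (I t + m)
        simpa using this
      have h2 := h1.exp.div_const γ
      rwa [mul_div_assoc, div_self hγ.ne', mul_one] at h2
    have hc : Continuous fun x => Real.exp (I t + m - γ * (t - x)) := by fun_prop
    calc ∫ x in T..t, Real.exp (I x) ≤ ∫ x in T..t, Real.exp (I t + m - γ * (t - x)) := by
          refine intervalIntegral.integral_mono_on ht
            ((Real.continuous_exp.comp hIc).intervalIntegrable _ _) (hc.intervalIntegrable _ _)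
            fun x hx => Real.exp_le_exp.mpr ?_
          linarith [hIt x hx.1 hx.2]
      _ = Real.exp (I t + m - γ * (t - t)) / γ - Real.exp (I t + m - γ * (t - T)) / γ :=
          intervalIntegral.integral_eq_sub_of_hasDerivAt (fun x _ => hd x)
            (hc.intervalIntegrable _ _)
      _ ≤ Real.exp (I t + m - γ * (t - t)) / γ := sub_le_self _ (by positivity)
      _ = _ := by rw [sub_self, mul_zero, sub_zero, Real.exp_add]; ring
  have hIT : I T = 0 := by simp [hI]
  have h3 : Y T ≤ Real.exp (I t) * (Real.exp m * (Real.exp (-(γ * (t - T))) * Y T)) := by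
    rw [← mul_assoc, ← mul_assoc, ← Real.exp_add, ← Real.exp_add]
    refine le_mul_of_one_le_left (hY0 T le_rfl) (Real.one_le_exp ?_)
    linarith [hIt T le_rfl ht]
  have h4 : Real.exp (I t) * Y t ≤ Real.exp (I t) *
      (Real.exp m * (Real.exp (-(γ * (t - T))) * Y T + K / γ)) := by
    calc Real.exp (I t) * Y t ≤ Y T + K * ∫ x in T..t, Real.exp (I x) := h
      _ ≤ Real.exp (I t) * (Real.exp m * (Real.exp (-(γ * (t - T))) * Y T)) +
          K * (Real.exp (I t) * (Real.exp m / γ)) := by gcongr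
      _ = _ := by ring
  exact le_of_mul_le_mul_left h4 (Real.exp_pos _)

/-- The rate `A - β f` is positive only on average. The bound `m` is the same for every starting
time, so restarting at a late `T`, where `ε` is small, costs a factor that does not depend on `T`.
-/
theorem tendsto_zero_of_differential_inequality {Y f : ℝ → ℝ} {A β κ m T₀ : ℝ}
    (hY : ContinuousOn Y (Set.Ici T₀)) (hf : ContinuousOn f (Set.Ici T₀))
    (hY0 : ∀ t, T₀ ≤ t → 0 ≤ Y t) (hβ : 0 < β) (hκ : 0 ≤ κ) (hA : β * κ < A)
    (hm : ∀ s t, T₀ ≤ s → s ≤ t → ∫ r in s..t, f r ≤ m + κ * (t - s))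
    (H : ∀ ε, 0 < ε → ∃ T, T₀ ≤ T ∧ ∀ s t, T ≤ s → s ≤ t →
      Y t - Y s ≤ ∫ r in s..t, (ε * (1 + f r) - (A - β * f r) * Y r)) :
    Tendsto Y atTop (𝓝 0) := by
  have hA0 : 0 < A := (mul_nonneg hβ.le hκ).trans_lt hA
  set γ := A - β * κ with hγ
  have hγ0 : 0 < γ := sub_pos.mpr hA
  set c := Real.exp (β * m) * (1 + (1 + A / β) / γ) with hc
  have hc0 : 0 < c := by positivity
  rw [Metric.tendsto_atTop]
  intro η hη
  obtain ⟨T, hT, hH⟩ := H (η / (2 * c)) (by positivity)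
  set ε := η / (2 * c) with hε
  have hε0 : 0 < ε := by positivity
  have hYT := hY.mono (Set.Ici_subset_Ici.mpr hT)
  have hfT := hf.mono (Set.Ici_subset_Ici.mpr hT)
  have hsub {s t : ℝ} (hs : T ≤ s) (hst : s ≤ t) : Set.uIcc s t ⊆ Set.Ici T := by
    rw [Set.uIcc_of_le hst]; exact fun x hx => hs.trans hx.1
  -- Shifting by `ε / β` absorbs the unbounded source `ε f`: `ε (1 + f) - (A - β f) Y = ε (1 + A /
  -- β) - (A - β f) (Y + ε / β)`.
  have hb (t : ℝ) (ht : T ≤ t) := gronwall_bound (Y := fun t => Y t + ε / β)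
    (a := fun t => A - β * f t) (K := ε * (1 + A / β)) (T := T) (γ := γ) (m := β * m)
    (hYT.add continuousOn_const) (continuousOn_const.sub (hfT.const_mul β))
    (fun t ht => add_nonneg (hY0 t (hT.trans ht)) (by positivity)) (by positivity) hγ0
    (fun s t hs hst => by
      rw [add_sub_add_right_eq_sub]
      refine (hH s t hs hst).trans_eq (intervalIntegral.integral_congr fun r _ => ?_)
      field_simp
      ring)
    (fun s t hs hst => by
      have hfi := (hfT.mono (hsub hs hst)).intervalIntegrable (μ := volume)
      rw [intervalIntegral.integral_sub intervalIntegrable_const (hfi.const_mul β),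
        intervalIntegral.integral_const_mul, intervalIntegral.integral_const, smul_eq_mul]
      have := mul_le_mul_of_nonneg_left (hm s t (hT.trans hs) hst) hβ.le
      linarith [hγ])
    ht
  have hdec : Tendsto (fun t => Real.exp (-(γ * (t - T))) * (Y T + ε / β)) atTop (𝓝 0) := by
    rw [← zero_mul (Y T + ε / β)]
    refine Tendsto.mul_const _ (Real.tendsto_exp_atBot.comp ?_)
    exact tendsto_neg_atTop_atBot.comp
      ((tendsto_atTop_add_const_right _ (-T) tendsto_id).const_mul_atTop hγ0)
  obtain ⟨T', hT'⟩ := eventually_atTop.mp (hdec.eventually (gt_mem_nhds hε0))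
  refine ⟨max T T', fun t ht => ?_⟩
  have ht1 := (le_max_left T T').trans ht
  have ht2 := (le_max_right T T').trans ht
  rw [Real.dist_eq, sub_zero, abs_of_nonneg (hY0 t (hT.trans ht1))]
  have h1 := hb t ht1
  have h2 := hT' t ht2
  have h3 : 0 < ε / β := by positivity
  calc Y t ≤ Real.exp (β * m) * (Real.exp (-(γ * (t - T))) * (Y T + ε / β) +
        ε * (1 + A / β) / γ) := by linarith
    _ ≤ Real.exp (β * m) * (ε + ε * (1 + A / β) / γ) := by gcongr
    _ = ε * c := by rw [hc]; ring
    _ = η / 2 := by rw [hε]; field_simp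
    _ < η := half_lt_self hη

/-! ### Energy balances of the mutual synchronization system at a fixed time -/

/-- The time derivative of the solution, for the force `f` and the state `v`. -/
def velocity (ν : ℝ) (f v : L2) : L2 := f - ν • stokes v - B v v

theorem projLow_projLow (N : ℝ) (u : L2) : projLow N (projLow N u) = projLow N u :=
  projLow_eq_self (Submodule.starProjection_apply_mem _ u)

section Balance

variable {ν N θ₁ θ₂ : ℝ} {h₁ h₂ u₁ u₂ : L2}

/-- The variance identity for weights `θ₂`, `θ₁`. It shows that the weighted dissipation dominates
`‖m‖²`. -/
theorem normV_sq_convex (hθ : θ₁ + θ₂ = 1) (hu₁ : u₁ ∈ V) (hu₂ : u₂ ∈ V) :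
    θ₂ * normV u₁ ^ 2 + θ₁ * normV u₂ ^ 2 =
      normV (θ₂ • u₁ + θ₁ • u₂) ^ 2 + θ₁ * θ₂ * normV (u₁ - u₂) ^ 2 := by
  simp only [normV_sq, Finset.mul_sum, ← Finset.sum_add_distrib]
  refine Finset.sum_congr rfl fun j _ => ?_
  rw [wderiv_add (V_smul _ hu₁) (V_smul _ hu₂), wderiv_smul _ hu₁, wderiv_smul _ hu₂,
    wderiv_sub hu₁ hu₂, norm_add_sq_real, norm_sub_sq_real, norm_smul, norm_smul,
    real_inner_smul_left, real_inner_smul_right, mul_pow, mul_pow, Real.norm_eq_abs,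
    Real.norm_eq_abs, sq_abs, sq_abs]
  obtain rfl : θ₂ = 1 - θ₁ := by linarith
  ring

theorem normV_le_convex (hθ₁ : 0 ≤ θ₁) (hθ₂ : 0 ≤ θ₂) (hθ : θ₁ + θ₂ = 1) (hu₁ : u₁ ∈ V)
    (hu₂ : u₂ ∈ V) :
    normV u₁ ≤ normV (θ₂ • u₁ + θ₁ • u₂) + normV (u₁ - u₂) ∧
      normV u₂ ≤ normV (θ₂ • u₁ + θ₁ • u₂) + normV (u₁ - u₂) := by
  have hw := V_sub hu₁ hu₂
  have hm := V_add (V_smul θ₂ hu₁) (V_smul θ₁ hu₂)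
  have key (c : ℝ) (hc : |c| ≤ 1) :
      normV (θ₂ • u₁ + θ₁ • u₂ + c • (u₁ - u₂)) ≤
        normV (θ₂ • u₁ + θ₁ • u₂) + normV (u₁ - u₂) := by
    refine (normV_add_le hm (V_smul c hw)).trans ?_
    rw [normV_smul _ hw]
    have := mul_le_mul_of_nonneg_right hc (normV_nonneg (u₁ - u₂))
    linarith
  obtain rfl : θ₂ = 1 - θ₁ := by linarith
  constructor
  · convert key θ₁ (by rw [abs_of_nonneg hθ₁]; linarith) using 2
    module
  · convert key (-(1 - θ₁)) (by rw [abs_neg, abs_of_nonneg hθ₂]; linarith) using 2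
    module

/-- Antisymmetry moves the derivative to `p`. With `p = P_N w` the term therefore carries a factor
that decays in time. -/
theorem inner_B_self_sub_B_self {C : ℝ} (hC : IsLadyzhenskayaConst C)
    (hu₁ : u₁ ∈ domA) (hu₂ : u₂ ∈ domA) {p : L2} (hp : p ∈ V) :
    inner ℝ (B u₁ u₁ - B u₂ u₂) p = tri u₂ p u₂ - tri u₁ p u₁ := by
  rw [inner_sub_left, inner_B hC hu₁ hu₁ hp, inner_B hC hu₂ hu₂ hp,
    tri_antisymm hC (domA_subset_V hu₁) (domA_subset_V hu₁) hp,
    tri_antisymm hC (domA_subset_V hu₂) (domA_subset_V hu₂) hp]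
  ring

theorem abs_inner_B_sub_le {C : ℝ} (hC : IsLadyzhenskayaConst C)
    (hu₁ : u₁ ∈ domA) (hu₂ : u₂ ∈ domA) {p : L2} (hp : p ∈ V) :
    |inner ℝ (B u₁ u₁ - B u₂ u₂) p| ≤ 2 * C * normV p * (normV u₁ ^ 2 + normV u₂ ^ 2) := by
  have hV₁ := domA_subset_V hu₁
  have hV₂ := domA_subset_V hu₂
  rw [inner_B_self_sub_B_self hC hu₁ hu₂ hp]
  have h1 := abs_tri_le_normV hC (v := p) hV₁ hV₁
  have h2 := abs_tri_le_normV hC (v := p) hV₂ hV₂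
  refine (abs_sub _ _).trans ?_
  rw [sq, sq]
  linarith

/-- The difference of the quadratic forms `b(·, p, ·)` telescopes into two terms, each with a factor
`u₁ - u₂`. -/
theorem abs_inner_B_sub_le_diff {C : ℝ} (hC : IsLadyzhenskayaConst C)
    (hu₁ : u₁ ∈ domA) (hu₂ : u₂ ∈ domA) {p : L2} (hp : p ∈ V) :
    |inner ℝ (B u₁ u₁ - B u₂ u₂) p| ≤
      2 * C * normV p * (normV (u₁ - u₂) * (normV u₁ + normV u₂)) := by
  have hV₁ := domA_subset_V hu₁
  have hV₂ := domA_subset_V hu₂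
  have hw := V_sub hV₁ hV₂
  rw [inner_B_self_sub_B_self hC hu₁ hu₂ hp]
  have e1 : tri u₁ p u₁ = tri u₂ p u₁ + tri (u₁ - u₂) p u₁ := by
    rw [← tri_add_left hC hV₂ hw p hV₁, add_sub_cancel]
  have e2 : tri u₂ p u₁ = tri u₂ p u₂ + tri u₂ p (u₁ - u₂) := by
    rw [← tri_add_right hC hV₂ p hV₂ hw, add_sub_cancel]
  have h1 := abs_tri_le_normV hC (v := p) hw hV₁
  have h2 := abs_tri_le_normV hC (v := p) hV₂ hw
  have e3 : tri u₂ p u₂ - tri u₁ p u₁ = -(tri u₂ p (u₁ - u₂) + tri (u₁ - u₂) p u₁) := by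
    rw [e1, e2]; ring
  rw [e3, abs_neg]
  refine (abs_add_le _ _).trans ?_
  linarith

/-- The usual reduction gives `b(w, u₂, w)`. Since `b(w, w, w) = 0`, any multiple of `w` may be
added in the middle, and `u₂ + θ₂ w = m` is the combination whose average dissipation is controlled
by `𝔤_λ`. -/
theorem inner_B_sub_diff {C : ℝ} (hC : IsLadyzhenskayaConst C)
    (hθ : θ₁ + θ₂ = 1) (hu₁ : u₁ ∈ domA) (hu₂ : u₂ ∈ domA) :
    inner ℝ (B u₁ u₁ - B u₂ u₂) (u₁ - u₂) =
      tri (u₁ - u₂) (θ₂ • u₁ + θ₁ • u₂) (u₁ - u₂) := by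
  have hV₁ := domA_subset_V hu₁
  have hV₂ := domA_subset_V hu₂
  have hw := V_sub hV₁ hV₂
  have hm : θ₂ • u₁ + θ₁ • u₂ = u₂ + θ₂ • (u₁ - u₂) := by
    obtain rfl : θ₁ = 1 - θ₂ := by linarith
    module
  rw [inner_sub_left, inner_B hC hu₁ hu₁ hw, inner_B hC hu₂ hu₂ hw, hm,
    tri_add_mid _ hV₂ (V_smul _ hw), tri_smul_mid _ _ hw, tri_self hC hw hw]
  have e1 : tri u₁ u₁ (u₁ - u₂) = tri u₁ u₂ (u₁ - u₂) + tri u₁ (u₁ - u₂) (u₁ - u₂) := by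
    rw [← tri_add_mid _ hV₂ hw, add_sub_cancel]
  have e2 : tri u₁ u₂ (u₁ - u₂) = tri u₂ u₂ (u₁ - u₂) + tri (u₁ - u₂) u₂ (u₁ - u₂) := by
    rw [← tri_add_left hC hV₂ hw _ hw, add_sub_cancel]
  rw [e1, e2, tri_self hC hV₁ hw]
  ring

theorem inner_velocity_self {C : ℝ} (hC : IsLadyzhenskayaConst C) (hu₁ : u₁ ∈ domA) :
    inner ℝ u₁ (velocity ν (h₁ + θ₁ • (projLow N (B u₁ u₁) - projLow N (B u₂ u₂))) u₁) =
      inner ℝ h₁ u₁ - ν * normV u₁ ^ 2 +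
        θ₁ * inner ℝ (B u₁ u₁ - B u₂ u₂) (projLow N u₁) := by
  have hV₁ := domA_subset_V hu₁
  rw [real_inner_comm, velocity, inner_sub_left, inner_sub_left, inner_add_left,
    real_inner_smul_left, real_inner_smul_left, inner_stokes_self hV₁ hu₁, inner_B hC hu₁ hu₁ hV₁,
    tri_self hC hV₁ hV₁, ← map_sub, inner_projLow_left]
  ring

/-- The weights are crossed, `θ₂` with `u₁` and `θ₁` with `u₂`, so that both coupling terms get the
common factor `θ₁ θ₂` and pair with `P_N` of the difference only. -/
theorem inner_velocity_pair {C : ℝ} (hC : IsLadyzhenskayaConst C)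
    (hu₁ : u₁ ∈ domA) (hu₂ : u₂ ∈ domA) (hθ : θ₁ + θ₂ = 1) :
    θ₂ * inner ℝ u₁ (velocity ν (h₁ + θ₁ • (projLow N (B u₁ u₁) - projLow N (B u₂ u₂))) u₁) +
      θ₁ * inner ℝ u₂ (velocity ν (h₂ + θ₂ • (projLow N (B u₂ u₂) - projLow N (B u₁ u₁))) u₂) =
      inner ℝ (θ₂ • h₁ + θ₁ • h₂) (θ₂ • u₁ + θ₁ • u₂) + θ₁ * θ₂ * inner ℝ (h₁ - h₂) (u₁ - u₂) -
        ν * (θ₂ * normV u₁ ^ 2 + θ₁ * normV u₂ ^ 2) +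
        θ₁ * θ₂ * inner ℝ (B u₁ u₁ - B u₂ u₂) (projLow N (u₁ - u₂)) := by
  rw [inner_velocity_self hC hu₁, inner_velocity_self hC hu₂, map_sub]
  simp only [inner_add_left, inner_add_right, inner_sub_left, inner_sub_right,
    real_inner_smul_left, real_inner_smul_right]
  obtain rfl : θ₂ = 1 - θ₁ := by linarith
  ring

theorem velocity_sub (hu₁ : u₁ ∈ domA) (hu₂ : u₂ ∈ domA) (hθ : θ₁ + θ₂ = 1) :
    velocity ν (h₁ + θ₁ • (projLow N (B u₁ u₁) - projLow N (B u₂ u₂))) u₁ -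
      velocity ν (h₂ + θ₂ • (projLow N (B u₂ u₂) - projLow N (B u₁ u₁))) u₂ =
      (h₁ - h₂) - ν • stokes (u₁ - u₂) - (B u₁ u₁ - B u₂ u₂) +
        projLow N (B u₁ u₁ - B u₂ u₂) := by
  rw [stokes_sub hu₁ hu₂, map_sub, velocity, velocity]
  obtain rfl : θ₂ = 1 - θ₁ := by linarith
  module

theorem inner_velocity_diff {C : ℝ} (hC : IsLadyzhenskayaConst C)
    (hu₁ : u₁ ∈ domA) (hu₂ : u₂ ∈ domA) (hθ : θ₁ + θ₂ = 1) :
    inner ℝ (u₁ - u₂)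
      (velocity ν (h₁ + θ₁ • (projLow N (B u₁ u₁) - projLow N (B u₂ u₂))) u₁ -
        velocity ν (h₂ + θ₂ • (projLow N (B u₂ u₂) - projLow N (B u₁ u₁))) u₂) =
      inner ℝ (h₁ - h₂) (u₁ - u₂) - ν * normV (u₁ - u₂) ^ 2 -
        tri (u₁ - u₂) (θ₂ • u₁ + θ₁ • u₂) (u₁ - u₂) +
        inner ℝ (B u₁ u₁ - B u₂ u₂) (projLow N (u₁ - u₂)) := by
  have hw := domA_sub hu₁ hu₂
  rw [velocity_sub hu₁ hu₂ hθ, real_inner_comm, inner_add_left, inner_sub_left _ (B u₁ u₁ - B u₂ u₂),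
    inner_sub_left (h₁ - h₂), real_inner_smul_left, inner_stokes_self (domA_subset_V hw) hw,
    inner_B_sub_diff hC hθ hu₁ hu₂, inner_projLow_left]

/-- By `velocity_sub` the nonlinear part of the difference is `-(1 - P_N) (B(u₁, u₁) - B(u₂, u₂))`,
which `P_N` annihilates. -/
theorem inner_velocity_low (hu₁ : u₁ ∈ domA) (hu₂ : u₂ ∈ domA) (hθ : θ₁ + θ₂ = 1) :
    inner ℝ (projLow N (u₁ - u₂)) (projLow N
      (velocity ν (h₁ + θ₁ • (projLow N (B u₁ u₁) - projLow N (B u₂ u₂))) u₁ -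
        velocity ν (h₂ + θ₂ • (projLow N (B u₂ u₂) - projLow N (B u₁ u₁))) u₂)) =
      inner ℝ (h₁ - h₂) (projLow N (u₁ - u₂)) - ν * normV (projLow N (u₁ - u₂)) ^ 2 := by
  have hw := domA_sub hu₁ hu₂
  rw [velocity_sub hu₁ hu₂ hθ, ← inner_projLow_left, projLow_projLow, real_inner_comm,
    inner_add_left, inner_sub_left _ (B u₁ u₁ - B u₂ u₂),
    inner_sub_left (h₁ - h₂), real_inner_smul_left, inner_stokes_projLow (domA_subset_V hw) hw,
    inner_projLow_left, projLow_projLow]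
  ring

end Balance

/-! ### Differential inequalities at a fixed time -/

section Inequalities

variable {ν N θ₁ θ₂ : ℝ} {h₁ h₂ u₁ u₂ : L2}

theorem low_inequality (hν : 0 < ν) (hu₁ : u₁ ∈ domA) (hu₂ : u₂ ∈ domA) (hθ : θ₁ + θ₂ = 1)
    {ε : ℝ} (hg : ‖h₁ - h₂‖ ^ 2 ≤ ν * ε) :
    2 * inner ℝ (projLow N (u₁ - u₂)) (projLow N
      (velocity ν (h₁ + θ₁ • (projLow N (B u₁ u₁) - projLow N (B u₂ u₂))) u₁ -
        velocity ν (h₂ + θ₂ • (projLow N (B u₂ u₂) - projLow N (B u₁ u₁))) u₂)) ≤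
      ε - ν * ‖projLow N (u₁ - u₂)‖ ^ 2 := by
  rw [inner_velocity_low hu₁ hu₂ hθ]
  set p := projLow N (u₁ - u₂) with hp
  have hpV : p ∈ V := V_projLow (V_sub (domA_subset_V hu₁) (domA_subset_V hu₂)) N
  have h1 := real_inner_le_norm (h₁ - h₂) p
  have h2 : ‖p‖ ^ 2 ≤ normV p ^ 2 := pow_le_pow_left₀ (norm_nonneg _) (norm_le_normV hpV) 2
  have h3 : 2 * (‖h₁ - h₂‖ * ‖p‖) ≤ ε + ν * ‖p‖ ^ 2 := by
    refine le_of_mul_le_mul_left ?_ hν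
    nlinarith [sq_nonneg (‖h₁ - h₂‖ - ν * ‖p‖)]
  nlinarith

/-- Of the dissipation `2 ν D`, the mean force takes at most `ν D`, since `‖m‖² ≤ D`, while the
force difference and the coupling take at most `δ D` each. -/
theorem energy_inequality {C : ℝ} (hC : IsLadyzhenskayaConst C)
    (hν : 0 < ν) (hθ₁ : 0 ≤ θ₁) (hθ₂ : 0 ≤ θ₂) (hθ : θ₁ + θ₂ = 1)
    (hu₁ : u₁ ∈ domA) (hu₂ : u₂ ∈ domA) {δ G : ℝ} (hg : ‖h₁ - h₂‖ ≤ δ)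
    (hG : ‖θ₂ • h₁ + θ₁ • h₂‖ ≤ G) (hp : 2 * C * normV (projLow N (u₁ - u₂)) ≤ δ / 2) :
    θ₂ * (2 * inner ℝ u₁
        (velocity ν (h₁ + θ₁ • (projLow N (B u₁ u₁) - projLow N (B u₂ u₂))) u₁)) +
      θ₁ * (2 * inner ℝ u₂
        (velocity ν (h₂ + θ₂ • (projLow N (B u₂ u₂) - projLow N (B u₁ u₁))) u₂)) ≤
      (G ^ 2 / ν + δ) - (ν - 2 * δ) * (θ₂ * normV u₁ ^ 2 + θ₁ * normV u₂ ^ 2) := by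
  have hV₁ := domA_subset_V hu₁
  have hV₂ := domA_subset_V hu₂
  have hw := V_sub hV₁ hV₂
  have hδ : 0 ≤ δ := (norm_nonneg _).trans hg
  have hG0 : 0 ≤ G := (norm_nonneg _).trans hG
  have hbal := inner_velocity_pair hC (ν := ν) (N := N) (h₁ := h₁) (h₂ := h₂) hu₁ hu₂ hθ
  have hD := normV_sq_convex hθ hV₁ hV₂
  set D := θ₂ * normV u₁ ^ 2 + θ₁ * normV u₂ ^ 2 with hDdef
  set m := θ₂ • u₁ + θ₁ • u₂ with hm
  set w := u₁ - u₂ with hwdef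
  have hmV : m ∈ V := V_add (V_smul _ hV₁) (V_smul _ hV₂)
  have hθθ : 0 ≤ θ₁ * θ₂ := mul_nonneg hθ₁ hθ₂
  have hθ1 : θ₁ ≤ 1 := by linarith
  have hθ2 : θ₂ ≤ 1 := by linarith
  have hθθ1 : θ₁ * θ₂ ≤ 1 := mul_le_one₀ hθ1 hθ₂ hθ2
  have i1 : 2 * inner ℝ (θ₂ • h₁ + θ₁ • h₂) m ≤ G ^ 2 / ν + ν * normV m ^ 2 := by
    have a1 := real_inner_le_norm (θ₂ • h₁ + θ₁ • h₂) m
    have a2 : ‖θ₂ • h₁ + θ₁ • h₂‖ * ‖m‖ ≤ G * normV m :=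
      mul_le_mul hG (norm_le_normV hmV) (norm_nonneg _) hG0
    have a3 : G ^ 2 / ν + ν * normV m ^ 2 - 2 * (G * normV m) = (G - ν * normV m) ^ 2 / ν := by
      field_simp; ring
    have a4 : 0 ≤ (G - ν * normV m) ^ 2 / ν := by positivity
    linarith
  have i2 : 2 * (θ₁ * θ₂ * inner ℝ (h₁ - h₂) w) ≤ δ + δ * (θ₁ * θ₂ * normV w ^ 2) := by
    have a1 := real_inner_le_norm (h₁ - h₂) w
    have a2 : ‖h₁ - h₂‖ * ‖w‖ ≤ δ * normV w :=
      mul_le_mul hg (norm_le_normV hw) (norm_nonneg _) hδ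
    have a3 : θ₁ * θ₂ * inner ℝ (h₁ - h₂) w ≤ θ₁ * θ₂ * (δ * normV w) :=
      mul_le_mul_of_nonneg_left (a1.trans a2) hθθ
    have a4 : 2 * normV w ≤ 1 + normV w ^ 2 := by nlinarith [sq_nonneg (normV w - 1)]
    have a5 := mul_le_mul_of_nonneg_left a4 (mul_nonneg hθθ hδ)
    have a6 := mul_le_mul_of_nonneg_right hθθ1 hδ
    linarith
  have i3 : 2 * (θ₁ * θ₂ * inner ℝ (B u₁ u₁ - B u₂ u₂) (projLow N w)) ≤ δ * D := by
    have a1 := (le_abs_self _).trans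
      (abs_inner_B_sub_le hC hu₁ hu₂ (V_projLow hw N))
    have a2 : 2 * C * normV (projLow N w) * (normV u₁ ^ 2 + normV u₂ ^ 2) ≤
        δ / 2 * (normV u₁ ^ 2 + normV u₂ ^ 2) := by gcongr
    have a3 := mul_le_mul_of_nonneg_left (a1.trans a2) hθθ
    have a4 : θ₁ * θ₂ * (normV u₁ ^ 2 + normV u₂ ^ 2) ≤ D := by
      have b1 := mul_le_mul_of_nonneg_right (mul_le_of_le_one_left hθ₂ hθ1) (sq_nonneg (normV u₁))
      have b2 := mul_le_mul_of_nonneg_right (mul_le_of_le_one_right hθ₁ hθ2) (sq_nonneg (normV u₂))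
      linarith
    have a5 := mul_le_mul_of_nonneg_left a4 hδ
    linarith
  have i4 : 0 ≤ θ₁ * θ₂ * normV w ^ 2 := mul_nonneg hθθ (sq_nonneg _)
  have i5 : ν * normV m ^ 2 ≤ ν * D := by gcongr; linarith
  have i6 : δ * (θ₁ * θ₂ * normV w ^ 2) ≤ δ * D := by
    gcongr; linarith [sq_nonneg (normV m)]
  linarith

/-- With `α = ν - δ`, the viscous `2 ν ‖w‖²` splits as `α + α + 2 δ`: one `α` pays for `b(w, m, w)`,
one gives decay through the high-mode Poincaré inequality, and `2 δ ≥ 7 ε` absorbs the errors `ε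
‖w‖²` (force) and `6 ε ‖w‖²` (coupling). -/
theorem diff_inequality {C : ℝ} (hC : IsLadyzhenskayaConst C)
    (hN : 0 ≤ N) (hθ₁ : 0 ≤ θ₁) (hθ₂ : 0 ≤ θ₂)
    (hθ : θ₁ + θ₂ = 1) (hu₁ : u₁ ∈ domA) (hu₂ : u₂ ∈ domA) {δ ε : ℝ} (hδ : δ < ν)
    (hεδ : 4 * ε ≤ δ) (hg : ‖h₁ - h₂‖ ≤ ε)
    (hp : 2 * C * normV (projLow N (u₁ - u₂)) ≤ ε)
    (hp' : (ν - δ) * max 1 N ^ 2 * ‖projLow N (u₁ - u₂)‖ ^ 2 ≤ ε) :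
    2 * inner ℝ (u₁ - u₂)
      (velocity ν (h₁ + θ₁ • (projLow N (B u₁ u₁) - projLow N (B u₂ u₂))) u₁ -
        velocity ν (h₂ + θ₂ • (projLow N (B u₂ u₂) - projLow N (B u₁ u₁))) u₂) ≤
      2 * ε * (1 + normV (θ₂ • u₁ + θ₁ • u₂) ^ 2) -
        ((ν - δ) * max 1 N ^ 2 - (2 * C) ^ 2 / (ν - δ) * normV (θ₂ • u₁ + θ₁ • u₂) ^ 2) *
          ‖u₁ - u₂‖ ^ 2 := by
  have hV₁ := domA_subset_V hu₁
  have hV₂ := domA_subset_V hu₂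
  have hw := V_sub hV₁ hV₂
  have hε : 0 ≤ ε := (norm_nonneg _).trans hg
  rw [inner_velocity_diff hC hu₁ hu₂ hθ]
  set m := θ₂ • u₁ + θ₁ • u₂ with hm
  obtain ⟨hn₁, hn₂⟩ := normV_le_convex hθ₁ hθ₂ hθ hV₁ hV₂
  rw [← hm] at hn₁ hn₂
  set w := u₁ - u₂ with hwdef
  set α := ν - δ with hα
  have hα0 : 0 < α := sub_pos.mpr hδ
  have i1 : 2 * inner ℝ (h₁ - h₂) w ≤ ε + ε * normV w ^ 2 := by
    have a1 := real_inner_le_norm (h₁ - h₂) w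
    have a2 : ‖h₁ - h₂‖ * ‖w‖ ≤ ε * normV w :=
      mul_le_mul hg (norm_le_normV hw) (norm_nonneg _) hε
    have a4 : 2 * normV w ≤ 1 + normV w ^ 2 := by nlinarith [sq_nonneg (normV w - 1)]
    have a5 := mul_le_mul_of_nonneg_left a4 hε
    linarith
  have i2 : -(2 * tri w m w) ≤
      α * normV w ^ 2 + (2 * C) ^ 2 / α * normV m ^ 2 * ‖w‖ ^ 2 := by
    have a1 := (neg_le_abs _).trans (abs_tri_self_le hC (v := m) hw)
    have a2 : α * normV w ^ 2 + (2 * C) ^ 2 / α * normV m ^ 2 * ‖w‖ ^ 2 -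
        2 * (2 * C * normV m * (normV w * ‖w‖)) =
        (α * normV w - 2 * C * normV m * ‖w‖) ^ 2 / α := by
      field_simp; ring
    have a3 : 0 ≤ (α * normV w - 2 * C * normV m * ‖w‖) ^ 2 / α := by positivity
    linarith
  have i3 : 2 * inner ℝ (B u₁ u₁ - B u₂ u₂) (projLow N w) ≤
      2 * ε * normV m ^ 2 + 6 * ε * normV w ^ 2 := by
    have a1 := (le_abs_self _).trans (abs_inner_B_sub_le_diff hC hu₁ hu₂ (V_projLow hw N))
    rw [← hwdef] at a1
    have hw0 := normV_nonneg w
    have a2 : 2 * C * normV (projLow N w) * (normV w * (normV u₁ + normV u₂)) ≤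
        ε * (normV w * ((normV m + normV w) + (normV m + normV w))) := by
      refine mul_le_mul hp (mul_le_mul_of_nonneg_left (add_le_add hn₁ hn₂) hw0)
        (mul_nonneg hw0 (add_nonneg (normV_nonneg _) (normV_nonneg _))) hε
    have a3 : normV w * ((normV m + normV w) + (normV m + normV w)) ≤
        normV m ^ 2 + 3 * normV w ^ 2 := by nlinarith [sq_nonneg (normV m - normV w)]
    have a4 := mul_le_mul_of_nonneg_left a3 hε
    linarith
  have i4 := mul_le_mul_of_nonneg_left (norm_sub_projLow_sq_le hw hN) hα0.le
  have i5 : 7 * ε * normV w ^ 2 ≤ 2 * δ * normV w ^ 2 :=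
    mul_le_mul_of_nonneg_right (by linarith) (sq_nonneg _)
  have i6 : ν = α + δ := by rw [hα]; ring
  rw [i6]
  linarith

end Inequalities

/-! ### Paths with values in `V` -/

/-- `z` is continuous on `[0, ∞)` with values in `V`. -/
def IsVPath (z : ℝ → L2) : Prop :=
  (∀ t, 0 ≤ t → z t ∈ V) ∧
    ∀ s, 0 ≤ s → Tendsto (fun t => normV (z t - z s)) (𝓝[Set.Ici 0] s) (𝓝 0)

theorem IsStrongPath.isVPath {v : ℝ → L2} (h : IsStrongPath v) : IsVPath v :=
  ⟨h.mem_V, h.continuous_V⟩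

namespace IsVPath

variable {z z' : ℝ → L2}

theorem smul (h : IsVPath z) (c : ℝ) : IsVPath fun t => c • z t := by
  refine ⟨fun t ht => V_smul c (h.1 t ht), fun s hs => ?_⟩
  have h1 := (h.2 s hs).const_mul |c|
  rw [mul_zero] at h1
  refine h1.congr' ?_
  filter_upwards [self_mem_nhdsWithin] with t ht
  rw [← smul_sub, normV_smul c (V_sub (h.1 t ht) (h.1 s hs))]

theorem add (h : IsVPath z) (h' : IsVPath z') : IsVPath fun t => z t + z' t := by
  refine ⟨fun t ht => V_add (h.1 t ht) (h'.1 t ht), fun s hs => ?_⟩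
  have h1 := (h.2 s hs).add (h'.2 s hs)
  rw [add_zero] at h1
  refine squeeze_zero' (Eventually.of_forall fun _ => normV_nonneg _) ?_ h1
  filter_upwards [self_mem_nhdsWithin] with t ht
  rw [add_sub_add_comm]
  exact normV_add_le (V_sub (h.1 t ht) (h.1 s hs)) (V_sub (h'.1 t ht) (h'.1 s hs))

theorem sub (h : IsVPath z) (h' : IsVPath z') : IsVPath fun t => z t - z' t := by
  have := h.add (h'.smul (-1))
  simpa only [neg_smul, one_smul, ← sub_eq_add_neg] using this

theorem continuousOn_normV (h : IsVPath z) : ContinuousOn (fun t => normV (z t)) (Set.Ici 0) := by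
  intro s hs
  rw [ContinuousWithinAt, tendsto_iff_dist_tendsto_zero]
  refine squeeze_zero' (Eventually.of_forall fun _ => dist_nonneg) ?_ (h.2 s hs)
  filter_upwards [self_mem_nhdsWithin] with t ht
  exact abs_normV_sub_le (h.1 t ht) (h.1 s hs)

theorem continuousOn (h : IsVPath z) : ContinuousOn z (Set.Ici 0) := by
  intro s hs
  rw [ContinuousWithinAt, tendsto_iff_norm_sub_tendsto_zero]
  refine squeeze_zero' (Eventually.of_forall fun _ => norm_nonneg _) ?_ (h.2 s hs)
  filter_upwards [self_mem_nhdsWithin] with t ht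
  exact norm_le_normV (V_sub (h.1 t ht) (h.1 s hs))

end IsVPath

/-! ### Integration in time -/

/-- `z` is an absolutely continuous path with derivative `f`. -/
def IsPrimitive (z f : ℝ → L2) : Prop :=
  (∀ T, 0 < T → IntegrableOn f (Set.Ioc 0 T)) ∧
    ∀ t, 0 ≤ t → z t = z 0 + ∫ r in (0 : ℝ)..t, f r

theorem IsStrongSolution.isPrimitive {ν : ℝ} {f v : ℝ → L2} {v₀ : L2}
    (h : IsStrongSolution ν f v₀ v) : IsPrimitive v fun t => velocity ν (f t) (v t) := by
  have h0 : v 0 = v₀ := by simpa using h.eqn 0 le_rfl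
  refine ⟨fun T hT => (h.memLp_rhs T hT).integrable (by norm_num), fun t ht => ?_⟩
  rw [h0]
  exact h.eqn t ht

namespace IsPrimitive

variable {z z' f f' : ℝ → L2}

theorem intervalIntegrable (h : IsPrimitive z f) {t : ℝ} (ht : 0 ≤ t) :
    IntervalIntegrable f volume 0 t :=
  (intervalIntegrable_iff_integrableOn_Ioc_of_le ht).mpr
    ((h.1 (t + 1) (by linarith)).mono_set (Set.Ioc_subset_Ioc_right (by linarith)))

theorem sub (h : IsPrimitive z f) (h' : IsPrimitive z' f') :
    IsPrimitive (fun t => z t - z' t) fun t => f t - f' t := by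
  refine ⟨fun T hT => (h.1 T hT).sub (h'.1 T hT), fun t ht => ?_⟩
  beta_reduce
  rw [intervalIntegral.integral_sub (h.intervalIntegrable ht) (h'.intervalIntegrable ht),
    h.2 t ht, h'.2 t ht]
  abel

theorem clm (h : IsPrimitive z f) (L : L2 →L[ℝ] L2) :
    IsPrimitive (fun t => L (z t)) fun t => L (f t) := by
  refine ⟨fun T hT => L.integrable_comp (h.1 T hT), fun t ht => ?_⟩
  beta_reduce
  rw [L.intervalIntegral_comp_comm (h.intervalIntegrable ht), h.2 t ht, map_add]

theorem energy (h : IsPrimitive z f) {s t : ℝ} (hs : 0 ≤ s) (hst : s ≤ t) :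
    IntervalIntegrable (fun r => 2 * inner ℝ (z r) (f r)) volume s t ∧
      ‖z t‖ ^ 2 - ‖z s‖ ^ 2 = ∫ r in s..t, 2 * inner ℝ (z r) (f r) :=
  energy_identity h.1 h.2 hs hst

end IsPrimitive

theorem integral_le_of_ae_le {φ k : ℝ → ℝ} {T s t : ℝ} (hT : 0 ≤ T) (hs : T ≤ s) (hst : s ≤ t)
    (hφ : IntervalIntegrable φ volume s t) (hk : ContinuousOn k (Set.Ici 0))
    (h : ∀ᵐ r ∂(volume.restrict (Set.Ioi (0 : ℝ))), T ≤ r → φ r ≤ k r) :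
    ∫ r in s..t, φ r ≤ ∫ r in s..t, k r := by
  have hk' : IntervalIntegrable k volume s t :=
    (hk.mono (by
      rw [Set.uIcc_of_le hst]
      exact fun x hx => hT.trans (hs.trans hx.1))).intervalIntegrable
  rw [intervalIntegral.integral_of_le hst, intervalIntegral.integral_of_le hst]
  refine integral_mono_ae hφ.1 hk'.1 ?_
  have hsub : Set.Ioc s t ⊆ Set.Ioi 0 := fun x hx => (hT.trans hs).trans_lt hx.1
  filter_upwards [ae_restrict_of_ae_restrict_of_subset hsub h, ae_restrict_mem measurableSet_Ioc]
    with r hr hmem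
  exact hr (hs.trans hmem.1.le)

/-! ### Synchronization -/

/-- At `δ = 0` the claim is `(c G)² < (ν² M)²`; strictness persists for small `δ` by continuity. -/
theorem exists_small_parameter {ν c G M : ℝ} (hν : 0 < ν) (h : c * G < ν ^ 2 * M) (hc : 0 ≤ c)
    (hG : 0 ≤ G) :
    ∃ δ, 0 < δ ∧ 4 * δ < ν ∧
      c ^ 2 / (ν - δ) * ((G ^ 2 / ν + δ) / (ν - 2 * δ)) < (ν - δ) * M ^ 2 := by
  have hlim : Tendsto (fun δ : ℝ => (ν - δ) * M ^ 2 -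
      c ^ 2 / (ν - δ) * ((G ^ 2 / ν + δ) / (ν - 2 * δ))) (𝓝[>] 0)
      (𝓝 ((ν - 0) * M ^ 2 - c ^ 2 / (ν - 0) * ((G ^ 2 / ν + 0) / (ν - 2 * 0)))) := by
    have hcont : ContinuousAt (fun δ : ℝ => (ν - δ) * M ^ 2 -
        c ^ 2 / (ν - δ) * ((G ^ 2 / ν + δ) / (ν - 2 * δ))) 0 := by
      have h1 : ν - 0 ≠ 0 := by simpa using hν.ne'
      have h2 : ν - 2 * 0 ≠ 0 := by simpa using hν.ne'
      fun_prop (disch := assumption)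
    exact hcont.tendsto.mono_left nhdsWithin_le_nhds
  have hpos : 0 < (ν - 0) * M ^ 2 - c ^ 2 / (ν - 0) * ((G ^ 2 / ν + 0) / (ν - 2 * 0)) := by
    have h1 : (c * G) ^ 2 < (ν ^ 2 * M) ^ 2 := pow_lt_pow_left₀ h (mul_nonneg hc hG) two_ne_zero
    have h2 : (ν - 0) * M ^ 2 - c ^ 2 / (ν - 0) * ((G ^ 2 / ν + 0) / (ν - 2 * 0)) =
        ((ν ^ 2 * M) ^ 2 - (c * G) ^ 2) / ν ^ 3 := by
      simp only [sub_zero, mul_zero, add_zero]; field_simp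
    rw [h2]
    exact div_pos (sub_pos.mpr h1) (by positivity)
  have h4 : ∀ᶠ δ : ℝ in 𝓝[>] 0, δ < ν / 4 :=
    nhdsWithin_le_nhds (gt_mem_nhds (by positivity))
  obtain ⟨δ, h1, h2, h3⟩ :=
    ((hlim.eventually (lt_mem_nhds hpos)).and (h4.and self_mem_nhdsWithin)).exists
  exact ⟨δ, h3, by linarith, by linarith⟩

section Dynamics

variable {ν N θ₁ θ₂ : ℝ} {g₁ g₂ v₁ v₂ : ℝ → L2} {a₁ a₂ : L2}

theorem ae_mem_domA (hsol : IsMutualSyncSolution ν N θ₁ θ₂ g₁ g₂ a₁ a₂ v₁ v₂) :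
    ∀ᵐ t ∂(volume.restrict (Set.Ioi (0 : ℝ))), v₁ t ∈ domA ∧ v₂ t ∈ domA :=
  hsol.1.path.mem_domA.and hsol.2.path.mem_domA

theorem tendsto_low (hν : 0 < ν) (hθ : θ₁ + θ₂ = 1)
    (hg : Tendsto (fun t => ‖g₁ t - g₂ t‖) atTop (𝓝 0))
    (hsol : IsMutualSyncSolution ν N θ₁ θ₂ g₁ g₂ a₁ a₂ v₁ v₂) :
    Tendsto (fun t => ‖projLow N (v₁ t - v₂ t)‖ ^ 2) atTop (𝓝 0) := by
  have hprim := (hsol.1.isPrimitive.sub hsol.2.isPrimitive).clm (projLow N)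
  have hw := hsol.1.path.isVPath.sub hsol.2.path.isVPath
  have hcont : ContinuousOn (fun t => ‖projLow N (v₁ t - v₂ t)‖ ^ 2) (Set.Ici 0) :=
    ((projLow N).continuous.comp_continuousOn hw.continuousOn).norm.pow 2
  -- The decay rate is the constant `ν`, so the fluctuating part vanishes and `β = 1` is a dummy.
  refine tendsto_zero_of_differential_inequality (f := fun _ => 0) (A := ν) (β := 1) (κ := 0)
    (m := 0) (T₀ := 0) hcont continuousOn_const (fun _ _ => sq_nonneg _) one_pos le_rfl
    (by simpa using hν) (fun s t _ _ => by simp) fun ε hε => ?_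
  have hg2 : Tendsto (fun t => ‖g₁ t - g₂ t‖ ^ 2) atTop (𝓝 0) := by
    simpa using hg.pow 2
  obtain ⟨T, hT⟩ := eventually_atTop.mp (hg2.eventually (gt_mem_nhds (mul_pos hν hε)))
  refine ⟨max T 0, le_max_right _ _, fun s t hs hst => ?_⟩
  have he := hprim.energy ((le_max_right T 0).trans hs) hst
  rw [he.2]
  refine integral_le_of_ae_le (le_max_right T 0) hs hst he.1 ?_ ?_
  · simp only [add_zero, mul_zero, sub_zero]
    fun_prop
  · filter_upwards [ae_mem_domA hsol] with r hr hTr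
    simp only [add_zero, mul_zero, sub_zero, mul_one]
    exact low_inequality hν hr.1 hr.2 hθ (hT r ((le_max_left T 0).trans hTr)).le

/-- Integrating the energy inequality over `[s, t]` bounds the dissipation by the energy at `s` plus
a linear term. The slope is close to `G² / ν²` for small `δ`. -/
theorem energy_window {C : ℝ} (hC : IsLadyzhenskayaConst C) (hν : 0 < ν) (hθ₁ : 0 ≤ θ₁)
    (hθ₂ : 0 ≤ θ₂) (hθ : θ₁ + θ₂ = 1)
    (hsol : IsMutualSyncSolution ν N θ₁ θ₂ g₁ g₂ a₁ a₂ v₁ v₂) {δ G T : ℝ} (hT : 0 ≤ T)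
    (hδ : 0 < δ) (hδν : 4 * δ < ν)
    (hG : ∀ᵐ t ∂(volume.restrict (Set.Ioi (0 : ℝ))), ‖θ₂ • g₁ t + θ₁ • g₂ t‖ ≤ G)
    (hg : ∀ t, T ≤ t → ‖g₁ t - g₂ t‖ ≤ δ)
    (hp : ∀ t, T ≤ t → 2 * C * normV (projLow N (v₁ t - v₂ t)) ≤ δ / 2) :
    ∃ m, ∀ s t, T ≤ s → s ≤ t → ∫ r in s..t, normV (θ₂ • v₁ r + θ₁ • v₂ r) ^ 2 ≤
      m + (G ^ 2 / ν + δ) / (ν - 2 * δ) * (t - s) := by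
  have hp₁ := hsol.1.path.isVPath
  have hp₂ := hsol.2.path.isVPath
  set γ := ν - 2 * δ with hγ
  have hγ0 : 0 < γ := by rw [hγ]; linarith
  set K := G ^ 2 / ν + δ with hK
  have hK0 : 0 ≤ K := by positivity
  set E : ℝ → ℝ := fun t => θ₂ * ‖v₁ t‖ ^ 2 + θ₁ * ‖v₂ t‖ ^ 2 with hE
  set D : ℝ → ℝ := fun t => θ₂ * normV (v₁ t) ^ 2 + θ₁ * normV (v₂ t) ^ 2 with hD
  have hEc : ContinuousOn E (Set.Ici 0) :=
    ((hp₁.continuousOn.norm.pow 2).const_mul θ₂).add ((hp₂.continuousOn.norm.pow 2).const_mul θ₁)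
  have hDc : ContinuousOn D (Set.Ici 0) :=
    ((hp₁.continuousOn_normV.pow 2).const_mul θ₂).add ((hp₂.continuousOn_normV.pow 2).const_mul θ₁)
  have hmc : ContinuousOn (fun r => normV (θ₂ • v₁ r + θ₁ • v₂ r) ^ 2) (Set.Ici 0) :=
    ((hp₁.smul θ₂).add (hp₂.smul θ₁)).continuousOn_normV.pow 2
  have hE0 (t : ℝ) : 0 ≤ E t := by positivity
  have hED (t : ℝ) (ht : 0 ≤ t) : E t ≤ D t := by
    have h1 := norm_le_normV (hp₁.1 t ht)
    have h2 := norm_le_normV (hp₂.1 t ht)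
    simp only [hE, hD]
    gcongr
  have hsub {s t : ℝ} (hs : T ≤ s) (hst : s ≤ t) : Set.uIcc s t ⊆ Set.Ici 0 := by
    rw [Set.uIcc_of_le hst]; exact fun x hx => hT.trans (hs.trans hx.1)
  have hEint {s t : ℝ} (hs : T ≤ s) (hst : s ≤ t) : E t - E s ≤ ∫ r in s..t, (K - γ * D r) := by
    have e1 := hsol.1.isPrimitive.energy (hT.trans hs) hst
    have e2 := hsol.2.isPrimitive.energy (hT.trans hs) hst
    have e3 : E t - E s = θ₂ * (‖v₁ t‖ ^ 2 - ‖v₁ s‖ ^ 2) + θ₁ * (‖v₂ t‖ ^ 2 - ‖v₂ s‖ ^ 2) := by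
      simp only [hE]; ring
    rw [e3, e1.2, e2.2, ← intervalIntegral.integral_const_mul,
      ← intervalIntegral.integral_const_mul, ← intervalIntegral.integral_add
        (e1.1.const_mul _) (e2.1.const_mul _)]
    refine integral_le_of_ae_le hT hs hst ((e1.1.const_mul _).add (e2.1.const_mul _))
      (continuousOn_const.sub (hDc.const_mul γ)) ?_
    filter_upwards [ae_mem_domA hsol, hG] with r hr hGr hTr
    exact energy_inequality hC hν hθ₁ hθ₂ hθ hr.1 hr.2 (hg r hTr) hGr (hp r hTr)
  -- Poincaré's inequality `E ≤ D` closes the estimate for `E` and bounds it on all of `[T, ∞)`;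
  -- this is why `m` does not depend on `s`.
  have hEb {t : ℝ} (ht : T ≤ t) : E t ≤ E T + K / γ := by
    have h := gronwall_bound (Y := E) (a := fun _ => γ) (K := K) (T := T) (γ := γ) (m := 0)
      (hEc.mono (Set.Ici_subset_Ici.mpr hT)) continuousOn_const (fun t _ => hE0 t) hK0 hγ0
      (fun s t hs hst => (hEint hs hst).trans (intervalIntegral.integral_mono_on hst
        ((continuousOn_const.sub (hDc.const_mul γ)).mono (hsub hs hst)).intervalIntegrable
        ((continuousOn_const.sub (hEc.const_mul γ)).mono (hsub hs hst)).intervalIntegrable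
        fun r hr => sub_le_sub_left (mul_le_mul_of_nonneg_left
          (hED r (hT.trans (hs.trans hr.1))) hγ0.le) K))
      (fun s t _ _ => by rw [intervalIntegral.integral_const, smul_eq_mul]; linarith) ht
    rw [Real.exp_zero, one_mul] at h
    have h1 : Real.exp (-(γ * (t - T))) ≤ 1 := by
      rw [Real.exp_le_one_iff]
      nlinarith
    have h2 := mul_le_mul_of_nonneg_right h1 (hE0 T)
    linarith
  refine ⟨(E T + K / γ) / γ, fun s t hs hst => ?_⟩
  have h1 := hEint hs hst
  have hDi : IntervalIntegrable D volume s t := (hDc.mono (hsub hs hst)).intervalIntegrable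
  rw [intervalIntegral.integral_sub intervalIntegrable_const (hDi.const_mul γ),
    intervalIntegral.integral_const_mul, intervalIntegral.integral_const, smul_eq_mul] at h1
  have h2 : ∫ r in s..t, normV (θ₂ • v₁ r + θ₁ • v₂ r) ^ 2 ≤ ∫ r in s..t, D r := by
    refine intervalIntegral.integral_mono_on hst (hmc.mono (hsub hs hst)).intervalIntegrable hDi
      fun r hr => ?_
    have hr0 := hT.trans (hs.trans hr.1)
    have := normV_sq_convex hθ (hp₁.1 r hr0) (hp₂.1 r hr0)
    have h3 : 0 ≤ θ₁ * θ₂ * normV (v₁ r - v₂ r) ^ 2 := by positivity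
    simp only [hD]
    linarith
  have h3 : γ * ∫ r in s..t, D r ≤ (E T + K / γ) + K * (t - s) := by
    linarith [hEb hs, hE0 t]
  have h4 : ∫ r in s..t, D r ≤ ((E T + K / γ) + K * (t - s)) / γ := by
    rw [le_div_iff₀ hγ0]; linarith
  calc _ ≤ _ := h2.trans h4
    _ = _ := by ring

theorem synchronizes {C : ℝ} (hC : IsLadyzhenskayaConst C) (hν : 0 < ν) (hN : 0 ≤ N) (hθ₁ : 0 ≤ θ₁)
    (hθ₂ : 0 ≤ θ₂) (hθ : θ₁ + θ₂ = 1) {G : ℝ} (hG0 : 0 ≤ G)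
    (hG : ∀ᵐ t ∂(volume.restrict (Set.Ioi (0 : ℝ))), ‖θ₂ • g₁ t + θ₁ • g₂ t‖ ≤ G)
    (hCG : 2 * C * G < ν ^ 2 * max 1 N)
    (hg : Tendsto (fun t => ‖g₁ t - g₂ t‖) atTop (𝓝 0))
    (hsol : IsMutualSyncSolution ν N θ₁ θ₂ g₁ g₂ a₁ a₂ v₁ v₂) :
    Tendsto (fun t => ‖v₁ t - v₂ t‖) atTop (𝓝 0) := by
  have hC0 := hC.1
  have hp₁ := hsol.1.path.isVPath
  have hp₂ := hsol.2.path.isVPath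
  have hw := hp₁.sub hp₂
  have hlow := tendsto_low hν hθ hg hsol
  have hlow1 : Tendsto (fun t => ‖projLow N (v₁ t - v₂ t)‖) atTop (𝓝 0) := by
    simpa using hlow.sqrt
  have hlowV : Tendsto (fun t => 2 * C * normV (projLow N (v₁ t - v₂ t))) atTop (𝓝 0) := by
    have h1 : Tendsto (fun t => 2 * C * (N * ‖projLow N (v₁ t - v₂ t)‖)) atTop (𝓝 0) := by
      simpa using (hlow1.const_mul N).const_mul (2 * C)
    refine squeeze_zero' (Eventually.of_forall fun t => ?_) ?_ h1
    · have := normV_nonneg (projLow N (v₁ t - v₂ t)); positivity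
    · filter_upwards [eventually_ge_atTop 0] with t ht
      exact mul_le_mul_of_nonneg_left (normV_projLow_le (hw.1 t ht) hN) (by positivity)
  obtain ⟨δ, hδ, hδν, hsmall⟩ := exists_small_parameter hν hCG (by positivity) hG0
  obtain ⟨T₀, hT₀⟩ := eventually_atTop.mp
    ((eventually_ge_atTop 0).and ((hg.eventually (gt_mem_nhds hδ)).and
      (hlowV.eventually (gt_mem_nhds (half_pos hδ)))))
  have hT₀0 : 0 ≤ T₀ := (hT₀ T₀ le_rfl).1
  obtain ⟨m, hm⟩ := energy_window hC hν hθ₁ hθ₂ hθ hsol hT₀0 hδ hδν hG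
    (fun t ht => (hT₀ t ht).2.1.le) fun t ht => (hT₀ t ht).2.2.le
  set α := ν - δ with hα
  have hα0 : 0 < α := by rw [hα]; linarith
  have hwc := hw.continuousOn.norm.pow 2
  have hmc : ContinuousOn (fun r => normV (θ₂ • v₁ r + θ₁ • v₂ r) ^ 2) (Set.Ici 0) :=
    ((hp₁.smul θ₂).add (hp₂.smul θ₁)).continuousOn_normV.pow 2
  have hprim := hsol.1.isPrimitive.sub hsol.2.isPrimitive
  have hmain : Tendsto (fun t => ‖v₁ t - v₂ t‖ ^ 2) atTop (𝓝 0) := by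
    refine tendsto_zero_of_differential_inequality
      (f := fun r => normV (θ₂ • v₁ r + θ₁ • v₂ r) ^ 2)
      (A := α * max 1 N ^ 2) (β := (2 * C) ^ 2 / α) (κ := (G ^ 2 / ν + δ) / (ν - 2 * δ)) (m := m)
      (T₀ := T₀) (hwc.mono (Set.Ici_subset_Ici.mpr hT₀0)) (hmc.mono (Set.Ici_subset_Ici.mpr hT₀0))
      (fun _ _ => sq_nonneg _) (by positivity)
      (div_nonneg (by positivity) (by linarith)) hsmall hm fun ε hε => ?_
    -- `diff_inequality` produces `2 η`, to be at most `ε`, and requires `4 η ≤ δ`.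
    set η := min (ε / 2) (δ / 4) with hη
    have hη0 : 0 < η := lt_min (by positivity) (by positivity)
    have hlow' : Tendsto (fun t => α * max 1 N ^ 2 * ‖projLow N (v₁ t - v₂ t)‖ ^ 2) atTop (𝓝 0) := by
      simpa using hlow.const_mul (α * max 1 N ^ 2)
    obtain ⟨T, hT⟩ := eventually_atTop.mp
      ((hg.eventually (gt_mem_nhds hη0)).and ((hlowV.eventually (gt_mem_nhds hη0)).and
        (hlow'.eventually (gt_mem_nhds hη0))))
    refine ⟨max T T₀, le_max_right _ _, fun s t hs hst => ?_⟩
    have hmax0 : 0 ≤ max T T₀ := hT₀0.trans (le_max_right _ _)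
    have he := hprim.energy (hmax0.trans hs) hst
    rw [he.2]
    refine integral_le_of_ae_le hmax0 hs hst he.1 ?_ ?_
    · exact ((continuousOn_const.add hmc).const_mul ε).sub
        ((continuousOn_const.sub (hmc.const_mul _)).mul hwc)
    · filter_upwards [ae_mem_domA hsol] with r hr hTr
      obtain ⟨h1, h2, h3⟩ := hT r ((le_max_left T T₀).trans hTr)
      refine (diff_inequality hC hN hθ₁ hθ₂ hθ hr.1 hr.2 (δ := δ) (ε := η) (by linarith)
        (by linarith [min_le_right (ε / 2) (δ / 4)]) h1.le h2.le h3.le).trans ?_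
      refine sub_le_sub_right (mul_le_mul_of_nonneg_right ?_ (by positivity)) _
      linarith [min_le_left (ε / 2) (δ / 4)]
  simpa using hmain.sqrt

end Dynamics

/-! ### From the linear smallness condition to the stated thresholds -/

theorem ae_norm_le_of_forces {θ₁ θ₂ : ℝ} {g₁ g₂ : ℝ → L2} (hg₁ : IsForce g₁) (hg₂ : IsForce g₂) :
    ∀ᵐ t ∂(volume.restrict (Set.Ioi (0 : ℝ))), ‖θ₂ • g₁ t + θ₁ • g₂ t‖ ≤
      (eLpNorm (fun t => θ₂ • g₁ t + θ₁ • g₂ t) ∞ (volume.restrict (Set.Ioi (0 : ℝ)))).toReal := by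
  have hmem : MemLp (fun t => θ₂ • g₁ t + θ₁ • g₂ t) ∞ (volume.restrict (Set.Ioi (0 : ℝ))) :=
    (hg₁.1.const_smul θ₂).add (hg₂.1.const_smul θ₁)
  filter_upwards [ae_le_eLpNormEssSup (f := fun t => θ₂ • g₁ t + θ₁ • g₂ t)
    (μ := volume.restrict (Set.Ioi (0 : ℝ)))] with t ht
  rw [← eLpNorm_exponent_top] at ht
  have := ENNReal.toReal_mono hmem.2.ne ht
  rwa [toReal_enorm] at this

theorem isSelfSynchronous_of_lt {ν N θ₁ θ₂ C : ℝ} {g₁ g₂ : ℝ → L2} (hC : IsLadyzhenskayaConst C)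
    (hν : 0 < ν) (hN : 0 ≤ N) (hθ₁ : 0 ≤ θ₁) (hθ₂ : 0 ≤ θ₂) (hθ : θ₁ + θ₂ = 1)
    (hg₁ : IsForce g₁) (hg₂ : IsForce g₂)
    (h : 2 * C * grashof ν θ₁ θ₂ g₁ g₂ < max 1 N) : IsSelfSynchronous ν N θ₁ θ₂ g₁ g₂ := by
  intro hg a₁ _ a₂ _ v₁ v₂ hsol
  refine synchronizes hC hν hN hθ₁ hθ₂ hθ ENNReal.toReal_nonneg (ae_norm_le_of_forces hg₁ hg₂) ?_
    hg hsol
  have h2 := mul_lt_mul_of_pos_left h (pow_pos hν 2)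
  rw [grashof] at h2
  refine lt_of_eq_of_lt ?_ h2
  field_simp

theorem grashof_nonneg {ν : ℝ} (θ₁ θ₂ : ℝ) (g₁ g₂ : ℝ → L2) : 0 ≤ grashof ν θ₁ θ₂ g₁ g₂ :=
  div_nonneg ENNReal.toReal_nonneg (sq_nonneg ν)

/-- Let `x = CL * gr`. Both branches give `N ≥ 15 x²`. If `2 x < 1` the maximum with 1 suffices;
otherwise `x ≥ 1/2` and `15 x² ≥ 7.5 x > 2 x`. -/
theorem lt_max_of_threshold_le {CL CA lam gr N : ℝ} (hCL : 0 < CL) (hgr : 0 ≤ gr)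
    (h : threshold CL CA lam gr ≤ N) : 2 * CL * gr < max 1 N := by
  have h3 : (1 : ℝ) ≤ √3 := Real.one_le_sqrt.mpr (by norm_num)
  have h27 : (1 : ℝ) ≤ √27 := Real.one_le_sqrt.mpr (by norm_num)
  have hx : 0 ≤ CL * gr := by positivity
  have hN : 15 * (CL * gr) ^ 2 ≤ N := by
    refine le_trans ?_ h
    unfold threshold
    split_ifs
    · refine le_trans ?_ (le_max_left _ _)
      have := mul_le_mul_of_nonneg_right h3 (sq_nonneg (CL * gr))
      nlinarith
    · have := mul_le_mul_of_nonneg_right h27 (sq_nonneg (CL * gr))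
      nlinarith
  by_cases h1 : 2 * (CL * gr) < 1
  · exact lt_max_of_lt_left (by linarith)
  · refine lt_max_of_lt_right ?_
    nlinarith

end NSE

end

theorem mainTheorem1 (ν : ℝ) (hν : 0 < ν) (θ₁ θ₂ : ℝ) (hθ₁ : 0 ≤ θ₁) (hθ₂ : 0 ≤ θ₂)
    (hθ : θ₁ + θ₂ = 1) (g₁ g₂ : ℝ → NSE.L2) (hg₁ : NSE.IsForce g₁) (hg₂ : NSE.IsForce g₂) :
    (∃ N₀ : ℝ, ∀ N : ℝ, 0 < N → N₀ ≤ N → NSE.IsSelfSynchronous ν N θ₁ θ₂ g₁ g₂) ∧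
    ∀ CL CA : ℝ, NSE.IsLadyzhenskayaConst CL → NSE.IsAgmonConst CA →
      ∀ N : ℝ, 0 < N →
        NSE.threshold CL CA θ₁ (NSE.grashof ν θ₁ θ₂ g₁ g₂) ≤ N →
          NSE.IsSelfSynchronous ν N θ₁ θ₂ g₁ g₂ := by
  -- The 3 is the proved Ladyzhenskaya constant; the added 1 makes the inequality strict.
  refine ⟨⟨2 * 3 * NSE.grashof ν θ₁ θ₂ g₁ g₂ + 1, fun N hN hle => ?_⟩,
    fun CL CA hCL _ N hN hle => ?_⟩
  · exact NSE.isSelfSynchronous_of_lt NSE.isLadyzhenskayaConst_three hν hN.le hθ₁ hθ₂ hθ hg₁ hg₂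
      (lt_max_of_lt_right (by linarith))
  · exact NSE.isSelfSynchronous_of_lt hCL hν hN.le hθ₁ hθ₂ hθ hg₁ hg₂
      (NSE.lt_max_of_threshold_le hCL.1 (NSE.grashof_nonneg _ _ _ _) hle)
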